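/- Let $M$ be a compact smooth manifold of dimension $2n$, let $\langle v+\xi,u+\eta\rangle=\frac12(\xi(u)+\eta(v))$ be the natural pairing on $TM\oplus T^*M$, and let $v+\xi$ act on forms by $(v+\xi)\cdot\alpha=i_v\alpha+\xi\wedge\alpha$. Let $\psi$ be a smooth complex differential form on $M$ which at every point is a nondegenerate pure spinor: $\psi_x\neq0$, $\ker\psi=\{e\in(TM\oplus T^*M)\otimes\mathbb C: e\cdot\psi=0\}$ has complex rank $2n$, and $\ker\psi\cap\overline{\ker\psi}=0$. Let $\mathcal J_\psi$ be the endomorphism of $TM\oplus T^*M$ equal to $-\sqrt{-1}$ on $\ker\psi$ and $\sqrt{-1}$ on $\overline{\ker\psi}$. Write $\langle\alpha,\beta\rangle_s=(\alpha\wedge\sigma\beta)_{[2n]}$, where $\sigma$ is $+1$ on forms of degree $\equiv 0,1$ and $-1$ on forms of degree $\equiv 2,3 \pmod 4$. Orient $M$ by the real nowhere vanishing top form $(\sqrt{-1})^{-n}\langle\psi,\overline\psi\rangle_s$. Let $\widetilde{\mathcal A}_\psi(M)$ be the set of smooth almost generalized complex structures $\mathcal J$ (orthogonal endomorphisms of $TM\oplus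 T^*M$ with $\mathcal J^2=-1$) that are $\psi$-compatible: $\mathcal J$ commutes with the almost generalized complex structure $\mathcal J_\psi$, and $\langle -\mathcal J\mathcal J_\psi\,\cdot,\cdot\rangle$ is positive definite. Let $P_{\psi,x}$ be the set of endomorphisms of $T_xM\oplus T_x^*M$ satisfying these conditions at $x$. Smoothness, openness and differentiation on spaces of sections refer to the $C^\infty$ (Fréchet) structure, in which a smooth finite-dimensional family of sections is one that is jointly smooth in the parameter and the point of $M$. Then: 1. The set of all $J$ on $\mathbb C^n\oplus\mathbb C^n$ such that $(J,\sqrt{-1})$ is a generalized Kähler pair for the real part of the standard Hermitian form of signature $(n,n)$ is homeomorphic to $U(n,n)/(U(n)\times U(n))$ via $[g]\mapsto g\,\mathrm{diag}(\sqrt{-1},-\sqrt{-1})\,g^{-1}$. Locally on $M$ there are smooth real-linear frames $L_x:\mathbb C^n\oplus\mathbb C^n\to T_xM\oplus T^*_xM$ that carry this form to $\langle\,,\rangle$ and $\sqrt{-1}$ to $\mathcal J_\psi$; conjugation by $L_x$ identifies this model set with $P_{\psi,x}$. Thus $P_\psi=\bigcup_xP_{\psi,x}$ is a fibre bundle with fibre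 $U(n,n)/(U(n)\times U(n))$, and $\widetilde{\mathcal A}_\psi(M)$ is the set of its smooth sections. 2. The tangent space (set of velocities of smooth families) of $\widetilde{\mathcal A}_\psi(M)$ at $\mathcal J$ is the space $T_{\mathcal J}$ of smooth sections $\dot{\mathcal J}$ of $\mathrm{so}(TM\oplus T^*M)$ with $\dot{\mathcal J}\mathcal J+\mathcal J\dot{\mathcal J}=0$ and $\dot{\mathcal J}\mathcal J_\psi=\mathcal J_\psi\dot{\mathcal J}$. The map $\dot{\mathcal J}\mapsto\mathcal J\dot{\mathcal J}$ is an integrable almost complex structure on $\widetilde{\mathcal A}_\psi(M)$: around every $\mathcal J_0$ there is a chart of $\widetilde{\mathcal A}_\psi(M)$ (acting fibrewise over $M$) onto an open subset of the complex Fréchet space $(T_{\mathcal J_0},\mathcal J_0\,\cdot)$ whose differential intertwines $\dot{\mathcal J}\mapsto\mathcal J\dot{\mathcal J}$ with $h\mapsto\mathcal J_0h$. 3. The form $$\omega_{\mathcal J}(\dot{\mathcal J}_1,\dot{\mathcal J}_2)=-\frac{1}{(\sqrt{-1})^{n}}\int_M\operatorname{tr}(\mathcal J\dot{\mathcal J}_1\dot{\mathcal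 J}_2)\,\langle\psi,\overline\psi\rangle_s$$ is a Kähler form on $\widetilde{\mathcal A}_\psi(M)$: it is a real, smooth, closed $2$-form, invariant under $\dot{\mathcal J}\mapsto\mathcal J\dot{\mathcal J}$, and $\omega_{\mathcal J}(\mathcal J\dot{\mathcal J}_1,\dot{\mathcal J}_2)$ equals the metric $g_{\mathcal J}(\dot{\mathcal J}_1,\dot{\mathcal J}_2)=(\sqrt{-1})^{-n}\int_M\operatorname{tr}(\dot{\mathcal J}_1\dot{\mathcal J}_2)\langle\psi,\overline\psi\rangle_s$, which is positive definite. -/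

import Mathlib

open scoped Manifold ContDiff TensorProduct Topology

namespace GenKahler

/-! ## Linear algebra of `V ⊕ V*` -/

section LinearAlgebra

section Structures

variable {W : Type*} [AddCommGroup W] [Module ℝ W] [TopologicalSpace W]

/-- `J` is a generalized complex structure on `(W, β)`: a `β`-orthogonal endomorphism with
`J² = -1`. (Such a `J` has determinant one, so it lies in `SO(W, β)`.) -/
def IsGenComplex (β : LinearMap.BilinForm ℝ W) (J : W →L[ℝ] W) : Prop :=
  (∀ e f, β (J e) (J f) = β e f) ∧ ∀ e, J (J e) = -e

/-- `(J₁, J₂)` is a generalized Kähler pair on `(W, β)`: two commuting generalized complex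
structures such that `Ĝ = -J₁ J₂` gives a positive definite form `β (Ĝ ·) ·`. -/
def IsGenKahlerPair (β : LinearMap.BilinForm ℝ W) (J₁ J₂ : W →L[ℝ] W) : Prop :=
  IsGenComplex β J₁ ∧ IsGenComplex β J₂ ∧ (∀ e, J₁ (J₂ e) = J₂ (J₁ e)) ∧
    ∀ e, e ≠ 0 → 0 < β (-(J₁ (J₂ e))) e

/-- `A` belongs to the Lie algebra `so(W, β)`. -/
def IsSkew (β : LinearMap.BilinForm ℝ W) (A : W →L[ℝ] W) : Prop :=
  ∀ e f, β (A e) f + β e (A f) = 0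

end Structures

/-- Complex conjugation on the complexification `ℂ ⊗ W` of a real vector space. -/
noncomputable def conjC (W : Type*) [AddCommGroup W] [Module ℝ W] :
    ℂ ⊗[ℝ] W →ₗ[ℝ] ℂ ⊗[ℝ] W :=
  LinearMap.rTensor W Complex.conjAe.toLinearMap

variable (V : Type*) [AddCommGroup V] [Module ℝ V] [TopologicalSpace V]
  [IsTopologicalAddGroup V] [ContinuousSMul ℝ V]

/-- `V ⊕ V*`. -/
abbrev GenTangent : Type _ := V × (V →L[ℝ] ℝ)

/-- The pairing `⟨v + ξ, u + η⟩ = (ξ(u) + η(v)) / 2` on `V ⊕ V*`. -/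
noncomputable def genPairing : LinearMap.BilinForm ℝ (GenTangent V) :=
  LinearMap.mk₂ ℝ (fun e f => (1 / 2) * (e.2 f.1 + f.2 e.1))
    (by intro a b c; simp; ring) (by intro r a b; simp; ring)
    (by intro a b c; simp; ring) (by intro r a b; simp; ring)

/-- The algebra `∧ V*` of real inhomogeneous forms. -/
abbrev RealForms : Type _ := ExteriorAlgebra ℝ (V →L[ℝ] ℝ)

/-- The algebra `∧ V* ⊗ ℂ` of complex inhomogeneous forms (spinors). -/
abbrev Forms : Type _ := ℂ ⊗[ℝ] RealForms V

/-- Evaluation of covectors at vectors, `V → V**`. -/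
noncomputable def evalVec : V →ₗ[ℝ] Module.Dual ℝ (V →L[ℝ] ℝ) :=
  LinearMap.mk₂ ℝ (fun v ξ => ξ v)
    (by intro a b c; simp) (by intro r a b; simp)
    (by intro a b c; simp) (by intro r a b; simp)

/-- Interior product `v ↦ i_v` on real forms. -/
noncomputable def interiorProd : V →ₗ[ℝ] RealForms V →ₗ[ℝ] RealForms V :=
  (CliffordAlgebra.contractLeft (Q := (0 : QuadraticForm ℝ (V →L[ℝ] ℝ)))).comp (evalVec V)

/-- The Clifford action `(v + ξ) · α = i_v α + ξ ∧ α` on real forms. -/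
noncomputable def cliffordAction : GenTangent V →ₗ[ℝ] RealForms V →ₗ[ℝ] RealForms V :=
  (interiorProd V).comp (LinearMap.fst ℝ V (V →L[ℝ] ℝ)) +
    ((LinearMap.mul ℝ (RealForms V)).comp (ExteriorAlgebra.ι ℝ)).comp
      (LinearMap.snd ℝ V (V →L[ℝ] ℝ))

variable {V}

/-- For a spinor `Φ`, the complex linear map `(V ⊕ V*) ⊗ ℂ → ∧ V* ⊗ ℂ`, `e ↦ e · Φ`. -/
noncomputable def spinAction (Φ : Forms V) : ℂ ⊗[ℝ] GenTangent V →ₗ[ℂ] Forms V :=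
  LinearMap.liftBaseChange ℂ
    { toFun := fun e => (cliffordAction V e).baseChange ℂ Φ
      map_add' := by intro a b; simp [LinearMap.baseChange_add]
      map_smul' := by intro r a; simp [LinearMap.baseChange_smul] }

/-- `ker Φ = {e ∈ (V ⊕ V*) ⊗ ℂ | e · Φ = 0}`. -/
noncomputable def spinKer (Φ : Forms V) : Submodule ℂ (ℂ ⊗[ℝ] GenTangent V) :=
  LinearMap.ker (spinAction Φ)

/-- `Φ` is a pure spinor: `Φ ≠ 0` and `ker Φ` (which is always isotropic) has the maximal possible
dimension `dim V`. (Then `Φ` is automatically of even or of odd type.) -/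
def IsPure (Φ : Forms V) : Prop :=
  Φ ≠ 0 ∧ Module.finrank ℂ (spinKer Φ) = Module.finrank ℝ V

/-- `Φ` is nondegenerate: `ker Φ` meets its complex conjugate only in `0`. -/
def IsNondegenerate (Φ : Forms V) : Prop :=
  ∀ e ∈ spinKer Φ, conjC (GenTangent V) e ∈ spinKer Φ → e = 0

/-- `J e = -√-1 e` for `e ∈ ker Φ`, and `J e = √-1 e` for `e` in the conjugate of `ker Φ`. -/
def Induces (Φ : Forms V) (J : GenTangent V →L[ℝ] GenTangent V) : Prop :=
  ∀ e ∈ spinKer Φ,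
    (J : GenTangent V →ₗ[ℝ] GenTangent V).baseChange ℂ e = -(Complex.I • e) ∧
    (J : GenTangent V →ₗ[ℝ] GenTangent V).baseChange ℂ (conjC (GenTangent V) e) =
      Complex.I • conjC (GenTangent V) e

open Classical in
/-- The generalized complex structure `J_Φ` on `V ⊕ V*` induced by a nondegenerate pure spinor `Φ`
(the unique `J` as in `Induces`; junk value `0` for other `Φ`). -/
noncomputable def inducedStructure (Φ : Forms V) : GenTangent V →L[ℝ] GenTangent V :=
  if h : ∃ J, Induces Φ J then h.choose else 0

/-- The involution `σ` of `∧ V* ⊗ ℂ`: `+1` in degrees `0, 1 mod 4`, `-1` in degrees `2, 3 mod 4`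
(reversal of the order of wedge products). -/
noncomputable def sigma : Forms V →ₗ[ℂ] Forms V :=
  (CliffordAlgebra.reverse (Q := (0 : QuadraticForm ℝ (V →L[ℝ] ℝ)))).baseChange ℂ

/-- The value `α(w₁, …, w_k)` of the component of degree `k` of a real form `α`, computed as the
scalar part of `i_{w_k} ⋯ i_{w_1} α`. -/
noncomputable def evalReal : (k : ℕ) → (Fin k → V) → (RealForms V →ₗ[ℝ] ℝ)
  | 0, _ => (ExteriorAlgebra.algebraMapInv (R := ℝ) (M := V →L[ℝ] ℝ)).toLinearMap
  | k + 1, w => (evalReal k (Fin.tail w)).comp (interiorProd V (w 0))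

/-- The value `α(w₁, …, w_k)` of the component of degree `k` of a complex form `α`. -/
noncomputable def evalForm {k : ℕ} (w : Fin k → V) : Forms V →ₗ[ℂ] ℂ :=
  (TensorProduct.AlgebraTensorModule.rid ℝ ℂ ℂ).toLinearMap.comp ((evalReal k w).baseChange ℂ)

/-- The value on `w₁, …, w_k`, `k = dim V`, of the spin pairing `⟨α, β⟩ = (α ∧ σβ)_{[dim V]}`. -/
noncomputable def spinPairing (α β : Forms V) {k : ℕ} (w : Fin k → V) : ℂ :=
  evalForm w (α * sigma β)

end LinearAlgebra

/-! ## The homogeneous space `U(n,n) / (U(n) × U(n))` -/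

section Homogeneous

open Matrix

/-- The matrix `diag(1_n, -1_n)`. -/
def signMatrix (n : ℕ) : Matrix (Fin n ⊕ Fin n) (Fin n ⊕ Fin n) ℂ :=
  Matrix.fromBlocks 1 0 0 (-1)

/-- `U(n,n)`, the group of complex matrices preserving the Hermitian form `diag(1_n, -1_n)`. -/
def Unn (n : ℕ) : Subgroup (GL (Fin n ⊕ Fin n) ℂ) where
  carrier := {g | (g : Matrix _ _ ℂ)ᴴ * signMatrix n * (g : Matrix _ _ ℂ) = signMatrix n}
  one_mem' := by simp
  mul_mem' := by
    intro a b ha hb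
    simp only [Set.mem_ofPred_eq] at ha hb ⊢
    rw [Units.val_mul, conjTranspose_mul]
    calc _ = (b : Matrix _ _ ℂ)ᴴ * ((a : Matrix _ _ ℂ)ᴴ * signMatrix n * (a : Matrix _ _ ℂ)) *
          (b : Matrix _ _ ℂ) := by simp only [Matrix.mul_assoc]
      _ = _ := by rw [ha, hb]
  inv_mem' := by
    intro a ha
    simp only [Set.mem_ofPred_eq] at ha ⊢
    have h1 : (a : Matrix _ _ ℂ) * (a⁻¹).val = 1 := by
      rw [← Units.val_mul]; simp
    have h2 : (a⁻¹).valᴴ * (a : Matrix _ _ ℂ)ᴴ = 1 := by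
      rw [← conjTranspose_mul, h1, conjTranspose_one]
    calc _ = (a⁻¹).valᴴ *
          ((a : Matrix _ _ ℂ)ᴴ * signMatrix n * (a : Matrix _ _ ℂ)) *
          (a⁻¹).val := by rw [ha]
      _ = ((a⁻¹).valᴴ * (a : Matrix _ _ ℂ)ᴴ) * signMatrix n *
          ((a : Matrix _ _ ℂ) * (a⁻¹).val) := by
            simp only [Matrix.mul_assoc]
      _ = _ := by rw [h1, h2]; simp

/-- `U(n) × U(n)`, embedded block-diagonally in `U(n,n)`. -/
def UnUn (n : ℕ) : Subgroup (Unn n) where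
  carrier := {g | ∃ a ∈ Matrix.unitaryGroup (Fin n) ℂ, ∃ b ∈ Matrix.unitaryGroup (Fin n) ℂ,
    ((g : GL (Fin n ⊕ Fin n) ℂ) : Matrix _ _ ℂ) = Matrix.fromBlocks a 0 0 b}
  one_mem' := ⟨1, one_mem _, 1, one_mem _, by simp⟩
  mul_mem' := by
    rintro g g' ⟨a, ha, b, hb, h⟩ ⟨a', ha', b', hb', h'⟩
    refine ⟨a * a', mul_mem ha ha', b * b', mul_mem hb hb', ?_⟩
    simp [h, h', Matrix.fromBlocks_multiply]
  inv_mem' := by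
    rintro g ⟨a, ha, b, hb, h⟩
    refine ⟨star a, Unitary.star_mem ha, star b, Unitary.star_mem hb, ?_⟩
    have h1 : Matrix.fromBlocks (star a) 0 0 (star b) *
        ((g : GL (Fin n ⊕ Fin n) ℂ) : Matrix _ _ ℂ) = 1 := by
      rw [h, Matrix.fromBlocks_multiply]
      simp [(Matrix.mem_unitaryGroup_iff').1 ha, (Matrix.mem_unitaryGroup_iff').1 hb]
    have h2 : ((g : GL (Fin n ⊕ Fin n) ℂ) : Matrix _ _ ℂ) *
        ((g : GL (Fin n ⊕ Fin n) ℂ)⁻¹).val = 1 := by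
      rw [← Units.val_mul]; simp
    rw [Subgroup.coe_inv]
    exact (left_inv_eq_right_inv h1 h2).symm

/-- The model space `ℂⁿ ⊕ ℂⁿ` (as a real vector space it has dimension `4n`). -/
abbrev ModelSpace (n : ℕ) : Type := Fin n ⊕ Fin n → ℂ

/-- The real part `Re (Σ conj(v_i) w_i - Σ conj(v'_i) w'_i)` of the standard Hermitian form of
signature `(n, n)` on `ℂⁿ ⊕ ℂⁿ`. -/
noncomputable def modelForm (n : ℕ) : LinearMap.BilinForm ℝ (ModelSpace n) :=
  LinearMap.mk₂ ℝ (fun v w => (star v ⬝ᵥ (signMatrix n *ᵥ w)).re)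
    (by intro a b c; simp [add_dotProduct]) (by intro r a b; simp)
    (by intro a b c; simp [Matrix.mulVec_add]) (by intro r a b; simp [Matrix.mulVec_smul])

/-- Multiplication by `√-1` on `ℂⁿ ⊕ ℂⁿ`. -/
noncomputable def modelI (n : ℕ) : ModelSpace n →L[ℝ] ModelSpace n :=
  Complex.I • ContinuousLinearMap.id ℝ (ModelSpace n)

/-- The real endomorphism of `ℂⁿ ⊕ ℂⁿ` given by a complex matrix. -/
noncomputable def matrixEnd {n : ℕ} (A : Matrix (Fin n ⊕ Fin n) (Fin n ⊕ Fin n) ℂ) :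
    ModelSpace n →L[ℝ] ModelSpace n :=
  (LinearMap.toContinuousLinearMap (Matrix.toLin' A)).restrictScalars ℝ

/-- The set of all `J` such that `(J, √-1)` is a generalized Kähler pair on `ℂⁿ ⊕ ℂⁿ`. -/
def modelFibre (n : ℕ) : Set (ModelSpace n →L[ℝ] ModelSpace n) :=
  {J | IsGenKahlerPair (modelForm n) J (modelI n)}

/-- The base point `diag(√-1, -√-1)`. -/
noncomputable def modelBase (n : ℕ) : Matrix (Fin n ⊕ Fin n) (Fin n ⊕ Fin n) ℂ :=
  Complex.I • signMatrix n

end Homogeneous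

/-! ## Sections over a manifold -/

section Manifold

/-- The model space `ℝ²ⁿ`. -/
abbrev Eu (n : ℕ) : Type := EuclideanSpace ℝ (Fin (2 * n))

variable {n : ℕ} {M : Type*} [TopologicalSpace M] [ChartedSpace (Eu n) M]

/-- The tangent space `T_x M`. -/
abbrev Tan (n : ℕ) {M : Type*} [TopologicalSpace M] [ChartedSpace (Eu n) M] (x : M) : Type :=
  TangentSpace (𝓡 (2 * n)) x

/-- Sections (no regularity imposed) of `End (TM ⊕ T*M)`. -/
abbrev EndField (n : ℕ) (M : Type*) [TopologicalSpace M] [ChartedSpace (Eu n) M] : Type _ :=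
  ∀ x : M, GenTangent (Tan n x) →L[ℝ] GenTangent (Tan n x)

/-- Inhomogeneous complex differential forms (no regularity imposed). -/
abbrev FormField (n : ℕ) (M : Type*) [TopologicalSpace M] [ChartedSpace (Eu n) M] : Type _ :=
  ∀ x : M, Forms (Tan n x)

variable [IsManifold (𝓡 (2 * n)) ∞ M]

/-- The coordinates `T_x M → ℝ²ⁿ` given by the chart at `c`, for `x` in the chart domain. -/
noncomputable def tanCoord (c x : M) : Tan n x →L[ℝ] Eu n :=
  (trivializationAt (Eu n) (TangentSpace (𝓡 (2 * n)) : M → Type _) c).continuousLinearMapAt ℝ x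

/-- The inverse `ℝ²ⁿ → T_x M`; it maps the standard basis to the coordinate frame of the chart
at `c`. -/
noncomputable def tanFrame (c x : M) : Eu n →L[ℝ] Tan n x :=
  (trivializationAt (Eu n) (TangentSpace (𝓡 (2 * n)) : M → Type _) c).symmL ℝ x

/-- The coordinates `(v, ξ)` on `T_x M ⊕ T_x* M` given by the chart at `c`. -/
noncomputable def genCoord (c x : M) : GenTangent (Tan n x) →L[ℝ] GenTangent (Eu n) :=
  ((tanCoord c x).comp (ContinuousLinearMap.fst ℝ _ _)).prod
    ((ContinuousLinearMap.precomp ℝ (tanFrame c x)).comp (ContinuousLinearMap.snd ℝ _ _))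

/-- The inverse of `genCoord`. -/
noncomputable def genFrame (c x : M) : GenTangent (Eu n) →L[ℝ] GenTangent (Tan n x) :=
  ((tanFrame c x).comp (ContinuousLinearMap.fst ℝ _ _)).prod
    ((ContinuousLinearMap.precomp ℝ (tanCoord c x)).comp (ContinuousLinearMap.snd ℝ _ _))

/-- The coordinate expression, in the chart at `c`, of an endomorphism of `T_x M ⊕ T_x* M`. -/
noncomputable def endCoord (c x : M) (A : GenTangent (Tan n x) →L[ℝ] GenTangent (Tan n x)) :
    GenTangent (Eu n) →L[ℝ] GenTangent (Eu n) :=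
  (genCoord c x).comp (A.comp (genFrame c x))

/-- `A` is a smooth section of `End (TM ⊕ T*M)`. -/
def IsSmoothField (A : EndField n M) : Prop :=
  ∀ c : M, ContMDiffOn (𝓡 (2 * n)) 𝓘(ℝ, GenTangent (Eu n) →L[ℝ] GenTangent (Eu n)) ∞
    (fun x => endCoord c x (A x)) (chartAt (Eu n) c).source

/-- `ψ` is a smooth complex inhomogeneous differential form: all its coefficients in charts are
smooth. -/
def IsSmoothForm (ψ : FormField n M) : Prop :=
  ∀ (c : M) (k : ℕ) (w : Fin k → Eu n), ContMDiffOn (𝓡 (2 * n)) 𝓘(ℝ, ℂ) ∞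
    (fun x => evalForm (fun j => tanFrame c x (w j)) (ψ x)) (chartAt (Eu n) c).source

/-- `t ↦ A t`, `t ∈ U`, is a smooth family of sections of `End (TM ⊕ T*M)`: it is jointly smooth in
`t` and `x ∈ M`. For open `U` and compact `M` these are exactly the smooth maps from `U` to the
Fréchet space of smooth sections with its `C^∞` topology. -/
def IsSmoothFamily {P : Type*} [NormedAddCommGroup P] [NormedSpace ℝ P] (U : Set P)
    (A : P → EndField n M) : Prop :=
  ∀ c : M, ContMDiffOn (𝓘(ℝ, P).prod (𝓡 (2 * n)))
    𝓘(ℝ, GenTangent (Eu n) →L[ℝ] GenTangent (Eu n)) ∞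
    (fun p : P × M => endCoord c p.2 (A p.1 p.2)) (U ×ˢ (chartAt (Eu n) c).source)

/-- The derivative at `t` in the direction `v` of a family of sections. -/
noncomputable def velocity {P : Type*} [NormedAddCommGroup P] [NormedSpace ℝ P]
    (A : P → EndField n M) (t v : P) : EndField n M :=
  fun x => fderiv ℝ (fun s => A s x) t v

/-! ### Almost generalized Kähler structures -/

/-- `J` is an almost generalized complex structure on `M`. -/
def IsAlmostGenComplex (J : EndField n M) : Prop :=
  IsSmoothField J ∧ ∀ x, IsGenComplex (genPairing (Tan n x)) (J x)

/-- `(J₁, J₂)` is an almost generalized Kähler structure on `M`. -/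
def IsAlmostGenKahler (J₁ J₂ : EndField n M) : Prop :=
  IsAlmostGenComplex J₁ ∧ IsAlmostGenComplex J₂ ∧
    ∀ x, IsGenKahlerPair (genPairing (Tan n x)) (J₁ x) (J₂ x)

/-- The structure `J_ψ` induced by `ψ`. -/
noncomputable def spinorStructure (ψ : FormField n M) : EndField n M :=
  fun x => inducedStructure (ψ x)

/-- The set `Ã_ψ(M)` of `ψ`-compatible almost generalized complex structures. -/
def Compatible (ψ : FormField n M) : Set (EndField n M) :=
  {J | IsAlmostGenKahler J (spinorStructure ψ)}

/-- The set `Ã_ψ(M)_x` of `ψ_x`-compatible generalized complex structures at the point `x`, the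
fibre at `x` of the bundle `P_ψ`. -/
def fibre (ψ : FormField n M) (x : M) :
    Set (GenTangent (Tan n x) →L[ℝ] GenTangent (Tan n x)) :=
  {J | IsGenKahlerPair (genPairing (Tan n x)) J (inducedStructure (ψ x))}

/-- The tangent space of `Ã_ψ(M)` at `J`: the smooth sections `a` of `so (TM ⊕ T*M)` which
anticommute with `J` and commute with `J_ψ`. -/
def tangentAt (ψ : FormField n M) (J : EndField n M) : Set (EndField n M) :=
  {a | IsSmoothField a ∧ ∀ x, IsSkew (genPairing (Tan n x)) (a x) ∧
    (a x).comp (J x) + (J x).comp (a x) = 0 ∧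
    (a x).comp (spinorStructure ψ x) = (spinorStructure ψ x).comp (a x)}

/-- The almost complex structure `a ↦ J a` on the tangent space at `J`. -/
noncomputable def acs (J a : EndField n M) : EndField n M := fun x => (J x).comp (a x)

/-! ### Integration over `M` -/

/-- A smooth partition of unity indexed by the points of `M`, the function with index `c` being
supported in the domain of the chart at `c`. -/
noncomputable def chartPartition (n : ℕ) (M : Type*) [TopologicalSpace M] [T2Space M]
    [CompactSpace M] [ChartedSpace (Eu n) M] [IsManifold (𝓡 (2 * n)) ∞ M] :
    SmoothPartitionOfUnity M (𝓡 (2 * n)) M Set.univ :=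
  (SmoothPartitionOfUnity.exists_isSubordinate_chartAt_source (𝓡 (2 * n)) M).choose

/-- The coefficient at `x` of a top degree form `θ` in the chart at `c`. -/
noncomputable def topCoeff (θ : ∀ x : M, (Fin (2 * n) → Tan n x) → ℂ) (c x : M) : ℂ :=
  θ x (fun j => tanFrame c x (EuclideanSpace.basisFun (Fin (2 * n)) ℝ j))

/-- The integral over `M` of the top degree form `θ`, where `M` is oriented by the nowhere vanishing
real top degree form `o`. -/
noncomputable def integralForm [T2Space M] [CompactSpace M]
    (o θ : ∀ x : M, (Fin (2 * n) → Tan n x) → ℂ) : ℂ :=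
  ∑ᶠ c : M, ∫ y in (chartAt (Eu n) c).target,
    ((chartPartition n M c ((chartAt (Eu n) c).symm y) *
      Real.sign (topCoeff o c ((chartAt (Eu n) c).symm y)).re : ℝ) : ℂ) *
      topCoeff θ c ((chartAt (Eu n) c).symm y)

/-- The top degree form `⟨ψ, ψ̄⟩`. -/
noncomputable def spinNorm (ψ : FormField n M) (x : M) (w : Fin (2 * n) → Tan n x) : ℂ :=
  spinPairing (ψ x) (conjC (RealForms (Tan n x)) (ψ x)) w

/-- `(√-1)^{-n} ∫_M f ⟨ψ, ψ̄⟩`. Here `M` carries its canonical orientation, in which the real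
top degree form `(√-1)^{-n} ⟨ψ, ψ̄⟩` is positive. -/
noncomputable def spinIntegral [T2Space M] [CompactSpace M] (ψ : FormField n M) (f : M → ℝ) : ℂ :=
  (Complex.I ^ n)⁻¹ * integralForm (fun x w => (Complex.I ^ n)⁻¹ * spinNorm ψ x w)
    (fun x w => (f x : ℂ) * spinNorm ψ x w)

/-- The `L²` metric `g_J(a, b) = (√-1)^{-n} ∫_M tr(a b) ⟨ψ, ψ̄⟩`. -/
noncomputable def l2Metric [T2Space M] [CompactSpace M] (ψ : FormField n M)
    (_J a b : EndField n M) : ℂ :=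
  spinIntegral ψ fun x => LinearMap.trace ℝ (GenTangent (Tan n x)) ((a x).comp (b x))

/-- The `L²` form `ω_J(a, b) = -(√-1)^{-n} ∫_M tr(J a b) ⟨ψ, ψ̄⟩`. -/
noncomputable def l2Form [T2Space M] [CompactSpace M] (ψ : FormField n M)
    (J a b : EndField n M) : ℂ :=
  -spinIntegral ψ fun x =>
    LinearMap.trace ℝ (GenTangent (Tan n x)) ((J x).comp ((a x).comp (b x)))

/-! ### Complex geometry of `Ã_ψ(M)` -/

/-- `D` is an open subset of the set `S` of sections: it has open preimage under every smooth
finite-dimensional family in `S`. (On the Fréchet space of smooth sections this is openness in the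
`C^∞` topology.) -/
def IsOpenIn (S D : Set (EndField n M)) : Prop :=
  D ⊆ S ∧ ∀ (m : ℕ) (U : Set (EuclideanSpace ℝ (Fin m)))
    (A : EuclideanSpace ℝ (Fin m) → EndField n M), IsOpen U → (∀ t ∈ U, A t ∈ S) →
    IsSmoothFamily U A → IsOpen {t | t ∈ U ∧ A t ∈ D}

/-- `Φ : D → T_{J₀} Ã_ψ(M)` is a holomorphic chart of `Ã_ψ(M)` around `J₀`: a diffeomorphism from an
open neighbourhood `D` of `J₀` onto an open subset of the complex Fréchet space
`(T_{J₀} Ã_ψ(M), J₀ ·)` whose derivative takes the almost complex structure `a ↦ J a` to the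
multiplication by the imaginary unit `h ↦ J₀ h`. The chart is moreover required to act fibrewise
over `M`. -/
structure IsHolomorphicChart (ψ : FormField n M) (J₀ : EndField n M) (D : Set (EndField n M))
    (Φ : EndField n M → EndField n M) : Prop where
  mem : J₀ ∈ D
  isOpen_source : IsOpenIn (Compatible ψ) D
  isOpen_target : IsOpenIn (tangentAt ψ J₀) (Φ '' D)
  injOn : Set.InjOn Φ D
  fibrewise : ∀ A ∈ D, ∀ B ∈ D, ∀ x, A x = B x → Φ A x = Φ B x
  smooth : ∀ (m : ℕ) (U : Set (EuclideanSpace ℝ (Fin m)))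
    (A : EuclideanSpace ℝ (Fin m) → EndField n M), IsOpen U → (∀ t ∈ U, A t ∈ D) →
    (IsSmoothFamily U A ↔ IsSmoothFamily U fun t => Φ (A t))
  holomorphic : ∀ (U : Set ℝ) (A B : ℝ → EndField n M), IsOpen U → 0 ∈ U →
    (∀ t ∈ U, A t ∈ D) → (∀ t ∈ U, B t ∈ D) → IsSmoothFamily U A → IsSmoothFamily U B →
    A 0 = B 0 → velocity B 0 1 = acs (A 0) (velocity A 0 1) →
    velocity (fun t => Φ (B t)) 0 1 = acs J₀ (velocity (fun t => Φ (A t)) 0 1)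

/-- `a ↦ J a` is an integrable almost complex structure on `Ã_ψ(M)`. -/
structure IsIntegrable (ψ : FormField n M) : Prop where
  mem_tangent : ∀ J ∈ Compatible ψ, ∀ a ∈ tangentAt ψ J, acs J a ∈ tangentAt ψ J
  square : ∀ J ∈ Compatible ψ, ∀ a ∈ tangentAt ψ J, acs J (acs J a) = -a
  exists_chart : ∀ J₀ ∈ Compatible ψ, ∃ D Φ, IsHolomorphicChart ψ J₀ D Φ

/-- `Ω` is a Kähler form on `Ã_ψ(M)` with its almost complex structure `a ↦ J a`: a smooth closed
real `2`-form, invariant under the almost complex structure, such that `(a, b) ↦ Ω_J(J a, b)` is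
positive definite. Smoothness and closedness of `Ω` are those of its pullbacks to all smooth
finite-dimensional families. -/
structure IsKahlerForm (ψ : FormField n M) (Ω : EndField n M → EndField n M → EndField n M → ℝ) :
    Prop where
  add_left : ∀ J ∈ Compatible ψ, ∀ a ∈ tangentAt ψ J, ∀ b ∈ tangentAt ψ J, ∀ c ∈ tangentAt ψ J,
    Ω J (a + b) c = Ω J a c + Ω J b c
  smul_left : ∀ J ∈ Compatible ψ, ∀ (r : ℝ), ∀ a ∈ tangentAt ψ J, ∀ b ∈ tangentAt ψ J,
    Ω J (r • a) b = r * Ω J a b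
  antisymm : ∀ J ∈ Compatible ψ, ∀ a ∈ tangentAt ψ J, ∀ b ∈ tangentAt ψ J, Ω J a b = -Ω J b a
  smooth : ∀ (m : ℕ) (U : Set (EuclideanSpace ℝ (Fin m)))
    (A : EuclideanSpace ℝ (Fin m) → EndField n M), IsOpen U → (∀ t ∈ U, A t ∈ Compatible ψ) →
    IsSmoothFamily U A → ∀ v w,
    ContDiffOn ℝ ∞ (fun t => Ω (A t) (velocity A t v) (velocity A t w)) U
  closed : ∀ (m : ℕ) (U : Set (EuclideanSpace ℝ (Fin m)))
    (A : EuclideanSpace ℝ (Fin m) → EndField n M), IsOpen U → (∀ t ∈ U, A t ∈ Compatible ψ) →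
    IsSmoothFamily U A → ∀ t ∈ U, ∀ u v w,
    fderiv ℝ (fun t => Ω (A t) (velocity A t v) (velocity A t w)) t u +
      fderiv ℝ (fun t => Ω (A t) (velocity A t w) (velocity A t u)) t v +
      fderiv ℝ (fun t => Ω (A t) (velocity A t u) (velocity A t v)) t w = 0
  invariant : ∀ J ∈ Compatible ψ, ∀ a ∈ tangentAt ψ J, ∀ b ∈ tangentAt ψ J,
    Ω J (acs J a) (acs J b) = Ω J a b
  pos : ∀ J ∈ Compatible ψ, ∀ a ∈ tangentAt ψ J, a ≠ 0 → 0 < Ω J (acs J a) a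

end Manifold

end GenKahler

open GenKahler

/-!
The proof translates spinors into Clifford algebra once and then works with endomorphisms only.

*The structure of the spinor.* For a nondegenerate pure spinor `ψ`, the endomorphism `J` attached
to its kernel is the unique real one with `cl (J w) ψ = √-1 cl w ψ` (`exists_intertwines`). Pairing
this with the conjugate spinor writes the matrix entries of `J` as quotients of Mukai pairings
(`spinPairing_cl_cl`), so `J` is smooth. The denominator `⟨ψ, ψ̄⟩` does not vanish because the forms
are an irreducible Clifford module (`spinPairing_conj_ne_zero`), and this is also why it orients
the manifold.

*The model fibre.* The group `U(n, n)` acts transitively on the generalized Kähler partners of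
`√-1`, and the square root of a positive Hermitian matrix gives a continuous section of the orbit
map, so the quotient is homeomorphic to the fibre (`exists_modelHomeomorph`). At one point a frame
comes from diagonalizing the Hermitian form of `J`, whose signature is `(n, n)` because `T M` is
isotropic (`exists_frame`). Nearby points are reached by the polar part of `(1 - J J₀) / 2`, which
depends smoothly on `J` (`exists_local_isometry`, `exists_localFrame`).

*The complex structure.* Fibrewise, the Cayley transform `μ = (J + J₀)⁻¹ (J - J₀)` maps the
compatible structures onto a bounded symmetric domain in the complex space of tangent vectors at
`J₀`, and its differential intertwines left multiplication by `J` with that by `J₀`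
(`isHolomorphicChart_cayley`). Its image is open among sections because the manifold is compact
(`isOpen_inBall`). The same chart realizes each tangent vector as the velocity of a smooth family.

*The Kähler form.* In a partition of unity the integral over the manifold is a finite sum of
ordinary integrals with nonnegative densities (`spinIntegral_eq`), so that it may be differentiated
under the integral sign (`fderiv_spinReal`). Everything else is a pointwise trace identity. A
product of three endomorphisms that anticommute with `J` has trace zero, hence the form is closed
(`tr_closed`); and a nonzero tangent vector `a` is self-adjoint for the positive definite metric
`⟨-J J_ψ ·, ·⟩`, hence `tr (a²) > 0` (`tr_mul_self_pos`).
-/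

set_option linter.unusedSectionVars false
set_option linter.style.haveILetI false
set_option linter.unusedSimpArgs false

namespace GenKahler

/-! ### Clifford action on forms -/

section Spinors

variable {V : Type*} [AddCommGroup V] [Module ℝ V] [TopologicalSpace V]
  [IsTopologicalAddGroup V] [ContinuousSMul ℝ V]

theorem genPairing_apply (e f : GenTangent V) :
    genPairing V e f = (1 / 2) * (e.2 f.1 + f.2 e.1) := rfl

theorem genPairing_comm (e f : GenTangent V) : genPairing V e f = genPairing V f e := by
  simp only [genPairing_apply]; ring

theorem interiorProd_one (v : V) : interiorProd V v 1 = 0 :=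
  CliffordAlgebra.contractLeft_one _ _

theorem interiorProd_ι_mul (v : V) (ξ : V →L[ℝ] ℝ) (a : RealForms V) :
    interiorProd V v (ExteriorAlgebra.ι ℝ ξ * a) =
      ξ v • a - ExteriorAlgebra.ι ℝ ξ * interiorProd V v a :=
  CliffordAlgebra.contractLeft_ι_mul _ _ _

theorem interiorProd_comm (v w : V) (a : RealForms V) :
    interiorProd V v (interiorProd V w a) = -interiorProd V w (interiorProd V v a) :=
  CliffordAlgebra.contractLeft_comm _ _ _

theorem interiorProd_self (v : V) (a : RealForms V) :
    interiorProd V v (interiorProd V v a) = 0 :=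
  CliffordAlgebra.contractLeft_contractLeft _ _

theorem cliffordAction_apply (e : GenTangent V) (a : RealForms V) :
    cliffordAction V e a = interiorProd V e.1 a + ExteriorAlgebra.ι ℝ e.2 * a := rfl

/-- The Clifford relation `e f + f e = 2 ⟨e, f⟩`. -/
theorem cliffordAction_anticomm (e f : GenTangent V) (a : RealForms V) :
    cliffordAction V e (cliffordAction V f a) + cliffordAction V f (cliffordAction V e a) =
      (2 * genPairing V e f) • a := by
  have h : ExteriorAlgebra.ι ℝ e.2 * (ExteriorAlgebra.ι ℝ f.2 * a) +
      ExteriorAlgebra.ι ℝ f.2 * (ExteriorAlgebra.ι ℝ e.2 * a) = 0 := by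
    rw [← mul_assoc, ← mul_assoc, ← add_mul, ExteriorAlgebra.ι_add_mul_swap, zero_mul]
  have h2 : 2 * genPairing V e f = f.2 e.1 + e.2 f.1 := by rw [genPairing_apply]; ring
  simp only [cliffordAction_apply, map_add, interiorProd_ι_mul, mul_add, h2, add_smul]
  rw [interiorProd_comm f.1 e.1, ← sub_eq_zero, ← h]
  abel

/-- The Clifford action of `V ⊕ V*` on complex forms. -/
noncomputable def cl (e : GenTangent V) : Forms V →ₗ[ℂ] Forms V :=
  (cliffordAction V e).baseChange ℂ

theorem cl_tmul (e : GenTangent V) (z : ℂ) (a : RealForms V) :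
    cl e (z ⊗ₜ[ℝ] a) = z ⊗ₜ[ℝ] cliffordAction V e a := rfl

theorem cl_add (e f : GenTangent V) (α : Forms V) : cl (e + f) α = cl e α + cl f α := by
  simp [cl, LinearMap.baseChange_add]

theorem ofReal_smul_tmul {W : Type*} [AddCommGroup W] [Module ℝ W] (r : ℝ) (z : ℂ) (a : W) :
    (r : ℂ) • (z ⊗ₜ[ℝ] a) = z ⊗ₜ[ℝ] (r • a) := by
  rw [TensorProduct.smul_tmul', ← TensorProduct.smul_tmul, smul_eq_mul, Complex.real_smul]

theorem cl_smul (r : ℝ) (e : GenTangent V) (α : Forms V) : cl (r • e) α = (r : ℂ) • cl e α := by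
  induction α using TensorProduct.induction_on with
  | zero => simp
  | tmul z a => rw [cl_tmul, cl_tmul, ofReal_smul_tmul, map_smul, LinearMap.smul_apply]
  | add x y hx hy => rw [map_add, map_add, hx, hy, smul_add]

theorem cl_zero (α : Forms V) : cl (0 : GenTangent V) α = 0 := by
  simpa using cl_smul 0 (0 : GenTangent V) α

theorem cl_neg (e : GenTangent V) (α : Forms V) : cl (-e) α = -cl e α := by
  apply eq_neg_of_add_eq_zero_left
  rw [← cl_add, neg_add_cancel, cl_zero]

theorem spinAction_tmul (Φ : Forms V) (z : ℂ) (e : GenTangent V) :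
    spinAction Φ (z ⊗ₜ[ℝ] e) = z • cl e Φ := rfl

theorem cl_anticomm (e f : GenTangent V) (α : Forms V) :
    cl e (cl f α) + cl f (cl e α) = ((2 * genPairing V e f : ℝ) : ℂ) • α := by
  induction α using TensorProduct.induction_on with
  | zero => simp
  | tmul z a =>
    rw [cl_tmul, cl_tmul, cl_tmul, cl_tmul, ← TensorProduct.tmul_add, cliffordAction_anticomm,
      ofReal_smul_tmul]
  | add x y hx hy =>
    simp only [map_add, smul_add, ← hx, ← hy]; abel

/-- The subspaces of forms containing the constants and stable under exterior multiplication by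
covectors are everything. -/
theorem forms_eq_top (T : Submodule ℂ (Forms V)) (h1 : (1 : Forms V) ∈ T)
    (hT : ∀ ξ : V →L[ℝ] ℝ, ∀ α ∈ T, cl ((0 : V), ξ) α ∈ T) : T = ⊤ := by
  have key : ∀ a : RealForms V, ∀ b : RealForms V, (1 : ℂ) ⊗ₜ[ℝ] b ∈ T →
      (1 : ℂ) ⊗ₜ[ℝ] (a * b) ∈ T := by
    intro a
    induction a using ExteriorAlgebra.induction with
    | algebraMap r =>
      intro b hb
      rw [← Algebra.smul_def, ← ofReal_smul_tmul]
      exact T.smul_mem _ hb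
    | ι ξ =>
      intro b hb
      have := hT ξ _ hb
      rwa [cl_tmul, cliffordAction_apply, map_zero, LinearMap.zero_apply, zero_add] at this
    | mul x y hx hy =>
      intro b hb
      rw [mul_assoc]
      exact hx _ (hy _ hb)
    | add x y hx hy =>
      intro b hb
      rw [add_mul, TensorProduct.tmul_add]
      exact T.add_mem (hx b hb) (hy b hb)
  rw [eq_top_iff]
  intro α _
  induction α using TensorProduct.induction_on with
  | zero => exact T.zero_mem
  | tmul z a =>
    have := T.smul_mem z (key a 1 h1)
    rwa [mul_one, TensorProduct.smul_tmul', smul_eq_mul, mul_one] at this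
  | add x y hx hy => exact T.add_mem (hx trivial) (hy trivial)

theorem cl_vec_one (v : V) : cl (v, (0 : V →L[ℝ] ℝ)) 1 = 0 := by
  change cl _ ((1 : ℂ) ⊗ₜ[ℝ] (1 : RealForms V)) = 0
  rw [cl_tmul, cliffordAction_apply]
  simp [interiorProd_one]

/-- Iterated interior product by the vectors of a list. -/
noncomputable def contractList (l : List V) (α : Forms V) : Forms V :=
  l.foldr (fun v β => cl (v, 0) β) α

theorem contractList_cons (v : V) (l : List V) (α : Forms V) :
    contractList (v :: l) α = cl (v, 0) (contractList l α) := rfl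

theorem cl_vec_comm (v w : V) (α : Forms V) :
    cl (v, 0) (cl (w, 0) α) = -cl (w, 0) (cl (v, 0) α) := by
  have := cl_anticomm (v, (0 : V →L[ℝ] ℝ)) (w, 0) α
  rw [genPairing_apply] at this
  simpa [add_eq_zero_iff_eq_neg] using this

theorem cl_vec_self (v : V) (α : Forms V) : cl (v, 0) (cl (v, 0) α) = 0 := by
  have := cl_anticomm (v, (0 : V →L[ℝ] ℝ)) (v, 0) α
  rw [genPairing_apply] at this
  simpa [← two_smul ℂ] using this

theorem cl_covec_comm (v w : V →L[ℝ] ℝ) (α : Forms V) :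
    cl (0, v) (cl (0, w) α) = -cl (0, w) (cl (0, v) α) := by
  have := cl_anticomm ((0 : V), v) (0, w) α
  rw [genPairing_apply] at this
  simpa [add_eq_zero_iff_eq_neg] using this

theorem cl_covec_self (v : V →L[ℝ] ℝ) (α : Forms V) : cl (0, v) (cl (0, v) α) = 0 := by
  have := cl_anticomm ((0 : V), v) (0, v) α
  rw [genPairing_apply] at this
  simpa [← two_smul ℂ] using this

theorem cl_vec_covec (v : V) (ξ : V →L[ℝ] ℝ) (α : Forms V) :
    cl (v, 0) (cl (0, ξ) α) = (ξ v : ℂ) • α - cl (0, ξ) (cl (v, 0) α) := by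
  have := cl_anticomm (v, (0 : V →L[ℝ] ℝ)) (0, ξ) α
  rw [genPairing_apply] at this
  rw [eq_sub_iff_add_eq, this]
  simp

section Basis

variable {ι : Type*} [Finite ι] {v : ι → V} {ξ : ι → V →L[ℝ] ℝ}

/-- Contracting a nonzero form with suitable vectors of a given list, one reaches a nonzero form
annihilated by all of them. -/
theorem exists_contractList_ne_zero (α : Forms V) (hα : α ≠ 0) (l : List V) :
    ∃ m : List V, contractList m α ≠ 0 ∧ ∀ u ∈ l, cl (u, 0) (contractList m α) = 0 := by
  induction l with
  | nil => exact ⟨[], hα, by simp⟩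
  | cons u l ih =>
    obtain ⟨m, hm, hl⟩ := ih
    by_cases h : cl (u, 0) (contractList m α) = 0
    · exact ⟨m, hm, by simpa [h] using hl⟩
    · refine ⟨u :: m, h, ?_⟩
      intro w hw
      rw [contractList_cons]
      rcases List.mem_cons.1 hw with rfl | hw
      · exact cl_vec_self _ _
      · rw [cl_vec_comm, hl w hw, map_zero, neg_zero]

/-- A form annihilated by all interior products with the vectors of a basis is constant: the
product of the commuting projections `i_{v_j} ∘ (ξ_j ∧ ·)` fixes such a form, and maps every form
to a constant. -/
theorem eq_smul_one_of_contract_eq_zero (hd : ∀ i, ξ i (v i) = 1)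
    (hd' : ∀ i j, i ≠ j → ξ i (v j) = 0) (hs : ⊤ ≤ Submodule.span ℝ (Set.range ξ))
    (α : Forms V) (hα : ∀ i, cl (v i, 0) α = 0) : ∃ c : ℂ, α = c • (1 : Forms V) := by
  classical
  cases nonempty_fintype ι
  -- `p i` is the projection `i_{v_i} ∘ (ξ_i ∧ ·)` and `P l` the product of those with index in `l`.
  let p : ι → Forms V →ₗ[ℂ] Forms V := fun i => cl (v i, 0) ∘ₗ cl (0, ξ i)
  let P : List ι → Forms V →ₗ[ℂ] Forms V := fun l => l.foldr (fun i q => p i ∘ₗ q) LinearMap.id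
  have hcons : ∀ i l x, P (i :: l) x = p i (P l x) := fun _ _ _ => rfl
  have hp : ∀ i x, cl (v i, 0) x = 0 → p i x = x := by
    intro i x hx
    simp [p, cl_vec_covec, hx, hd]
  have hfix : ∀ l x, (∀ i, cl (v i, 0) x = 0) → P l x = x := by
    intro l x hx
    induction l with
    | nil => rfl
    | cons i l ih => rw [hcons, ih, hp i x (hx i)]
  -- `p i` preserves the multiples of `ξ_j`, and kills those of `ξ_i`.
  have hx : ∀ i j x, ∃ y, p i (cl (0, ξ j) x) = cl (0, ξ j) y ∧ (i = j → y = 0) := by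
    intro i j x
    by_cases hij : i = j
    · subst hij
      exact ⟨0, by simp [p, cl_covec_self], fun _ => rfl⟩
    · refine ⟨p i x, ?_, fun h => absurd h hij⟩
      simp only [p, LinearMap.comp_apply]
      rw [cl_covec_comm, map_neg, cl_vec_covec, hd' j i (Ne.symm hij)]
      simp
  have hP : ∀ l j x, ∃ y, P l (cl (0, ξ j) x) = cl (0, ξ j) y ∧ (j ∈ l → y = 0) := by
    intro l j x
    induction l with
    | nil => exact ⟨x, rfl, by simp⟩
    | cons i l ih =>
      obtain ⟨y, hy, hy0⟩ := ih
      obtain ⟨z, hz, hz0⟩ := hx i j y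
      by_cases hjl : j ∈ l
      · refine ⟨0, ?_, fun _ => rfl⟩
        rw [hcons, hy, hy0 hjl]; simp
      · refine ⟨z, by rw [hcons, hy, hz], ?_⟩
        intro h
        rcases List.mem_cons.1 h with h | h
        · exact hz0 h.symm
        · exact absurd h hjl
  have hone : ∀ l, P l 1 = 1 := fun l => hfix l 1 fun i => cl_vec_one _
  -- The forms which the full product maps to constants contain `1` and are stable under exterior
  -- multiplication, hence they are all the forms.
  have htop : (Submodule.span ℂ {(1 : Forms V)}).comap (P Finset.univ.toList) = ⊤ := by
    apply forms_eq_top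
    · rw [Submodule.mem_comap, hone]
      exact Submodule.mem_span_singleton_self _
    · intro η x _
      have hη : η ∈ Submodule.span ℝ (Set.range ξ) := hs trivial
      rw [Submodule.mem_comap]
      induction hη using Submodule.span_induction with
      | mem η hη =>
        obtain ⟨j, rfl⟩ := hη
        obtain ⟨y, hy, hy0⟩ := hP Finset.univ.toList j x
        rw [hy, hy0 (by simp), map_zero]
        exact Submodule.zero_mem _
      | zero => rw [show ((0 : V), (0 : V →L[ℝ] ℝ)) = 0 from rfl, cl_zero, map_zero]
                exact Submodule.zero_mem _
      | add a b _ _ ha hb =>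
        have : ((0 : V), a + b) = (0, a) + (0, b) := by simp
        rw [this, cl_add, map_add]
        exact Submodule.add_mem _ ha hb
      | smul r a _ ha =>
        have : ((0 : V), r • a) = r • (0, a) := by simp
        rw [this, cl_smul, map_smul]
        exact Submodule.smul_mem _ _ ha
  have hmem : α ∈ (Submodule.span ℂ {(1 : Forms V)}).comap (P Finset.univ.toList) := by
    rw [htop]; trivial
  rw [Submodule.mem_comap, hfix _ _ hα] at hmem
  obtain ⟨c, hc⟩ := Submodule.mem_span_singleton.1 hmem
  exact ⟨c, hc.symm⟩

end Basis

variable [FiniteDimensional ℝ V] [T2Space V]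

/-- The covectors dual to a basis. -/
noncomputable def dualVec {ι : Type*} (b : Module.Basis ι ℝ V) (i : ι) : V →L[ℝ] ℝ :=
  LinearMap.toContinuousLinearMap (b.coord i)

theorem dualVec_apply {ι : Type*} (b : Module.Basis ι ℝ V) (i : ι) (u : V) :
    dualVec b i u = b.repr u i := rfl

theorem span_dualVec {ι : Type*} [Finite ι] (b : Module.Basis ι ℝ V) :
    ⊤ ≤ Submodule.span ℝ (Set.range (dualVec b)) := by
  cases nonempty_fintype ι
  intro η _
  have : η = ∑ i, η (b i) • dualVec b i := by
    ext u
    conv_lhs => rw [← b.sum_repr u]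
    simp [dualVec_apply, -Module.Basis.sum_repr, mul_comm]
  rw [this]
  exact Submodule.sum_mem _ fun i _ => Submodule.smul_mem _ _ (Submodule.subset_span ⟨i, rfl⟩)

/-- Every nonzero form is contracted to a nonzero constant by suitable vectors. -/
theorem exists_contractList_eq_smul_one (α : Forms V) (hα : α ≠ 0) :
    ∃ (m : List V) (c : ℂ), c ≠ 0 ∧ contractList m α = c • (1 : Forms V) := by
  let b := Module.finBasis ℝ V
  obtain ⟨m, hm, hl⟩ := exists_contractList_ne_zero α hα (List.ofFn b)
  obtain ⟨c, hc⟩ := eq_smul_one_of_contract_eq_zero (v := b) (ξ := dualVec b)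
    (by simp [dualVec_apply]) (by intro i j h; simp [dualVec_apply, Finsupp.single_apply, h.symm])
    (span_dualVec b) (contractList m α) (fun i => hl _ (by simp))
  refine ⟨m, c, ?_, hc⟩
  rintro rfl
  simp [hc] at hm

/-- The space of forms is an irreducible module over the Clifford algebra. -/
theorem forms_eq_top_of_stable (T : Submodule ℂ (Forms V))
    (hT : ∀ e : GenTangent V, ∀ α ∈ T, cl e α ∈ T) {α : Forms V} (hα : α ∈ T) (h0 : α ≠ 0) :
    T = ⊤ := by
  obtain ⟨m, c, hc, hm⟩ := exists_contractList_eq_smul_one α h0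
  have hmem : contractList m α ∈ T := by
    clear hm
    induction m with
    | nil => exact hα
    | cons u m ih => exact hT _ _ ih
  refine forms_eq_top T ?_ fun ξ β hβ => hT _ _ hβ
  rw [hm] at hmem
  simpa [smul_smul, hc] using T.smul_mem c⁻¹ hmem

instance : Module.Finite ℂ (Forms V) := by
  haveI : FiniteDimensional ℝ (V →L[ℝ] ℝ) :=
    LinearEquiv.finiteDimensional (LinearMap.toContinuousLinearMap (𝕜 := ℝ) (E := V) (F' := ℝ))
  haveI : Module.Finite ℝ (RealForms V) :=
    Module.Finite.of_basis (Module.finBasis ℝ (V →L[ℝ] ℝ)).ExteriorAlgebra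
  infer_instance

end Spinors

/-! ### The spin pairing -/

section Pairing

variable {V : Type*} [AddCommGroup V] [Module ℝ V] [TopologicalSpace V]
  [IsTopologicalAddGroup V] [ContinuousSMul ℝ V]

open CliffordAlgebra (involute reverse)

theorem realForms_induction {P : RealForms V → Prop}
    (algebraMap : ∀ r : ℝ, P (algebraMap ℝ (RealForms V) r))
    (add : ∀ x y, P x → P y → P (x + y))
    (ι_mul : ∀ (ξ : V →L[ℝ] ℝ) x, P x → P (ExteriorAlgebra.ι ℝ ξ * x)) (a : RealForms V) : P a :=
  CliffordAlgebra.left_induction _ algebraMap add (fun x ξ hx => ι_mul ξ x hx) a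

theorem involute_ext (ξ : V →L[ℝ] ℝ) :
    involute (Q := 0) (ExteriorAlgebra.ι ℝ ξ) = -ExteriorAlgebra.ι ℝ ξ :=
  CliffordAlgebra.involute_ι _

theorem reverse_ext (ξ : V →L[ℝ] ℝ) :
    reverse (Q := 0) (ExteriorAlgebra.ι ℝ ξ) = ExteriorAlgebra.ι ℝ ξ :=
  CliffordAlgebra.reverse_ι _

theorem interiorProd_algebraMap (v : V) (r : ℝ) :
    interiorProd V v (algebraMap ℝ (RealForms V) r) = 0 :=
  CliffordAlgebra.contractLeft_algebraMap (Q := (0 : QuadraticForm ℝ (V →L[ℝ] ℝ))) (evalVec V v) r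

theorem interiorProd_ι (v : V) (ξ : V →L[ℝ] ℝ) :
    interiorProd V v (ExteriorAlgebra.ι ℝ ξ) = algebraMap ℝ _ (ξ v) :=
  CliffordAlgebra.contractLeft_ι (Q := (0 : QuadraticForm ℝ (V →L[ℝ] ℝ))) (evalVec V v) ξ

theorem interiorProd_involute (v : V) (a : RealForms V) :
    interiorProd V v (involute a) = -involute (interiorProd V v a) := by
  induction a using realForms_induction with
  | algebraMap r => rw [AlgHom.commutes, interiorProd_algebraMap, map_zero, neg_zero]
  | add x y hx hy => rw [map_add, map_add, hx, hy, map_add, map_add, neg_add]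
  | ι_mul ξ x hx =>
    rw [map_mul, involute_ext, neg_mul, map_neg, interiorProd_ι_mul, interiorProd_ι_mul,
      hx, map_sub, map_smul, map_mul, involute_ext, mul_neg, neg_mul, sub_neg_eq_add]

/-- The interior product is an antiderivation. -/
theorem interiorProd_mul (v : V) (a b : RealForms V) :
    interiorProd V v (a * b) = interiorProd V v a * b + involute a * interiorProd V v b := by
  induction a using realForms_induction with
  | algebraMap r =>
    rw [AlgHom.commutes, interiorProd_algebraMap, zero_mul, zero_add, ← Algebra.smul_def,
      ← Algebra.smul_def, map_smul]
  | add x y hx hy => rw [add_mul, map_add, hx, hy, map_add, map_add, add_mul, add_mul]; abel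
  | ι_mul ξ x hx =>
    have h : involute (ExteriorAlgebra.ι ℝ ξ * x) = -ExteriorAlgebra.ι ℝ ξ * involute x := by
      rw [map_mul, involute_ext]
    rw [h, mul_assoc, interiorProd_ι_mul, interiorProd_ι_mul, hx, mul_add,
      sub_mul, smul_mul_assoc, neg_mul, neg_mul, mul_assoc, mul_assoc]
    abel

theorem involute_interiorProd_reverse (v : V) (a : RealForms V) :
    involute (interiorProd V v (reverse a)) = reverse (interiorProd V v a) := by
  induction a using realForms_induction with
  | algebraMap r =>
    rw [CliffordAlgebra.reverse.commutes]
    erw [interiorProd_algebraMap]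
    rw [map_zero, map_zero]
  | add x y hx hy => rw [map_add, map_add, map_add, hx, hy, map_add, map_add]
  | ι_mul ξ x hx =>
    rw [CliffordAlgebra.reverse.map_mul, reverse_ext, interiorProd_mul, interiorProd_ι, map_add,
      map_mul, map_mul, hx, involute_ext, CliffordAlgebra.involute_involute,
      AlgHom.commutes, interiorProd_ι_mul, map_sub, map_smul, CliffordAlgebra.reverse.map_mul,
      reverse_ext, ← Algebra.commutes, ← Algebra.smul_def, mul_neg]
    abel

theorem ι_mul_eq_involute_mul_ι (ξ : V →L[ℝ] ℝ) (a : RealForms V) :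
    ExteriorAlgebra.ι ℝ ξ * a = involute a * ExteriorAlgebra.ι ℝ ξ := by
  induction a using realForms_induction with
  | algebraMap r => rw [AlgHom.commutes]; exact (Algebra.commutes _ _).symm
  | add x y hx hy => rw [mul_add, map_add, add_mul, hx, hy]
  | ι_mul η x hx =>
    have h := ExteriorAlgebra.ι_add_mul_swap (R := ℝ) ξ η
    rw [add_eq_zero_iff_eq_neg] at h
    rw [map_mul, involute_ext, mul_assoc, ← hx, ← mul_assoc, h, neg_mul, neg_mul, mul_assoc]

theorem evalReal_zero (w : Fin 0 → V) (a : RealForms V) :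
    evalReal 0 w a = ExteriorAlgebra.algebraMapInv a := rfl

theorem evalReal_succ {k : ℕ} (w : Fin (k + 1) → V) (a : RealForms V) :
    evalReal (k + 1) w a = evalReal k (Fin.tail w) (interiorProd V (w 0) a) := rfl

theorem evalReal_involute {k : ℕ} (w : Fin k → V) (a : RealForms V) :
    evalReal k w (involute a) = (-1) ^ k * evalReal k w a := by
  induction k generalizing a with
  | zero =>
    have : (ExteriorAlgebra.algebraMapInv (R := ℝ) (M := V →L[ℝ] ℝ)).comp
        (involute (Q := (0 : QuadraticForm ℝ (V →L[ℝ] ℝ)))) = ExteriorAlgebra.algebraMapInv := by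
      apply ExteriorAlgebra.hom_ext
      ext ξ
      simp only [LinearMap.comp_apply, AlgHom.toLinearMap_apply, AlgHom.comp_apply]
      erw [CliffordAlgebra.involute_ι]
      rw [map_neg]
      erw [ExteriorAlgebra.lift_ι_apply]
      simp
    rw [evalReal_zero, evalReal_zero, pow_zero, one_mul]
    exact DFunLike.congr_fun this a
  | succ k ih =>
    rw [evalReal_succ, evalReal_succ, interiorProd_involute, map_neg, ih]
    ring

/-- In degree `k` the reversal acts by the sign `(-1)^(k (k - 1) / 2)`. -/
theorem evalReal_reverse {k : ℕ} (w : Fin k → V) (a : RealForms V) :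
    evalReal k w (reverse a) = (-1) ^ (k * (k - 1) / 2) * evalReal k w a := by
  induction k generalizing a with
  | zero =>
    have key : ∀ a : RealForms V, ExteriorAlgebra.algebraMapInv (reverse a) =
        ExteriorAlgebra.algebraMapInv a := by
      intro a
      induction a using CliffordAlgebra.left_induction with
      | algebraMap r => rw [CliffordAlgebra.reverse.commutes]
      | add x y hx hy => rw [map_add, map_add, map_add, hx, hy]
      | ι_mul x ξ hx =>
        rw [CliffordAlgebra.reverse.map_mul, CliffordAlgebra.reverse_ι, map_mul, map_mul, hx,
          mul_comm]
    rw [evalReal_zero, evalReal_zero, key a]; simp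
  | succ k ih =>
    have h : interiorProd V (w 0) (reverse a) = involute (reverse (interiorProd V (w 0) a)) := by
      rw [← involute_interiorProd_reverse, CliffordAlgebra.involute_involute]
    rw [evalReal_succ, evalReal_succ, h, evalReal_involute, ih, ← mul_assoc, ← pow_add]
    congr 2
    have := Nat.triangle_succ k
    omega

/-- An interior product has no component of top degree. -/
theorem evalReal_interiorProd_mem {k : ℕ} (w : Fin k → V) (j : Fin k) (a : RealForms V) :
    evalReal k w (interiorProd V (w j) a) = 0 := by
  induction k generalizing a with
  | zero => exact j.elim0
  | succ k ih =>
    rw [evalReal_succ]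
    refine Fin.cases ?_ (fun i => ?_) j
    · rw [interiorProd_self, map_zero]
    · rw [interiorProd_comm, map_neg, neg_eq_zero]
      exact ih (Fin.tail w) i _

theorem evalReal_interiorProd {k : ℕ} (w : Fin k → V)
    (hw : ⊤ ≤ Submodule.span ℝ (Set.range w)) (v : V) (a : RealForms V) :
    evalReal k w (interiorProd V v a) = 0 := by
  have hv : v ∈ Submodule.span ℝ (Set.range w) := hw trivial
  induction hv using Submodule.span_induction with
  | mem v hv => obtain ⟨j, rfl⟩ := hv; exact evalReal_interiorProd_mem w j a
  | zero => simp
  | add x y _ _ hx hy => rw [map_add, LinearMap.add_apply, map_add, hx, hy, add_zero]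
  | smul r x _ hx => rw [map_smul, LinearMap.smul_apply, map_smul, hx, smul_zero]

/-- The real spin pairing is skew with respect to the Clifford action in even dimension. -/
theorem evalReal_cliffordAction_mul {k : ℕ} (hk : Even k) (w : Fin k → V)
    (hw : ⊤ ≤ Submodule.span ℝ (Set.range w)) (e : GenTangent V) (a b : RealForms V) :
    evalReal k w (cliffordAction V e a * reverse b) =
      -evalReal k w (a * reverse (cliffordAction V e b)) := by
  have hinv : ∀ c : RealForms V, evalReal k w (involute c) = evalReal k w c := by
    intro c; rw [evalReal_involute, hk.neg_one_pow, one_mul]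
  have h1 : evalReal k w (interiorProd V e.1 a * reverse b) =
      -evalReal k w (a * reverse (interiorProd V e.1 b)) := by
    have h := evalReal_interiorProd w hw e.1 (a * reverse b)
    rw [interiorProd_mul, map_add, add_eq_zero_iff_eq_neg] at h
    rw [h, ← involute_interiorProd_reverse, ← hinv, map_mul, CliffordAlgebra.involute_involute]
  have h2 : evalReal k w (ExteriorAlgebra.ι ℝ e.2 * a * reverse b) =
      -evalReal k w (a * reverse (ExteriorAlgebra.ι ℝ e.2 * b)) := by
    have hr : reverse (ExteriorAlgebra.ι ℝ e.2 * b) = reverse b * ExteriorAlgebra.ι ℝ e.2 := by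
      rw [CliffordAlgebra.reverse.map_mul, reverse_ext]
    have hi : involute (ExteriorAlgebra.ι ℝ e.2) = -ExteriorAlgebra.ι ℝ e.2 :=
      CliffordAlgebra.involute_ι _
    -- Moving `e.2` to the other end applies the involution, which is trivial in even degree.
    rw [mul_assoc, ι_mul_eq_involute_mul_ι, hr, ← hinv, map_mul,
      CliffordAlgebra.involute_involute, hi, mul_neg, map_neg, mul_assoc]
  rw [cliffordAction_apply, cliffordAction_apply, add_mul, map_add, h1, h2, map_add, mul_add,
    map_add, neg_add]

theorem evalForm_tmul {k : ℕ} (w : Fin k → V) (z : ℂ) (a : RealForms V) :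
    evalForm w (z ⊗ₜ[ℝ] a) = z * evalReal k w a := by
  simp [evalForm]
  ring

theorem spinPairing_tmul {k : ℕ} (w : Fin k → V) (z z' : ℂ) (a b : RealForms V) :
    spinPairing (z ⊗ₜ[ℝ] a) (z' ⊗ₜ[ℝ] b) w = z * z' * evalReal k w (a * reverse b) := by
  have : sigma (z' ⊗ₜ[ℝ] b) = z' ⊗ₜ[ℝ] (reverse b : RealForms V) := rfl
  rw [spinPairing, this, Algebra.TensorProduct.tmul_mul_tmul, evalForm_tmul]

section
variable {k : ℕ} (w : Fin k → V) (α α' β β' : Forms V) (c : ℂ)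

theorem spinPairing_add_left :
    spinPairing (α + α') β w = spinPairing α β w + spinPairing α' β w := by
  simp [spinPairing, add_mul]

theorem spinPairing_add_right :
    spinPairing α (β + β') w = spinPairing α β w + spinPairing α β' w := by
  simp [spinPairing, mul_add]

theorem spinPairing_smul_left : spinPairing (c • α) β w = c * spinPairing α β w := by
  rw [spinPairing, spinPairing]; rw [smul_mul_assoc, map_smul, smul_eq_mul]

theorem spinPairing_smul_right : spinPairing α (c • β) w = c * spinPairing α β w := by
  rw [spinPairing, spinPairing]; rw [map_smul, mul_smul_comm, map_smul, smul_eq_mul]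

theorem spinPairing_zero_left : spinPairing 0 β w = 0 := by simp [spinPairing]

theorem spinPairing_zero_right : spinPairing α 0 w = 0 := by simp [spinPairing]

end

/-- The Clifford action of `V ⊕ V*` is skew for the spin pairing in even dimension. -/
theorem spinPairing_cl {k : ℕ} (hk : Even k) (w : Fin k → V)
    (hw : ⊤ ≤ Submodule.span ℝ (Set.range w)) (e : GenTangent V) (α β : Forms V) :
    spinPairing (cl e α) β w = -spinPairing α (cl e β) w := by
  induction α using TensorProduct.induction_on with
  | zero => simp [spinPairing_zero_left]
  | add x y hx hy =>
    rw [map_add, spinPairing_add_left, hx, hy, spinPairing_add_left, neg_add]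
  | tmul z a =>
    induction β using TensorProduct.induction_on with
    | zero => simp [spinPairing_zero_right]
    | add x y hx hy =>
      rw [map_add, spinPairing_add_right, hx, hy, spinPairing_add_right, neg_add]
    | tmul z' b =>
      rw [cl_tmul, cl_tmul, spinPairing_tmul, spinPairing_tmul,
        evalReal_cliffordAction_mul hk w hw]
      push_cast; ring

theorem conjC_tmul {W : Type*} [AddCommGroup W] [Module ℝ W] (z : ℂ) (a : W) :
    conjC W (z ⊗ₜ[ℝ] a) = (starRingEnd ℂ z) ⊗ₜ[ℝ] a := rfl

theorem conjC_smul {W : Type*} [AddCommGroup W] [Module ℝ W] (z : ℂ) (a : ℂ ⊗[ℝ] W) :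
    conjC W (z • a) = (starRingEnd ℂ z) • conjC W a := by
  induction a using TensorProduct.induction_on with
  | zero => simp
  | add x y hx hy => rw [smul_add, map_add, hx, hy, map_add, smul_add]
  | tmul z' b =>
    rw [TensorProduct.smul_tmul', conjC_tmul, conjC_tmul, TensorProduct.smul_tmul', smul_eq_mul,
      map_mul, smul_eq_mul]

theorem conjC_conjC {W : Type*} [AddCommGroup W] [Module ℝ W] (a : ℂ ⊗[ℝ] W) :
    conjC W (conjC W a) = a := by
  induction a using TensorProduct.induction_on with
  | zero => simp
  | add x y hx hy => rw [map_add, map_add, hx, hy]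
  | tmul z' b => rw [conjC_tmul, conjC_tmul, Complex.conj_conj]

theorem cl_conjC (e : GenTangent V) (α : Forms V) :
    cl e (conjC _ α) = conjC _ (cl e α) := by
  induction α using TensorProduct.induction_on with
  | zero => simp
  | add x y hx hy => simp only [map_add, hx, hy]
  | tmul z a => rfl

/-- In dimension `2n` the spin pairing is symmetric up to the sign `(-1)^n`, here in combination
with conjugation. -/
theorem spinPairing_conj_swap {n : ℕ} (w : Fin (2 * n) → V) (α β : Forms V) :
    starRingEnd ℂ (spinPairing α β w) =
      (-1) ^ n * spinPairing (conjC _ β) (conjC _ α) w := by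
  induction α using TensorProduct.induction_on with
  | zero => simp [spinPairing_zero_left, spinPairing_zero_right]
  | add x y hx hy =>
    rw [spinPairing_add_left, map_add, hx, hy, map_add, spinPairing_add_right, mul_add]
  | tmul z a =>
    induction β using TensorProduct.induction_on with
    | zero => simp [spinPairing_zero_left, spinPairing_zero_right]
    | add x y hx hy =>
      rw [spinPairing_add_right, map_add, hx, hy, map_add, spinPairing_add_left, mul_add]
    | tmul z' b =>
      rw [conjC_tmul, conjC_tmul, spinPairing_tmul, spinPairing_tmul]
      have h : b * reverse a = reverse (a * reverse b) := by
        rw [CliffordAlgebra.reverse.map_mul, CliffordAlgebra.reverse_reverse]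
      have hn : ((-1 : ℝ)) ^ (2 * n * (2 * n - 1) / 2) = (-1) ^ n := by
        rw [mul_assoc, Nat.mul_div_cancel_left _ two_pos]
        rcases Nat.eq_zero_or_pos n with rfl | hpos
        · simp
        · have : Odd (2 * n - 1) := ⟨n - 1, by omega⟩
          rw [mul_comm, pow_mul, this.neg_one_pow]
      rw [h, evalReal_reverse, hn, map_mul, map_mul, Complex.conj_ofReal]
      have h1 : ((-1 : ℂ)) ^ n * (-1) ^ n = 1 := by rw [← mul_pow]; simp
      push_cast
      linear_combination (-(starRingEnd ℂ z * starRingEnd ℂ z' *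
        (evalReal (2 * n) w (a * reverse b) : ℂ))) * h1

/-- The exterior product of covectors dual to `w` has value one on `w`. -/
theorem exists_evalReal_eq_one {k : ℕ} (w : Fin k → V) (ξ : Fin k → V →L[ℝ] ℝ)
    (h : ∀ i j, ξ i (w j) = if i = j then 1 else 0) :
    ∃ a : RealForms V, evalReal k w a = 1 ∧
      ∀ v, (∀ i, ξ i v = 0) → interiorProd V v a = 0 := by
  induction k with
  | zero => exact ⟨1, by rw [evalReal_zero, map_one], fun v _ => interiorProd_one v⟩
  | succ k ih =>
    obtain ⟨a, ha, ha'⟩ := ih (Fin.tail w) (Fin.tail ξ) (by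
      intro i j; simp only [Fin.tail, h, Fin.succ_inj])
    refine ⟨ExteriorAlgebra.ι ℝ (ξ 0) * a, ?_, ?_⟩
    · rw [evalReal_succ, interiorProd_ι_mul, ha' (w 0), h]
      · simpa using ha
      · intro i; simp [Fin.tail, h]
    · intro v hv
      rw [interiorProd_ι_mul, hv, ha' v fun i => hv _]
      simp

theorem evalForm_succ {k : ℕ} (w : Fin (k + 1) → V) (α : Forms V) :
    evalForm w α = evalForm (Fin.tail w) (cl (w 0, 0) α) := by
  induction α using TensorProduct.induction_on with
  | zero => simp
  | add x y hx hy => simp only [map_add, hx, hy]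
  | tmul z a =>
    rw [cl_tmul, evalForm_tmul, evalForm_tmul, cliffordAction_apply, evalReal_succ]
    simp

theorem evalForm_zero_one (w : Fin 0 → V) : evalForm w (1 : Forms V) = 1 := by
  change evalForm w ((1 : ℂ) ⊗ₜ[ℝ] (1 : RealForms V)) = 1
  rw [evalForm_tmul]
  simp [evalReal]

/-- The values of a form on all systems of vectors determine it. -/
theorem eq_zero_of_evalForm [FiniteDimensional ℝ V] [T2Space V] (α : Forms V)
    (h : ∀ (k : ℕ) (w : Fin k → V), evalForm w α = 0) : α = 0 := by
  by_contra h0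
  obtain ⟨m, c, hc, hm⟩ := exists_contractList_eq_smul_one α h0
  have key : ∀ m : List V, ∀ (k : ℕ) (w : Fin k → V), evalForm w (contractList m α) = 0 := by
    intro m
    induction m with
    | nil => exact h
    | cons v m ih =>
      intro k w
      have := ih (k + 1) (Fin.cons v w)
      rwa [evalForm_succ, Fin.tail_cons, Fin.cons_zero] at this
  have := key m 0 Fin.elim0
  rw [hm, map_smul, evalForm_zero_one] at this
  simp [hc] at this

end Pairing

/-! ### The structure induced by a nondegenerate pure spinor -/

section ReIm

variable {W : Type*} [AddCommGroup W] [Module ℝ W]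

/-- The real part `ℂ ⊗ W → W`. -/
noncomputable def reC (W : Type*) [AddCommGroup W] [Module ℝ W] : ℂ ⊗[ℝ] W →ₗ[ℝ] W :=
  (TensorProduct.lid ℝ W).toLinearMap ∘ₗ LinearMap.rTensor W Complex.reLm

/-- The imaginary part `ℂ ⊗ W → W`. -/
noncomputable def imC (W : Type*) [AddCommGroup W] [Module ℝ W] : ℂ ⊗[ℝ] W →ₗ[ℝ] W :=
  (TensorProduct.lid ℝ W).toLinearMap ∘ₗ LinearMap.rTensor W Complex.imLm

theorem reC_tmul (z : ℂ) (w : W) : reC W (z ⊗ₜ[ℝ] w) = z.re • w := by simp [reC]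

theorem imC_tmul (z : ℂ) (w : W) : imC W (z ⊗ₜ[ℝ] w) = z.im • w := by simp [imC]

theorem re_add_im_tmul (z : ℂ ⊗[ℝ] W) :
    (1 : ℂ) ⊗ₜ[ℝ] reC W z + Complex.I ⊗ₜ[ℝ] imC W z = z := by
  induction z using TensorProduct.induction_on with
  | zero => simp
  | add x y hx hy =>
    nth_rewrite 3 [← hx]
    nth_rewrite 3 [← hy]
    simp only [map_add, TensorProduct.tmul_add]
    abel
  | tmul z w =>
    rw [reC_tmul, imC_tmul, ← TensorProduct.smul_tmul, ← TensorProduct.smul_tmul,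
      ← TensorProduct.add_tmul]
    congr 1
    apply Complex.ext <;> simp

end ReIm

section PureSpinors

variable {V : Type*} [AddCommGroup V] [Module ℝ V] [TopologicalSpace V]
  [IsTopologicalAddGroup V] [ContinuousSMul ℝ V]

/-- The kernel in real terms: `a + √-1 b` annihilates `Φ` iff `b · Φ = √-1 (a · Φ)`. -/
theorem mem_spinKer_iff (Φ : Forms V) (a b : GenTangent V) :
    (1 : ℂ) ⊗ₜ[ℝ] a + Complex.I ⊗ₜ[ℝ] b ∈ spinKer Φ ↔ cl b Φ = Complex.I • cl a Φ := by
  rw [spinKer, LinearMap.mem_ker, map_add, spinAction_tmul, spinAction_tmul, one_smul]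
  constructor
  · intro h
    have := congrArg (fun x => Complex.I • x) h
    simp only [smul_add, smul_smul, Complex.I_mul_I, smul_zero, neg_smul, one_smul] at this
    exact (add_neg_eq_zero.1 this).symm
  · intro h
    rw [h, smul_smul, Complex.I_mul_I]; simp

/-- Clifford multiplication of `Φ` intertwines `J` with the multiplication by `√-1`. This is an
equation between real endomorphisms which characterizes the structure induced by `Φ`: the kernel of
`Φ` consists of the elements `w + √-1 J w`. -/
def Intertwines (Φ : Forms V) (J : GenTangent V →L[ℝ] GenTangent V) : Prop :=
  ∀ w, cl (J w) Φ = Complex.I • cl w Φ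

theorem conjC_re_im (a b : GenTangent V) :
    conjC (GenTangent V) ((1 : ℂ) ⊗ₜ[ℝ] a + Complex.I ⊗ₜ[ℝ] b) =
      (1 : ℂ) ⊗ₜ[ℝ] a + Complex.I ⊗ₜ[ℝ] (-b) := by
  rw [map_add, conjC_tmul, conjC_tmul, map_one, Complex.conj_I, TensorProduct.neg_tmul,
    TensorProduct.tmul_neg]

/-- Real elements of `V ⊕ V*` act injectively on a nondegenerate spinor. -/
theorem IsNondegenerate.eq_zero {Φ : Forms V} (h : IsNondegenerate Φ) {w : GenTangent V}
    (hw : cl w Φ = 0) : w = 0 := by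
  have h1 : (1 : ℂ) ⊗ₜ[ℝ] w + Complex.I ⊗ₜ[ℝ] (0 : GenTangent V) ∈ spinKer Φ := by
    rw [mem_spinKer_iff, cl_zero, hw, smul_zero]
  have h2 := h _ h1 (by rw [conjC_re_im, neg_zero]; exact h1)
  have h3 := congrArg (reC _) h2
  simpa [reC_tmul] using h3

/-- The intertwining structure is determined by a nondegenerate spinor. -/
theorem Intertwines.unique {Φ : Forms V} (h : IsNondegenerate Φ)
    {J : GenTangent V →L[ℝ] GenTangent V} (hJ : Intertwines Φ J) {a b : GenTangent V}
    (hab : cl b Φ = Complex.I • cl a Φ) : b = J a := by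
  rw [← sub_eq_zero]
  apply h.eq_zero
  rw [sub_eq_add_neg, cl_add, cl_neg, hJ, hab, add_neg_cancel]

/-- The real part maps `ker Φ` isomorphically onto `V ⊕ V*`, by nondegeneracy and a dimension
count, so that `ker Φ` is the graph of a real endomorphism. -/
theorem exists_intertwines [FiniteDimensional ℝ V] [T2Space V] {Φ : Forms V} (hp : IsPure Φ)
    (h : IsNondegenerate Φ) : ∃ J, Intertwines Φ J := by
  haveI : FiniteDimensional ℝ (V →L[ℝ] ℝ) :=
    LinearEquiv.finiteDimensional (LinearMap.toContinuousLinearMap (𝕜 := ℝ) (E := V) (F' := ℝ))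
  have hdim : Module.finrank ℝ (V →L[ℝ] ℝ) = Module.finrank ℝ V := by
    rw [← LinearEquiv.finrank_eq
      (LinearMap.toContinuousLinearMap (𝕜 := ℝ) (E := V) (F' := ℝ))]
    exact Subspace.dual_finrank_eq
  let L := (spinKer Φ).restrictScalars ℝ
  let ρ : L →ₗ[ℝ] GenTangent V := (reC (GenTangent V)).domRestrict L
  haveI : FiniteDimensional ℝ (ℂ ⊗[ℝ] GenTangent V) := inferInstance
  have hL : Module.finrank ℝ L = Module.finrank ℝ (GenTangent V) := by
    have h1 : Module.finrank ℝ L = Module.finrank ℝ ℂ * Module.finrank ℂ (spinKer Φ) :=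
      (Module.finrank_mul_finrank ℝ ℂ (spinKer Φ)).symm
    rw [h1, Complex.finrank_real_complex, hp.2, Module.finrank_prod, hdim]
    ring
  have hinj : Function.Injective ρ := by
    rw [← LinearMap.ker_eq_bot, LinearMap.ker_eq_bot']
    rintro ⟨z, hz⟩ hz0
    have hre : reC _ z = 0 := hz0
    have hz' : z ∈ spinKer Φ := hz
    have hdec := re_add_im_tmul z
    rw [hre] at hdec
    rw [← hdec, mem_spinKer_iff, cl_zero, smul_zero] at hz'
    have him := h.eq_zero hz'
    rw [him, TensorProduct.tmul_zero, TensorProduct.tmul_zero, add_zero] at hdec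
    exact Subtype.ext hdec.symm
  have hsurj : Function.Surjective ρ :=
    (LinearMap.injective_iff_surjective_of_finrank_eq_finrank hL).1 hinj
  let e := LinearEquiv.ofBijective ρ ⟨hinj, hsurj⟩
  let J : GenTangent V →ₗ[ℝ] GenTangent V :=
    (imC (GenTangent V)).domRestrict L ∘ₗ e.symm.toLinearMap
  refine ⟨LinearMap.toContinuousLinearMap J, fun w => ?_⟩
  have h1 : reC _ (e.symm w : ℂ ⊗[ℝ] GenTangent V) = w := e.apply_symm_apply w
  have h2 : (e.symm w : ℂ ⊗[ℝ] GenTangent V) ∈ spinKer Φ := (e.symm w).2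
  rw [← re_add_im_tmul (e.symm w : ℂ ⊗[ℝ] GenTangent V), mem_spinKer_iff, h1] at h2
  exact h2

theorem Intertwines.sq {Φ : Forms V} (h : IsNondegenerate Φ)
    {J : GenTangent V →L[ℝ] GenTangent V} (hJ : Intertwines Φ J) (w : GenTangent V) :
    J (J w) = -w := by
  symm
  apply hJ.unique h
  rw [hJ, smul_smul, Complex.I_mul_I, cl_neg]; simp

/-- The intertwining structure is orthogonal because `ker Φ` is isotropic. -/
theorem Intertwines.isGenComplex {Φ : Forms V} (h0 : Φ ≠ 0) (h : IsNondegenerate Φ)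
    {J : GenTangent V →L[ℝ] GenTangent V} (hJ : Intertwines Φ J) :
    IsGenComplex (genPairing V) J := by
  refine ⟨fun e f => ?_, hJ.sq h⟩
  -- the kernel of `Φ` is isotropic
  have hk : ∀ g, cl g Φ + Complex.I • cl (J g) Φ = 0 := by
    intro g
    rw [hJ, smul_smul, Complex.I_mul_I]; simp
  have hz : ∀ g g', cl g (cl g' Φ) + Complex.I • cl g (cl (J g') Φ) = 0 := by
    intro g g'
    rw [← map_smul, ← map_add, hk, map_zero]
  -- By the Clifford relation, twice the pairing of `e + √-1 J e` and `f + √-1 J f` annihilates `Φ`.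
  have h5 : (((2 * genPairing V e f : ℝ) : ℂ) - ((2 * genPairing V (J e) (J f) : ℝ) : ℂ) +
      Complex.I * (((2 * genPairing V e (J f) : ℝ) : ℂ) +
        ((2 * genPairing V (J e) f : ℝ) : ℂ))) • Φ = 0 := by
    rw [add_smul, sub_smul, mul_smul, add_smul, ← cl_anticomm, ← cl_anticomm, ← cl_anticomm,
      ← cl_anticomm]
    have hsum : (cl e (cl f Φ) + Complex.I • cl e (cl (J f) Φ)) +
        Complex.I • (cl (J e) (cl f Φ) + Complex.I • cl (J e) (cl (J f) Φ)) +
        (cl f (cl e Φ) + Complex.I • cl f (cl (J e) Φ)) +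
        Complex.I • (cl (J f) (cl e Φ) + Complex.I • cl (J f) (cl (J e) Φ)) = 0 := by
      simp only [hz, smul_zero, add_zero]
    rw [← hsum]
    simp only [smul_add, smul_smul, Complex.I_mul_I, neg_smul, one_smul]
    abel
  have h7 := (smul_eq_zero.1 h5).resolve_right h0
  have h8 := congrArg Complex.re h7
  simp at h8
  linarith

theorem Intertwines.induces {Φ : Forms V} (h : IsNondegenerate Φ)
    {J : GenTangent V →L[ℝ] GenTangent V} (hJ : Intertwines Φ J) : Induces Φ J := by
  intro z hz
  obtain ⟨a, b, rfl⟩ : ∃ a b, z = (1 : ℂ) ⊗ₜ[ℝ] a + Complex.I ⊗ₜ[ℝ] b :=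
    ⟨_, _, (re_add_im_tmul z).symm⟩
  rw [mem_spinKer_iff] at hz
  obtain rfl := hJ.unique h hz
  rw [conjC_re_im]
  have hI : ∀ w : GenTangent V, Complex.I • (Complex.I ⊗ₜ[ℝ] w) = -((1 : ℂ) ⊗ₜ[ℝ] w) := by
    intro w
    rw [TensorProduct.smul_tmul', smul_eq_mul, Complex.I_mul_I, TensorProduct.neg_tmul]
  have hI' : ∀ w : GenTangent V, Complex.I • ((1 : ℂ) ⊗ₜ[ℝ] w) = Complex.I ⊗ₜ[ℝ] w := by
    intro w
    rw [TensorProduct.smul_tmul', smul_eq_mul, mul_one]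
  constructor
  · rw [map_add, LinearMap.baseChange_tmul, LinearMap.baseChange_tmul,
      ContinuousLinearMap.coe_coe, hJ.sq h, smul_add, hI, hI', TensorProduct.tmul_neg]
    abel
  · rw [map_add, LinearMap.baseChange_tmul, LinearMap.baseChange_tmul,
      ContinuousLinearMap.coe_coe, map_neg, hJ.sq h, neg_neg, smul_add, TensorProduct.tmul_neg,
      smul_neg, hI, hI', neg_neg, add_comm]

theorem inducedStructure_intertwines [FiniteDimensional ℝ V] [T2Space V] {Φ : Forms V}
    (hp : IsPure Φ) (h : IsNondegenerate Φ) : Intertwines Φ (inducedStructure Φ) := by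
  obtain ⟨J, hJ⟩ := exists_intertwines hp h
  have hex : ∃ J, Induces Φ J := ⟨J, hJ.induces h⟩
  have hI : Induces Φ (inducedStructure Φ) := by
    rw [inducedStructure, dif_pos hex]; exact hex.choose_spec
  intro w
  have hmem : (1 : ℂ) ⊗ₜ[ℝ] w + Complex.I ⊗ₜ[ℝ] J w ∈ spinKer Φ := by
    rw [mem_spinKer_iff, hJ]
  have h1 := congrArg (reC _) (hI _ hmem).1
  have h2 : inducedStructure Φ w = J w := by
    simpa [reC_tmul, smul_add, TensorProduct.smul_tmul', TensorProduct.neg_tmul] using h1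
  rw [h2, hJ]

section Norm

variable {n : ℕ} (b : Module.Basis (Fin (2 * n)) ℝ V)

/-- The pairing of `e · f · Φ` with the conjugate of `Φ` recovers the induced structure. -/
theorem spinPairing_cl_cl {Φ : Forms V} {J : GenTangent V →L[ℝ] GenTangent V}
    (hJ : Intertwines Φ J) (e f : GenTangent V) :
    spinPairing (cl e (cl f Φ)) (conjC _ Φ) b =
      (genPairing V e f - Complex.I * genPairing V e (J f)) * spinPairing Φ (conjC _ Φ) b := by
  have hb : ⊤ ≤ Submodule.span ℝ (Set.range b) := b.span_eq.ge
  have hk : Even (2 * n) := even_two_mul n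
  have hconj : cl (J f) (conjC _ Φ) = -(Complex.I • cl f (conjC _ Φ)) := by
    rw [cl_conjC, hJ, conjC_smul, Complex.conj_I, cl_conjC, neg_smul]
  have h1 := congrArg (fun x => spinPairing x (conjC _ Φ) b) (cl_anticomm e f Φ)
  have h2 := congrArg (fun x => spinPairing x (conjC _ Φ) b) (cl_anticomm e (J f) Φ)
  simp only [spinPairing_add_left, spinPairing_smul_left] at h1 h2
  rw [hJ, map_smul, spinPairing_smul_left, spinPairing_cl hk _ hb (J f), hconj] at h2
  rw [spinPairing_cl hk _ hb f] at h1
  have h3 : spinPairing (cl e Φ) (-(Complex.I • cl f (conjC _ Φ))) b =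
      -(Complex.I * spinPairing (cl e Φ) (cl f (conjC _ Φ)) b) := by
    rw [← neg_smul, spinPairing_smul_right]; ring
  rw [h3] at h2
  push_cast at h1 h2
  linear_combination (1 / 2) * h1 - (Complex.I / 2) * h2 + (1 / 2) *
    (spinPairing (cl e (cl f Φ)) (conjC _ Φ) b + spinPairing (cl e Φ) (cl f (conjC _ Φ)) b) *
      Complex.I_sq

/-- A nondegenerate pure spinor pairs nontrivially with its conjugate. The products of the
operators `e - √-1 J e`, applied to `Φ`, span an irreducible Clifford module, hence give all
forms, and they all pair with the conjugate of `Φ` to a multiple of the pairing of `Φ` with it. -/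
theorem spinPairing_conj_ne_zero [FiniteDimensional ℝ V] [T2Space V] {Φ : Forms V} (h0 : Φ ≠ 0)
    {J : GenTangent V →L[ℝ] GenTangent V} (hJ : Intertwines Φ J) :
    spinPairing Φ (conjC _ Φ) b ≠ 0 := by
  intro hs
  have hb : ⊤ ≤ Submodule.span ℝ (Set.range b) := b.span_eq.ge
  have hk : Even (2 * n) := even_two_mul n
  -- `cm e` and `cp e` are the actions of `e - √-1 J e` and of `e + √-1 J e`, which lies in `ker Φ`.
  let cm : GenTangent V → Forms V →ₗ[ℂ] Forms V := fun e => cl e - Complex.I • cl (J e)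
  let cp : GenTangent V → Forms V →ₗ[ℂ] Forms V := fun e => cl e + Complex.I • cl (J e)
  let word : List (GenTangent V) → Forms V := fun l => l.foldr (fun e α => cm e α) Φ
  have hconj : ∀ f, cl (J f) (conjC _ Φ) = -(Complex.I • cl f (conjC _ Φ)) := by
    intro f
    rw [cl_conjC, hJ, conjC_smul, Complex.conj_I, cl_conjC, neg_smul]
  -- `cp` and `cm` anticommute up to scalars, and `cp` kills `Φ`, so the span of the words is stable
  -- under `cp`, hence under the Clifford action `cl = (cp + cm) / 2`.
  have hcomm : ∀ e f, ∃ c : ℂ, ∀ α, cp e (cm f α) = c • α - cm f (cp e α) := by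
    intro e f
    refine ⟨((2 * genPairing V e f : ℝ) : ℂ) + ((2 * genPairing V (J e) (J f) : ℝ) : ℂ) +
      Complex.I * (((2 * genPairing V (J e) f : ℝ) : ℂ) -
        ((2 * genPairing V e (J f) : ℝ) : ℂ)), fun α => ?_⟩
    rw [add_smul, add_smul, mul_smul, sub_smul, ← cl_anticomm, ← cl_anticomm, ← cl_anticomm,
      ← cl_anticomm]
    simp only [cp, cm, LinearMap.add_apply, LinearMap.sub_apply, LinearMap.smul_apply, map_add,
      map_sub, map_smul, smul_add, smul_sub, smul_smul, Complex.I_mul_I, neg_smul, one_smul]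
    abel
  have hcp : ∀ l e, cp e (word l) ∈ Submodule.span ℂ (Set.range word) := by
    intro l
    induction l with
    | nil =>
      intro e
      have : cp e (word []) = 0 := by
        simp only [cp, word, List.foldr_nil, LinearMap.add_apply, LinearMap.smul_apply]
        rw [hJ, smul_smul, Complex.I_mul_I]; simp
      rw [this]; exact Submodule.zero_mem _
    | cons f l ih =>
      intro e
      obtain ⟨c, hc⟩ := hcomm e f
      have : cp e (word (f :: l)) = c • word l - cm f (cp e (word l)) := hc _
      rw [this]
      refine Submodule.sub_mem _ (Submodule.smul_mem _ _ (Submodule.subset_span ⟨l, rfl⟩)) ?_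
      have hst : Submodule.span ℂ (Set.range word) ≤
          (Submodule.span ℂ (Set.range word)).comap (cm f) := by
        rw [Submodule.span_le]
        rintro _ ⟨l', rfl⟩
        exact Submodule.subset_span ⟨f :: l', rfl⟩
      exact hst (ih e)
  have hstable : ∀ e : GenTangent V, ∀ α ∈ Submodule.span ℂ (Set.range word),
      cl e α ∈ Submodule.span ℂ (Set.range word) := by
    intro e
    have : Submodule.span ℂ (Set.range word) ≤
          (Submodule.span ℂ (Set.range word)).comap (cl e) := by
      rw [Submodule.span_le]
      rintro _ ⟨l, rfl⟩
      have h1 : cl e (word l) = (1 / 2 : ℂ) • (cp e (word l) + word (e :: l)) := by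
        have : word (e :: l) = cm e (word l) := rfl
        rw [this]
        simp only [cp, cm, LinearMap.add_apply, LinearMap.sub_apply]
        rw [add_add_sub_cancel, ← two_smul ℂ, smul_smul]; norm_num
      rw [SetLike.mem_coe, Submodule.mem_comap, h1]
      exact Submodule.smul_mem _ _ (Submodule.add_mem _ (hcp l e) (Submodule.subset_span ⟨_, rfl⟩))
    exact this
  have htop := forms_eq_top_of_stable _ hstable (Submodule.subset_span ⟨[], rfl⟩) h0
  -- `cm e` annihilates the conjugate of `Φ`, so only the empty word could pair with it.
  have hword : ∀ l, spinPairing (word l) (conjC _ Φ) b = 0 := by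
    intro l
    cases l with
    | nil => exact hs
    | cons e l =>
      have h1 : spinPairing (cm e (word l)) (conjC _ Φ) b = 0 := by
        have : cm e (word l) = cl e (word l) + (-Complex.I) • cl (J e) (word l) := by
          simp [cm, sub_eq_add_neg]
        rw [this, spinPairing_add_left, spinPairing_smul_left, spinPairing_cl hk _ hb,
          spinPairing_cl hk _ hb, hconj, ← neg_smul, spinPairing_smul_right]
        linear_combination (-spinPairing (word l) (cl e (conjC _ Φ)) b) * Complex.I_sq
      exact h1
  have hall : ∀ α, spinPairing α (conjC _ Φ) b = 0 := by
    intro α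
    have hα : α ∈ Submodule.span ℂ (Set.range word) := by rw [htop]; trivial
    induction hα using Submodule.span_induction with
    | mem x hx => obtain ⟨l, rfl⟩ := hx; exact hword l
    | zero => exact spinPairing_zero_left _ _
    | add x y _ _ hx hy => rw [spinPairing_add_left, hx, hy, add_zero]
    | smul c x _ hx => rw [spinPairing_smul_left, hx, mul_zero]
  -- The radical of the spin pairing is a Clifford submodule which contains the conjugate of `Φ`, so
  -- the spin pairing vanishes altogether, which contradicts its value on a volume form and `1`.
  let R : Submodule ℂ (Forms V) :=
    { carrier := {β | ∀ α, spinPairing α β b = 0}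
      add_mem' := fun {x y} hx hy α => by rw [spinPairing_add_right, hx, hy, add_zero]
      zero_mem' := fun α => spinPairing_zero_right _ _
      smul_mem' := fun c x hx α => by rw [spinPairing_smul_right, hx, mul_zero] }
  have hR : R = ⊤ := by
    refine forms_eq_top_of_stable R (fun e β hβ α => ?_) (α := conjC _ Φ) hall ?_
    · have := spinPairing_cl hk _ hb e α β
      rw [hβ] at this
      exact neg_eq_zero.1 this.symm
    · intro h
      apply h0
      rw [← conjC_conjC Φ, h, map_zero]
  obtain ⟨a, ha, -⟩ := exists_evalReal_eq_one b (dualVec b) (by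
    intro i j
    simp [dualVec_apply, Finsupp.single_apply, eq_comm])
  have h1 : (1 : Forms V) ∈ R := by rw [hR]; trivial
  have h2 : spinPairing ((1 : ℂ) ⊗ₜ[ℝ] a) ((1 : ℂ) ⊗ₜ[ℝ] (1 : RealForms V)) b = 0 := h1 _
  rw [spinPairing_tmul, CliffordAlgebra.reverse.map_one, mul_one, mul_one a, ha] at h2
  simp at h2

/-- The number `(√-1)^{-n} ⟨Φ, Φ̄⟩` is real. -/
theorem spinPairing_conj_real (w : Fin (2 * n) → V) (Φ : Forms V) :
    ((Complex.I ^ n)⁻¹ * spinPairing Φ (conjC _ Φ) w).im = 0 := by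
  rw [← Complex.conj_eq_iff_im, map_mul, map_inv₀, map_pow, Complex.conj_I,
    spinPairing_conj_swap, conjC_conjC, ← mul_assoc]
  congr 1
  rw [neg_pow, mul_inv, mul_comm _ ((-1 : ℂ) ^ n), ← mul_assoc]
  have : ((-1 : ℂ) ^ n) * ((-1 : ℂ) ^ n)⁻¹ = 1 := mul_inv_cancel₀ (by simp)
  rw [this, one_mul]

end Norm

end PureSpinors

/-! ### Naturality under linear isomorphisms -/

section Naturality

variable {V : Type*} [AddCommGroup V] [Module ℝ V] [TopologicalSpace V]
  [IsTopologicalAddGroup V] [ContinuousSMul ℝ V]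
  {V' : Type*} [AddCommGroup V'] [Module ℝ V'] [TopologicalSpace V']
  [IsTopologicalAddGroup V'] [ContinuousSMul ℝ V']

/-- The isomorphism `V' ⊕ V'* ≃ V ⊕ V*` induced by `L : V' ≃ V`. -/
noncomputable def genMap (L : V' ≃L[ℝ] V) : GenTangent V' ≃L[ℝ] GenTangent V :=
  L.prodCongr (L.arrowCongr (ContinuousLinearEquiv.refl ℝ ℝ))

theorem genMap_apply (L : V' ≃L[ℝ] V) (e : GenTangent V') :
    genMap L e = (L e.1, e.2.comp (L.symm : V →L[ℝ] V')) := rfl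

theorem genPairing_genMap (L : V' ≃L[ℝ] V) (e f : GenTangent V') :
    genPairing V (genMap L e) (genMap L f) = genPairing V' e f := by
  simp [genPairing_apply, genMap_apply]

/-- The pullback of real forms along a linear isomorphism. -/
noncomputable def pullReal (L : V' ≃L[ℝ] V) : RealForms V →ₐ[ℝ] RealForms V' :=
  ExteriorAlgebra.map (ContinuousLinearMap.precomp ℝ (L : V' →L[ℝ] V)).toLinearMap

theorem pullReal_ι (L : V' ≃L[ℝ] V) (ξ : V →L[ℝ] ℝ) :
    pullReal L (ExteriorAlgebra.ι ℝ ξ) = ExteriorAlgebra.ι ℝ (ξ.comp (L : V' →L[ℝ] V)) :=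
  ExteriorAlgebra.map_apply_ι _ _

/-- The pullback of complex forms along a linear isomorphism. -/
noncomputable def pullForm (L : V' ≃L[ℝ] V) : Forms V →ₗ[ℂ] Forms V' :=
  (pullReal L).toLinearMap.baseChange ℂ

theorem pullForm_tmul (L : V' ≃L[ℝ] V) (z : ℂ) (a : RealForms V) :
    pullForm L (z ⊗ₜ[ℝ] a) = z ⊗ₜ[ℝ] pullReal L a := rfl

theorem interiorProd_map (L : V' ≃L[ℝ] V) (v : V') (a : RealForms V) :
    interiorProd V' v (pullReal L a) =
    pullReal L
      (interiorProd V (L v) a) := by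
  induction a using realForms_induction with
  | algebraMap r =>
    rw [AlgHom.commutes, interiorProd_algebraMap, interiorProd_algebraMap, map_zero]
  | add x y hx hy => rw [map_add, map_add, hx, hy, map_add, map_add]
  | ι_mul ξ x hx =>
    rw [map_mul, pullReal_ι, interiorProd_ι_mul, interiorProd_ι_mul, hx, map_sub,
      map_mul, map_smul, pullReal_ι]
    rfl

theorem cl_pullForm (L : V' ≃L[ℝ] V) (e : GenTangent V') (α : Forms V) :
    cl e (pullForm L α) = pullForm L (cl (genMap L e) α) := by
  induction α using TensorProduct.induction_on with
  | zero => simp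
  | add x y hx hy => simp only [map_add, hx, hy]
  | tmul z a =>
    rw [cl_tmul, pullForm_tmul, cl_tmul, pullForm_tmul, cliffordAction_apply, cliffordAction_apply,
      map_add, interiorProd_map, map_mul, pullReal_ι]
    have : (genMap L e).2.comp (L : V' →L[ℝ] V) = e.2 := by
      ext u
      simp [genMap_apply]
    rw [this]; rfl

theorem Intertwines.pullForm {Φ : Forms V} {J : GenTangent V →L[ℝ] GenTangent V}
    (hJ : Intertwines Φ J) (L : V' ≃L[ℝ] V) :
    Intertwines (pullForm L Φ) (((genMap L).symm : GenTangent V →L[ℝ] GenTangent V').comp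
      (J.comp (genMap L : GenTangent V' →L[ℝ] GenTangent V))) := by
  intro w
  rw [cl_pullForm, cl_pullForm, ← map_smul, ← hJ]
  simp

/-- `pullForm` is the usual pullback of multilinear forms. -/
theorem evalForm_pullForm (L : V' ≃L[ℝ] V) {k : ℕ} (w : Fin k → V') (α : Forms V) :
    evalForm w (GenKahler.pullForm L α) = evalForm (fun i => L (w i)) α := by
  induction k generalizing α with
  | zero =>
    induction α using TensorProduct.induction_on with
    | zero => simp
    | add x y hx hy => simp only [map_add, hx, hy]
    | tmul z a =>
      rw [pullForm_tmul, evalForm_tmul, evalForm_tmul, evalReal_zero, evalReal_zero]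
      congr 2
      have : (ExteriorAlgebra.algebraMapInv (R := ℝ)).comp (pullReal L) =
          ExteriorAlgebra.algebraMapInv := by
        apply ExteriorAlgebra.hom_ext
        ext ξ
        simp only [LinearMap.comp_apply, AlgHom.toLinearMap_apply, AlgHom.comp_apply,
          pullReal_ι]
        erw [ExteriorAlgebra.lift_ι_apply, ExteriorAlgebra.lift_ι_apply]
        rfl
      exact DFunLike.congr_fun this a
  | succ k ih =>
    rw [evalForm_succ, evalForm_succ, cl_pullForm]
    have : genMap L (w 0, 0) = (L (w 0), 0) := by simp [genMap_apply]
    rw [this, ih]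
    rfl

theorem conjC_pullForm (L : V' ≃L[ℝ] V) (α : Forms V) :
    conjC _ (pullForm L α) = pullForm L (conjC _ α) := by
  induction α using TensorProduct.induction_on with
  | zero => simp
  | add x y hx hy => simp only [map_add, hx, hy]
  | tmul z a => rfl

theorem pullForm_mul (L : V' ≃L[ℝ] V) (α β : Forms V) :
    pullForm L (α * β) = pullForm L α * pullForm L β :=
  map_mul (Algebra.TensorProduct.map (AlgHom.id ℂ ℂ) (pullReal L)) α β

theorem sigma_pullForm (L : V' ≃L[ℝ] V) (α : Forms V) :
    sigma (pullForm L α) = pullForm L (sigma α) := by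
  have hr : ∀ a : RealForms V, CliffordAlgebra.reverse (Q := 0) (pullReal L a) = pullReal L
        (CliffordAlgebra.reverse (Q := 0) a) := by
    intro a
    induction a using realForms_induction with
    | algebraMap r =>
      rw [AlgHom.commutes, CliffordAlgebra.reverse.commutes, CliffordAlgebra.reverse.commutes]
      exact (AlgHom.commutes _ _).symm
    | add x y hx hy => rw [map_add, map_add, hx, hy, map_add, map_add]
    | ι_mul ξ x hx =>
      rw [map_mul, CliffordAlgebra.reverse.map_mul, hx, pullReal_ι, reverse_ext,
        CliffordAlgebra.reverse.map_mul, reverse_ext, map_mul, pullReal_ι]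
  induction α using TensorProduct.induction_on with
  | zero => simp
  | add x y hx hy => simp only [map_add, hx, hy]
  | tmul z a =>
    exact congrArg (fun x => z ⊗ₜ[ℝ] x) (hr a)

theorem spinPairing_pullForm (L : V' ≃L[ℝ] V) (α β : Forms V) {k : ℕ} (w : Fin k → V') :
    spinPairing (pullForm L α) (pullForm L β) w = spinPairing α β (fun i => L (w i)) := by
  rw [spinPairing, sigma_pullForm, ← pullForm_mul, evalForm_pullForm, spinPairing]

end Naturality

/-! ### Smoothness of the induced structure -/

section Smooth

variable {V : Type*} [NormedAddCommGroup V] [NormedSpace ℝ V] [FiniteDimensional ℝ V]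
  {E : Type*} [NormedAddCommGroup E] [NormedSpace ℝ E]

/-- Linear functionals of a form are linear combinations of its coefficients. -/
theorem contDiffOn_functional {Φ : E → Forms V} {s : Set E}
    (h : ∀ (k : ℕ) (w : Fin k → V), ContDiffOn ℝ ∞ (fun x => evalForm w (Φ x)) s)
    (f : Module.Dual ℂ (Forms V)) : ContDiffOn ℝ ∞ (fun x => f (Φ x)) s := by
  let S : Submodule ℂ (Module.Dual ℂ (Forms V)) :=
    Submodule.span ℂ {g | ∃ (k : ℕ) (w : Fin k → V), g = evalForm w}
  have hS : S = ⊤ := by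
    -- A form on which all evaluations vanish is zero, so the evaluations span the dual space.
    have h0 : S.dualCoannihilator = ⊥ := by
      rw [eq_bot_iff]
      intro α hα
      rw [Submodule.mem_dualCoannihilator] at hα
      exact eq_zero_of_evalForm α fun k w => hα _ (Submodule.subset_span ⟨k, w, rfl⟩)
    rw [← Subspace.dualCoannihilator_dualAnnihilator_eq (W := S), h0,
      Submodule.dualAnnihilator_bot]
  have hf : f ∈ S := by rw [hS]; trivial
  induction hf using Submodule.span_induction with
  | mem g hg => obtain ⟨k, w, rfl⟩ := hg; exact h k w
  | zero => exact contDiffOn_const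
  | add g g' _ _ hg hg' => exact hg.add hg'
  | smul c g _ hg => exact contDiffOn_const.mul hg

/-- The spin pairing with the conjugate is sesquilinear, hence smooth in families of forms. -/
theorem contDiffOn_spinPairing {Φ : E → Forms V} {s : Set E}
    (h : ∀ (k : ℕ) (w : Fin k → V), ContDiffOn ℝ ∞ (fun x => evalForm w (Φ x)) s)
    (F : Forms V →ₗ[ℂ] Forms V) {k : ℕ} (w : Fin k → V) :
    ContDiffOn ℝ ∞ (fun x => spinPairing (F (Φ x)) (conjC _ (Φ x)) w) s := by
  let B := Module.finBasis ℂ (Forms V)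
  have h1 : ∀ α : Forms V, spinPairing (F α) (conjC _ α) w =
      ∑ i, ∑ j, B.coord i α * starRingEnd ℂ (B.coord j α) *
        spinPairing (F (B i)) (conjC _ (B j)) w := by
    intro α
    let f1 : Forms V → Module.Dual ℂ (Forms V) := fun β =>
      { toFun := fun γ => spinPairing (F γ) β w
        map_add' := fun x y => by rw [map_add, spinPairing_add_left]
        map_smul' := fun c x => by rw [map_smul, spinPairing_smul_left]; rfl }
    let f2 : Forms V → Module.Dual ℂ (Forms V) := fun β =>
      { toFun := fun γ => spinPairing (F β) γ w
        map_add' := fun x y => by rw [spinPairing_add_right]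
        map_smul' := fun c x => by rw [spinPairing_smul_right]; rfl }
    have e1 : ∀ β γ, spinPairing (F γ) β w = ∑ i, B.coord i γ * spinPairing (F (B i)) β w := by
      intro β γ
      change f1 β γ = ∑ i, B.coord i γ * f1 β (B i)
      conv_lhs => rw [← B.sum_repr γ]
      simp only [map_sum, map_smul, smul_eq_mul, Module.Basis.coord_apply]
    have e2 : ∀ β γ, spinPairing (F β) (conjC _ γ) w =
        ∑ j, starRingEnd ℂ (B.coord j γ) * spinPairing (F β) (conjC _ (B j)) w := by
      intro β γ
      change f2 β (conjC _ γ) = ∑ j, starRingEnd ℂ (B.coord j γ) * f2 β (conjC _ (B j))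
      conv_lhs => rw [← B.sum_repr γ]
      simp only [map_sum, conjC_smul, map_smul, smul_eq_mul, Module.Basis.coord_apply]
    rw [e1]
    refine Finset.sum_congr rfl fun i _ => ?_
    rw [e2, Finset.mul_sum]
    exact Finset.sum_congr rfl fun j _ => by ring
  simp only [h1]
  refine ContDiffOn.sum fun i _ => ContDiffOn.sum fun j _ => ?_
  refine ((contDiffOn_functional h (B.coord i)).mul ?_).mul contDiffOn_const
  exact Complex.conjCLE.contDiff.comp_contDiffOn (contDiffOn_functional h (B.coord j))

/-- A family of endomorphisms of `V ⊕ V*` is smooth if its matrix coefficients with respect to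
the pairing are. -/
theorem contDiffOn_of_genPairing {A : E → GenTangent V →L[ℝ] GenTangent V} {s : Set E}
    (h : ∀ e f, ContDiffOn ℝ ∞ (fun x => genPairing V e (A x f)) s) : ContDiffOn ℝ ∞ A s := by
  haveI : FiniteDimensional ℝ (V →L[ℝ] ℝ) := inferInstance
  rw [contDiffOn_clm_apply]
  intro f
  have h1 : ContDiffOn ℝ ∞ (fun x => (A x f).1) s := by
    let b := Module.finBasis ℝ V
    have : ∀ x, (A x f).1 = ∑ i, (2 * genPairing V (0, dualVec b i) (A x f)) • b i := by
      intro x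
      conv_lhs => rw [← b.sum_repr (A x f).1]
      simp [genPairing_apply, dualVec_apply]
    simp only [this]
    exact ContDiffOn.sum fun i _ => (contDiffOn_const.mul (h _ _)).smul contDiffOn_const
  have h2 : ContDiffOn ℝ ∞ (fun x => (A x f).2) s := by
    rw [contDiffOn_clm_apply]
    intro v
    have : ∀ x, (A x f).2 v = 2 * genPairing V (v, 0) (A x f) := by
      intro x; simp [genPairing_apply]
    simp only [this]
    exact contDiffOn_const.mul (h _ _)
  exact h1.prodMk h2

/-- The structure induced by a smooth family of nondegenerate pure spinors is smooth. -/
theorem contDiffOn_of_intertwines {n : ℕ} (b : Module.Basis (Fin (2 * n)) ℝ V) {Φ : E → Forms V}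
    {s : Set E} (h : ∀ (k : ℕ) (w : Fin k → V), ContDiffOn ℝ ∞ (fun x => evalForm w (Φ x)) s)
    {J : E → GenTangent V →L[ℝ] GenTangent V} (hJ : ∀ x ∈ s, Intertwines (Φ x) (J x))
    (h0 : ∀ x ∈ s, spinPairing (Φ x) (conjC _ (Φ x)) b ≠ 0) : ContDiffOn ℝ ∞ J s := by
  apply contDiffOn_of_genPairing
  intro e f
  have h1 := contDiffOn_spinPairing h (cl e ∘ₗ cl f) b
  have h2 := contDiffOn_spinPairing h LinearMap.id b
  have h3 : ContDiffOn ℝ ∞ (fun x => spinPairing ((cl e ∘ₗ cl f) (Φ x)) (conjC _ (Φ x)) b *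
      (spinPairing (LinearMap.id (R := ℂ) (Φ x)) (conjC _ (Φ x)) b)⁻¹) s :=
    h1.mul (h2.inv h0)
  have h4 : ∀ x ∈ s, genPairing V e (J x f) = -Complex.imCLM
      (spinPairing ((cl e ∘ₗ cl f) (Φ x)) (conjC _ (Φ x)) b *
      (spinPairing (LinearMap.id (R := ℂ) (Φ x)) (conjC _ (Φ x)) b)⁻¹) := by
    intro x hx
    -- The quotient is `⟨e, f⟩ - √-1 ⟨e, J f⟩`, whose imaginary part gives the coefficients of `J`.
    rw [LinearMap.comp_apply, spinPairing_cl_cl b (hJ x hx), LinearMap.id_apply, mul_assoc,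
      mul_inv_cancel₀ (h0 x hx)]
    simp
  exact ((Complex.imCLM.contDiff.comp_contDiffOn h3).neg).congr h4

end Smooth

/-! ### The Cayley transform on a fibre -/

section Cayley

variable {W : Type*} [AddCommGroup W] [Module ℝ W] [TopologicalSpace W]

theorem IsGenComplex.skew {β : LinearMap.BilinForm ℝ W} {J : W →L[ℝ] W} (hJ : IsGenComplex β J)
    (e f : W) : β (J e) f = -β e (J f) := by
  have := hJ.1 e (J f)
  rw [hJ.2, map_neg] at this
  linarith

variable [IsTopologicalAddGroup W] [ContinuousSMul ℝ W]

theorem IsGenComplex.mul_self {β : LinearMap.BilinForm ℝ W} {J : W →L[ℝ] W}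
    (hJ : IsGenComplex β J) : J * J = -1 := by
  ext e; exact hJ.2 e

/-- An injective endomorphism of a finite-dimensional space is invertible. -/
theorem isUnit_of_injective [FiniteDimensional ℝ W] [T2Space W] (A : W →L[ℝ] W)
    (h : ∀ e, A e = 0 → e = 0) : IsUnit A := by
  have hinj : Function.Injective (A : W →ₗ[ℝ] W) := by
    rw [← LinearMap.ker_eq_bot, LinearMap.ker_eq_bot']; exact h
  let e := LinearEquiv.ofInjectiveEndo (A : W →ₗ[ℝ] W) hinj
  let B : W →L[ℝ] W := LinearMap.toContinuousLinearMap e.symm.toLinearMap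
  refine ⟨⟨A, B, ?_, ?_⟩, rfl⟩
  · ext x; exact e.apply_symm_apply x
  · ext x; exact e.symm_apply_apply x

/-- The Cayley transform `(J + J₀)⁻¹ (J - J₀)`. -/
noncomputable def cayley (J₀ J : W →L[ℝ] W) : W →L[ℝ] W := Ring.inverse (J + J₀) * (J - J₀)

/-- The inverse Cayley transform `(1 - μ) J₀ (1 - μ)⁻¹`. -/
noncomputable def cayleyInv (J₀ μ : W →L[ℝ] W) : W →L[ℝ] W :=
  (1 - μ) * J₀ * Ring.inverse (1 - μ)

/-- The conditions at a point which define the tangent space at `J₀`. -/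
def IsTangent (β : LinearMap.BilinForm ℝ W) (I J₀ a : W →L[ℝ] W) : Prop :=
  IsSkew β a ∧ a.comp J₀ + J₀.comp a = 0 ∧ a.comp I = I.comp a

/-- The image of the Cayley transform: the unit ball of the bounded symmetric domain. -/
def InBall (β : LinearMap.BilinForm ℝ W) (I J₀ μ : W →L[ℝ] W) : Prop :=
  ∀ e, e ≠ 0 → 0 < β ((1 - μ) (-(J₀ (I e)))) ((1 - μ) e)

variable {β : LinearMap.BilinForm ℝ W} {I J₀ J μ : W →L[ℝ] W}

theorem IsTangent.mul_J (h : IsTangent β I J₀ μ) : μ * J₀ = -(J₀ * μ) :=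
  eq_neg_of_add_eq_zero_left h.2.1

theorem IsTangent.comm (h : IsTangent β I J₀ μ) : μ * I = I * μ := h.2.2

theorem IsGenKahlerPair.comm (h : IsGenKahlerPair β J I) : J * I = I * J := by
  ext e; exact h.2.2.1 e

section

variable [FiniteDimensional ℝ W] [T2Space W]

/-- The sum of two positive structures is invertible. -/
theorem isUnit_add (h : IsGenKahlerPair β J I) (h₀ : IsGenKahlerPair β J₀ I) :
    IsUnit (J + J₀) := by
  apply isUnit_of_injective
  intro e he
  by_contra hne
  have hI : I (-(I e)) = e := by rw [map_neg, h.2.1.2, neg_neg]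
  have hne' : -(I e) ≠ 0 := by
    intro h0; rw [h0, map_zero] at hI; exact hne hI.symm
  have h1 := h.2.2.2 _ hne'
  have h2 := h₀.2.2.2 _ hne'
  rw [hI] at h1 h2
  have h3 : β (-((J + J₀) e)) (-(I e)) = β (-(J e)) (-(I e)) + β (-(J₀ e)) (-(I e)) := by
    rw [← LinearMap.add_apply, ← map_add, add_apply, neg_add]
  rw [he] at h3
  simp only [neg_zero, map_zero, LinearMap.zero_apply] at h3
  linarith

theorem add_mul_cayley (h : IsGenKahlerPair β J I) (h₀ : IsGenKahlerPair β J₀ I) :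
    (J + J₀) * cayley J₀ J = J - J₀ := by
  rw [cayley, Ring.mul_inverse_cancel_left _ _ (isUnit_add h h₀)]

/-- In particular `1 - μ = 2 (J + J₀)⁻¹ J₀` for the Cayley transform `μ` of `J`. -/
theorem add_mul_one_sub_cayley (h : IsGenKahlerPair β J I) (h₀ : IsGenKahlerPair β J₀ I) :
    (J + J₀) * (1 - cayley J₀ J) = 2 * J₀ := by
  rw [mul_sub, add_mul_cayley h h₀, mul_one, two_mul]; abel

theorem isUnit_one_sub_cayley (h : IsGenKahlerPair β J I) (h₀ : IsGenKahlerPair β J₀ I) :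
    IsUnit (1 - cayley J₀ J) := by
  have hT := isUnit_add h h₀
  have h2 : IsUnit ((J + J₀) * (1 - cayley J₀ J)) := by
    rw [add_mul_one_sub_cayley h h₀]
    have hJ : IsUnit J₀ := ⟨⟨J₀, -J₀, by rw [mul_neg, h₀.1.mul_self, neg_neg],
      by rw [neg_mul, h₀.1.mul_self, neg_neg]⟩, rfl⟩
    have hh : (1 / 2 : ℝ) • (2 : W →L[ℝ] W) = 1 := by
      have : (2 : W →L[ℝ] W) = (2 : ℝ) • 1 := by rw [two_smul, one_add_one_eq_two]
      rw [this, smul_smul]; norm_num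
    have : IsUnit (2 : W →L[ℝ] W) :=
      ⟨⟨2, (1 / 2 : ℝ) • 1, by rw [mul_smul_comm, mul_one, hh],
        by rw [smul_mul_assoc, one_mul, hh]⟩, rfl⟩
    exact this.mul hJ
  exact (hT.mul_left_iff).1 h2

/-- Since `(J + J₀) J = J₀ (J + J₀)`, the operator `1 - μ` conjugates `J₀` into `J`. -/
theorem mul_one_sub_cayley (h : IsGenKahlerPair β J I) (h₀ : IsGenKahlerPair β J₀ I) :
    J * (1 - cayley J₀ J) = (1 - cayley J₀ J) * J₀ := by
  apply (isUnit_add h h₀).mul_left_cancel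
  have h1 : (J + J₀) * J = J₀ * (J + J₀) := by
    rw [add_mul, mul_add, h.1.mul_self, h₀.1.mul_self, add_comm]
  rw [← mul_assoc, h1, mul_assoc, add_mul_one_sub_cayley h h₀, ← mul_assoc (J + J₀),
    add_mul_one_sub_cayley h h₀, two_mul, mul_add, add_mul]

theorem cayleyInv_cayley (h : IsGenKahlerPair β J I) (h₀ : IsGenKahlerPair β J₀ I) :
    cayleyInv J₀ (cayley J₀ J) = J := by
  rw [cayleyInv, ← mul_one_sub_cayley h h₀, Ring.mul_inverse_cancel_right _ _
    (isUnit_one_sub_cayley h h₀)]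

theorem isTangent_cayley (h : IsGenKahlerPair β J I) (h₀ : IsGenKahlerPair β J₀ I) :
    IsTangent β I J₀ (cayley J₀ J) := by
  have hT := isUnit_add h h₀
  have hJ := h.1.mul_self
  have hJ₀ := h₀.1.mul_self
  have hc := add_mul_cayley h h₀
  set μ := cayley J₀ J with hμ
  refine ⟨?_, ?_, ?_⟩
  · have h1 : (J + J₀) * (μ * (J + J₀)) = (J + J₀) * (-(J - J₀)) := by
      rw [← mul_assoc, hc, mul_neg, sub_mul, add_mul, mul_sub, mul_sub, mul_add, mul_add, hJ, hJ₀]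
      abel
    have h2 := hT.mul_left_cancel h1
    have h3 : ∀ e, μ ((J + J₀) e) = -(J e - J₀ e) := fun e => DFunLike.congr_fun h2 e
    -- It suffices to check skewness on vectors `(J + J₀) e`, where `μ` is given by `h3`.
    have hsurj : ∀ e, ∃ e', e = (J + J₀) e' := by
      intro e
      refine ⟨Ring.inverse (J + J₀) e, ?_⟩
      have := DFunLike.congr_fun (Ring.mul_inverse_cancel _ hT) e
      exact this.symm
    intro e f
    obtain ⟨e, rfl⟩ := hsurj e
    obtain ⟨f, rfl⟩ := hsurj f
    rw [h3, h3]
    simp only [add_apply, map_neg, map_sub, map_add, LinearMap.neg_apply,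
      LinearMap.sub_apply, LinearMap.add_apply, h.1.1, h₀.1.1]
    ring
  · apply hT.mul_left_cancel
    change (J + J₀) * (μ * J₀ + J₀ * μ) = (J + J₀) * 0
    have h1 : (J + J₀) * J₀ = J * (J + J₀) := by
      rw [add_mul, mul_add, hJ, hJ₀, add_comm]
    rw [mul_add, ← mul_assoc, ← mul_assoc, hc, h1, mul_assoc, hc, sub_mul, mul_sub, hJ, hJ₀,
      mul_zero]
    abel
  · apply hT.mul_left_cancel
    change (J + J₀) * (μ * I) = (J + J₀) * (I * μ)
    have h1 : (J + J₀) * I = I * (J + J₀) := by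
      rw [add_mul, mul_add, h.comm, h₀.comm]
    rw [← mul_assoc, ← mul_assoc, hc, h1, mul_assoc, hc, sub_mul, mul_sub, h.comm, h₀.comm]

/-- The positivity of `J`, transported by `1 - μ`, is the inequality which defines the ball. -/
theorem inBall_cayley (h : IsGenKahlerPair β J I) (h₀ : IsGenKahlerPair β J₀ I) :
    InBall β I J₀ (cayley J₀ J) := by
  intro e he
  have hI := (isTangent_cayley h h₀).comm
  have hQ := isUnit_one_sub_cayley h h₀
  have hm := mul_one_sub_cayley h h₀
  set μ := cayley J₀ J
  have h1 : (1 - μ) (-(J₀ (I e))) = -(J (I ((1 - μ) e))) := by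
    have h2 := DFunLike.congr_fun hm (I e)
    have h3 : (1 - μ) * I = I * (1 - μ) := by rw [sub_mul, mul_sub, hI, one_mul, mul_one]
    have h4 := DFunLike.congr_fun h3 e
    simp only [mul_apply_eq_comp] at h2 h4
    rw [map_neg, ← h2, h4]
  rw [h1]
  apply h.2.2.2
  intro h0
  apply he
  have := DFunLike.congr_fun (Ring.inverse_mul_cancel _ hQ) e
  rw [mul_apply_eq_comp, h0, map_zero] at this
  exact this.symm

theorem isUnit_one_sub (hb : InBall β I J₀ μ) : IsUnit (1 - μ) := by
  apply isUnit_of_injective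
  intro e he
  by_contra hne
  have := hb e hne
  rw [he, map_zero] at this
  exact lt_irrefl _ this

theorem cayleyInv_mul (hb : InBall β I J₀ μ) :
    cayleyInv J₀ μ * (1 - μ) = (1 - μ) * J₀ := by
  rw [cayleyInv, Ring.inverse_mul_cancel_right _ _ (isUnit_one_sub hb)]

theorem isGenKahlerPair_cayleyInv (h₀ : IsGenKahlerPair β J₀ I) (ht : IsTangent β I J₀ μ)
    (hb : InBall β I J₀ μ) : IsGenKahlerPair β (cayleyInv J₀ μ) I := by
  have hQ := isUnit_one_sub hb
  have hm := cayleyInv_mul hb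
  set J := cayleyInv J₀ μ
  have hI : (1 - μ) * I = I * (1 - μ) := by rw [sub_mul, mul_sub, ht.comm, one_mul, mul_one]
  have hsurj : ∀ e, ∃ e', e = (1 - μ) e' := fun e =>
    ⟨Ring.inverse (1 - μ) e, (DFunLike.congr_fun (Ring.mul_inverse_cancel _ hQ) e).symm⟩
  have hJ : ∀ e, J ((1 - μ) e) = (1 - μ) (J₀ e) := fun e => DFunLike.congr_fun hm e
  have hIe : ∀ e, I ((1 - μ) e) = (1 - μ) (I e) := fun e => (DFunLike.congr_fun hI e).symm
  have hsk : ∀ a b, β ((1 - μ) a) ((1 - μ) b) = β a b + β (μ a) (μ b) := by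
    intro a b
    have := ht.1 a b
    simp only [sub_apply, one_apply_eq_self, map_sub,
      LinearMap.sub_apply]
    linarith
  have hμJ : ∀ e, μ (J₀ e) = -(J₀ (μ e)) := fun e => DFunLike.congr_fun ht.mul_J e
  refine ⟨⟨?_, ?_⟩, h₀.2.1, ?_, ?_⟩
  · intro e f
    obtain ⟨e, rfl⟩ := hsurj e
    obtain ⟨f, rfl⟩ := hsurj f
    rw [hJ, hJ, hsk, hsk, h₀.1.1, hμJ, hμJ]
    simp [h₀.1.1]
  · intro e
    obtain ⟨e, rfl⟩ := hsurj e
    rw [hJ, hJ, h₀.1.2, map_neg]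
  · intro e
    obtain ⟨e, rfl⟩ := hsurj e
    rw [hIe, hJ, hJ, hIe, h₀.2.2.1]
  · intro e he
    obtain ⟨e, rfl⟩ := hsurj e
    have he' : e ≠ 0 := by rintro rfl; exact he (map_zero _)
    have := hb e he'
    rwa [hIe, hJ, ← map_neg]

theorem cayley_cayleyInv (h₀ : IsGenKahlerPair β J₀ I) (ht : IsTangent β I J₀ μ)
    (hb : InBall β I J₀ μ) : cayley J₀ (cayleyInv J₀ μ) = μ := by
  have h := isGenKahlerPair_cayleyInv h₀ ht hb
  apply (isUnit_add h h₀).mul_left_cancel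
  rw [add_mul_cayley h h₀]
  have hm := cayleyInv_mul hb
  set J := cayleyInv J₀ μ
  have h1 := ht.mul_J
  rw [mul_sub, mul_one, sub_mul, one_mul, h1, sub_neg_eq_add] at hm
  rw [add_mul, sub_eq_iff_eq_add.1 hm]
  nth_rewrite 2 [← sub_eq_iff_eq_add.1 hm]
  abel

theorem inBall_zero (h₀ : IsGenKahlerPair β J₀ I) : InBall β I J₀ 0 := by
  intro e he
  simpa using h₀.2.2.2 e he

end

end Cayley

/-! ### Traces -/

section Trace

/-- The trace of the square of a nonzero endomorphism which is symmetric with respect to a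
positive definite form is positive. -/
theorem trace_mul_self_pos {W : Type*} [AddCommGroup W] [Module ℝ W] [FiniteDimensional ℝ W]
    (γ : LinearMap.BilinForm ℝ W) (hs : ∀ e f, γ e f = γ f e) (hp : ∀ e, e ≠ 0 → 0 < γ e e)
    (a : W →ₗ[ℝ] W) (ha : ∀ e f, γ (a e) f = γ e (a f)) (h0 : a ≠ 0) :
    0 < LinearMap.trace ℝ W (a ∘ₗ a) := by
  obtain ⟨v, hv⟩ := LinearMap.BilinForm.exists_orthogonal_basis (B := γ) ⟨fun e f => hs e f⟩
  have hvv : ∀ i, 0 < γ (v i) (v i) := fun i => hp _ (v.ne_zero i)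
  have hcoord : ∀ i e, v.repr e i = γ (v i) e / γ (v i) (v i) := by
    intro i e
    rw [eq_div_iff (hvv i).ne']
    conv_rhs => rw [← v.sum_repr e]
    rw [map_sum, Finset.sum_eq_single i]
    · simp
    · intro j _ hj
      have : γ (v i) (v j) = 0 := hv (Ne.symm hj)
      simp [this]
    · simp
  have htr : LinearMap.trace ℝ W (a ∘ₗ a) = ∑ i, γ (a (v i)) (a (v i)) / γ (v i) (v i) := by
    rw [LinearMap.trace_eq_matrix_trace ℝ v, Matrix.trace]
    refine Finset.sum_congr rfl fun i _ => ?_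
    rw [Matrix.diag_apply, LinearMap.toMatrix_apply, hcoord, LinearMap.comp_apply, ← ha]
  have hnn : ∀ i, 0 ≤ γ (a (v i)) (a (v i)) / γ (v i) (v i) := by
    intro i
    apply div_nonneg _ (hvv i).le
    by_cases h : a (v i) = 0
    · simp [h]
    · exact (hp _ h).le
  rw [htr]
  obtain ⟨i, hi⟩ : ∃ i, a (v i) ≠ 0 := by
    by_contra hcon
    push Not at hcon
    exact h0 (v.ext fun i => by simpa using hcon i)
  exact Finset.sum_pos' (fun i _ => hnn i) ⟨i, Finset.mem_univ _, div_pos (hp _ hi) (hvv i)⟩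

variable {W : Type*} [AddCommGroup W] [Module ℝ W] [TopologicalSpace W]
  [IsTopologicalAddGroup W] [ContinuousSMul ℝ W]

/-- The trace of a continuous endomorphism. -/
noncomputable def tr (A : W →L[ℝ] W) : ℝ := LinearMap.trace ℝ W (A : W →ₗ[ℝ] W)

theorem tr_add (A B : W →L[ℝ] W) : tr (A + B) = tr A + tr B := map_add (LinearMap.trace ℝ W) _ _

theorem tr_smul (r : ℝ) (A : W →L[ℝ] W) : tr (r • A) = r * tr A :=
  map_smul (LinearMap.trace ℝ W) _ _

theorem tr_neg (A : W →L[ℝ] W) : tr (-A) = -tr A := map_neg (LinearMap.trace ℝ W) _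

theorem tr_zero : tr (0 : W →L[ℝ] W) = 0 := map_zero (LinearMap.trace ℝ W)

theorem tr_mul_comm (A B : W →L[ℝ] W) : tr (A * B) = tr (B * A) :=
  LinearMap.trace_mul_comm ℝ _ _

variable {β : LinearMap.BilinForm ℝ W} {I J a b c : W →L[ℝ] W}

theorem tr_antisymm (ha : a * J = -(J * a)) : tr (J * (a * b)) = -tr (J * (b * a)) := by
  rw [← mul_assoc J b a, tr_mul_comm (J * b) a, ← mul_assoc a J b, ha, neg_mul, tr_neg, neg_neg,
    mul_assoc]

theorem tr_invariant (hJ : J * J = -1) (ha : a * J = -(J * a)) :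
    tr (J * ((J * a) * (J * b))) = tr (J * (a * b)) := by
  have : J * ((J * a) * (J * b)) = (J * J) * (a * J) * b := by simp only [mul_assoc]
  rw [this, hJ, ha]
  simp [mul_assoc]

theorem tr_acs_left (hJ : J * J = -1) : tr (J * ((J * a) * b)) = -tr (a * b) := by
  have : J * ((J * a) * b) = (J * J) * (a * b) := by simp only [mul_assoc]
  rw [this, hJ, ← tr_neg]; simp

/-- A product of three endomorphisms which anticommute with `J` anticommutes with `J`, hence is
traceless. -/
theorem tr_mul_mul_eq_zero (hJ : J * J = -1) (ha : a * J = -(J * a)) (hb : b * J = -(J * b))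
    (hc : c * J = -(J * c)) : tr (a * (b * c)) = 0 := by
  have h1 : a * (b * c) * J = -(J * (a * (b * c))) := by
    rw [mul_assoc, mul_assoc, hc, mul_neg, ← mul_assoc b, hb, neg_mul, mul_neg, mul_neg, neg_neg,
      mul_assoc J, ← mul_assoc a, ha, neg_mul, mul_assoc]
  have h2 : tr (J * (a * (b * c) * J)) = -tr (a * (b * c)) := by
    rw [tr_mul_comm, mul_assoc, hJ, mul_neg, mul_one, tr_neg]
  rw [h1, mul_neg, ← mul_assoc, hJ, neg_mul, one_mul, neg_neg] at h2
  linarith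

/-- Tangent vectors are symmetric for the positive definite form `⟨-J I ·, ·⟩`. -/
theorem tr_mul_self_pos [FiniteDimensional ℝ W] (hs : ∀ e f, β e f = β f e)
    (h : IsGenKahlerPair β J I) (ha : IsTangent β I J a) (h0 : a ≠ 0) : 0 < tr (a * a) := by
  have hsk := h.1.skew
  have hskI := h.2.1.skew
  refine trace_mul_self_pos (β.comp ((-(J * I) : W →L[ℝ] W) : W →ₗ[ℝ] W) LinearMap.id) ?_ ?_
    (a : W →ₗ[ℝ] W) ?_ ?_
  · intro e f
    simp only [LinearMap.BilinForm.comp_apply, ContinuousLinearMap.coe_coe,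
      neg_apply, mul_apply_eq_comp, LinearMap.id_apply, map_neg,
      LinearMap.neg_apply]
    rw [hsk, hskI, neg_neg, hs, h.2.2.1]
  · intro e he
    exact h.2.2.2 e he
  · intro e f
    have h1 : J (I (a e)) = -(a (J (I e))) := by
      have e1 : I (a e) = a (I e) := (DFunLike.congr_fun ha.comm e).symm
      have e2 : a (J (I e)) = -(J (a (I e))) := DFunLike.congr_fun ha.mul_J (I e)
      rw [e1, e2, neg_neg]
    have h2 := ha.1 (J (I e)) f
    simp only [LinearMap.BilinForm.comp_apply, ContinuousLinearMap.coe_coe,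
      neg_apply, mul_apply_eq_comp, LinearMap.id_apply, map_neg,
      LinearMap.neg_apply, h1]
    linarith
  · intro h1
    apply h0
    ext e
    exact LinearMap.congr_fun h1 e

/-- The algebraic identity behind the closedness of the `L²` form: the derivative of
`tr (A dA dA)` for a family `A` of almost complex structures vanishes after antisymmetrization.
Here `a`, `b`, `c` are first and `ab`, `bc`, `ca` second derivatives of `A`. -/
theorem tr_closed (hJ : J * J = -1) (ha : a * J = -(J * a)) (hb : b * J = -(J * b))
    (hc : c * J = -(J * c)) (ab bc ca : W →L[ℝ] W) :
    (tr (a * (b * c)) + tr (J * (ab * c)) + tr (J * (b * ca))) +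
    (tr (b * (c * a)) + tr (J * (bc * a)) + tr (J * (c * ab))) +
    (tr (c * (a * b)) + tr (J * (ca * b)) + tr (J * (a * bc))) = 0 := by
  rw [tr_mul_mul_eq_zero hJ ha hb hc, tr_mul_mul_eq_zero hJ hb hc ha,
    tr_mul_mul_eq_zero hJ hc ha hb]
  have h1 := tr_antisymm (b := ab) hc
  have h2 := tr_antisymm (b := bc) ha
  have h3 := tr_antisymm (b := ca) hb
  linarith

end Trace

/-! ### Square roots of positive definite matrices -/

section MatrixSqrt

open Matrix
open scoped ComplexOrder MatrixOrder Matrix.Norms.L2Operator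

variable {N : Type*} [Fintype N] [DecidableEq N]

/-- The positive semidefinite square root of a complex matrix. -/
noncomputable def msqrt (P : Matrix N N ℂ) : Matrix N N ℂ := CFC.sqrt P

theorem continuousOn_msqrt : ContinuousOn (msqrt : Matrix N N ℂ → Matrix N N ℂ)
    {P | P.PosSemidef} := by
  have h := CFC.continuousOn_sqrt (A := Matrix N N ℂ)
  simp only [Matrix.nonneg_iff_posSemidef] at h
  exact h

theorem msqrt_mul_self {P : Matrix N N ℂ} (h : P.PosSemidef) : msqrt P * msqrt P = P :=
  CFC.sqrt_mul_sqrt_self P (Matrix.nonneg_iff_posSemidef.2 h)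

theorem posSemidef_msqrt (P : Matrix N N ℂ) : (msqrt P).PosSemidef :=
  Matrix.nonneg_iff_posSemidef.1 (CFC.sqrt_nonneg P)

theorem msqrt_unique {P Q : Matrix N N ℂ} (h : Q * Q = P) (hQ : Q.PosSemidef) : msqrt P = Q :=
  CFC.sqrt_unique h (Matrix.nonneg_iff_posSemidef.2 hQ)

end MatrixSqrt

/-! ### The model fibre as a homogeneous space -/

section Model

open Matrix
open scoped ComplexOrder

variable {n : ℕ}

theorem signMatrix_sq (n : ℕ) : signMatrix n * signMatrix n = 1 := by
  simp [signMatrix, Matrix.fromBlocks_multiply]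

theorem signMatrix_conjTranspose (n : ℕ) : (signMatrix n)ᴴ = signMatrix n := by
  simp [signMatrix, Matrix.fromBlocks_conjTranspose]

theorem modelForm_apply (v w : ModelSpace n) :
    modelForm n v w = (star v ⬝ᵥ (signMatrix n *ᵥ w)).re := rfl

theorem modelI_apply (v : ModelSpace n) : modelI n v = Complex.I • v := rfl

theorem matrixEnd_apply (A : Matrix (Fin n ⊕ Fin n) (Fin n ⊕ Fin n) ℂ) (v : ModelSpace n) :
    matrixEnd A v = A *ᵥ v := rfl

/-- A complex matrix is determined by the real parts of the associated sesquilinear form. -/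
theorem matrix_eq_of_re {N : Type*} [Fintype N] [DecidableEq N] {A B : Matrix N N ℂ}
    (h : ∀ v w : N → ℂ, (star v ⬝ᵥ (A *ᵥ w)).re = (star v ⬝ᵥ (B *ᵥ w)).re) : A = B := by
  have h2 : ∀ v w : N → ℂ, star v ⬝ᵥ (A *ᵥ w) = star v ⬝ᵥ (B *ᵥ w) := by
    intro v w
    apply Complex.ext (h v w)
    have := h v (-Complex.I • w)
    simpa [Matrix.mulVec_smul, Matrix.mulVec_neg] using this
  ext i j
  have := h2 (Pi.single i 1) (Pi.single j 1)
  have hs : star (Pi.single i 1 : N → ℂ) = Pi.single i 1 := by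
    ext k; by_cases hk : k = i
    · subst hk; simp
    · simp [hk]
  rw [hs] at this
  simpa using this

theorem modelForm_mulVec (A B : Matrix (Fin n ⊕ Fin n) (Fin n ⊕ Fin n) ℂ) (v w : ModelSpace n) :
    modelForm n (A *ᵥ v) (B *ᵥ w) = (star v ⬝ᵥ ((Aᴴ * signMatrix n * B) *ᵥ w)).re := by
  rw [modelForm_apply, Matrix.star_mulVec, ← Matrix.dotProduct_mulVec, Matrix.mulVec_mulVec,
    Matrix.mulVec_mulVec, Matrix.mul_assoc]

/-- For complex matrices, orthogonality for the real part of the Hermitian form is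
pseudo-unitarity. -/
theorem isGenComplex_matrixEnd_iff (A : Matrix (Fin n ⊕ Fin n) (Fin n ⊕ Fin n) ℂ) :
    IsGenComplex (modelForm n) (matrixEnd A) ↔ Aᴴ * signMatrix n * A = signMatrix n ∧
      A * A = -1 := by
  constructor
  · rintro ⟨h1, h2⟩
    constructor
    · apply matrix_eq_of_re
      intro v w
      rw [← modelForm_mulVec]
      exact h1 v w
    · apply Matrix.toLin'.injective
      ext1 v
      rw [Matrix.toLin'_mul]
      ext1
      have := h2 (Pi.single v 1)
      simp only [matrixEnd_apply] at this
      simpa using this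
  · rintro ⟨h1, h2⟩
    constructor
    · intro v w
      rw [matrixEnd_apply, matrixEnd_apply, modelForm_mulVec, h1]; rfl
    · intro v
      rw [matrixEnd_apply, matrixEnd_apply, Matrix.mulVec_mulVec, h2]
      simp [Matrix.neg_mulVec]

theorem isGenComplex_modelI : IsGenComplex (modelForm n) (modelI n) := by
  constructor
  · intro e f
    simp only [modelForm_apply, modelI_apply, star_smul, Matrix.mulVec_smul, smul_dotProduct,
      dotProduct_smul, smul_smul, smul_eq_mul, ← mul_assoc]
    simp
  · intro e
    rw [modelI_apply, modelI_apply, smul_smul, Complex.I_mul_I, neg_smul, one_smul]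

theorem matrixEnd_comm_modelI (A : Matrix (Fin n ⊕ Fin n) (Fin n ⊕ Fin n) ℂ) (v : ModelSpace n) :
    matrixEnd A (modelI n v) = modelI n (matrixEnd A v) := by
  rw [modelI_apply, modelI_apply, matrixEnd_apply, matrixEnd_apply, Matrix.mulVec_smul]

/-- The matrix of a real endomorphism (meaningful for complex linear ones). -/
noncomputable def endMatrix (J : ModelSpace n →L[ℝ] ModelSpace n) :
    Matrix (Fin n ⊕ Fin n) (Fin n ⊕ Fin n) ℂ := Matrix.of fun i j => J (Pi.single j 1) i

/-- Endomorphisms which commute with `√-1`, such as the elements of the model fibre, are given by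
complex matrices. -/
theorem matrixEnd_endMatrix {J : ModelSpace n →L[ℝ] ModelSpace n}
    (hJ : ∀ v, J (modelI n v) = modelI n (J v)) : matrixEnd (endMatrix J) = J := by
  have hc : ∀ (z : ℂ) v, J (z • v) = z • J v := by
    intro z v
    have h1 : ∀ u : ModelSpace n, z • u = z.re • u + z.im • modelI n u := by
      intro u
      rw [modelI_apply]
      conv_lhs => rw [← Complex.re_add_im z]
      ext i
      simp only [Pi.smul_apply, Pi.add_apply, smul_eq_mul, Complex.real_smul]
      ring
    rw [h1, map_add, map_smul, map_smul, hJ, ← h1]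
  ext v i
  conv_rhs => rw [pi_eq_sum_univ' v, map_sum]
  rw [matrixEnd_apply, Matrix.mulVec, dotProduct, Finset.sum_apply]
  refine Finset.sum_congr rfl fun j _ => ?_
  rw [hc, Pi.smul_apply, smul_eq_mul, mul_comm]
  rfl

theorem endMatrix_matrixEnd (A : Matrix (Fin n ⊕ Fin n) (Fin n ⊕ Fin n) ℂ) :
    endMatrix (matrixEnd A) = A := by
  ext i j
  simp [endMatrix, matrixEnd_apply]

theorem continuous_endMatrix :
    Continuous (endMatrix : (ModelSpace n →L[ℝ] ModelSpace n) → _) := by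
  refine continuous_matrix fun i j => ?_
  exact (continuous_apply i).comp ((ContinuousLinearMap.apply ℝ (ModelSpace n)
    (Pi.single j (1 : ℂ) : ModelSpace n)).continuous)

theorem continuous_matrixEnd : Continuous
    (matrixEnd : Matrix (Fin n ⊕ Fin n) (Fin n ⊕ Fin n) ℂ → ModelSpace n →L[ℝ] ModelSpace n) := by
  let f : Matrix (Fin n ⊕ Fin n) (Fin n ⊕ Fin n) ℂ →ₗ[ℝ] (ModelSpace n →L[ℝ] ModelSpace n) :=
    { toFun := matrixEnd
      map_add' := fun A B => by ext v : 1; simp [matrixEnd_apply, Matrix.add_mulVec]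
      map_smul' := fun r A => by ext v : 1; simp [matrixEnd_apply, Matrix.smul_mulVec] }
  exact f.continuous_of_finiteDimensional

/-- The matrices of the elements of the model fibre. -/
theorem matrixEnd_mem_modelFibre_iff (A : Matrix (Fin n ⊕ Fin n) (Fin n ⊕ Fin n) ℂ) :
    matrixEnd A ∈ modelFibre n ↔ Aᴴ * signMatrix n * A = signMatrix n ∧ A * A = -1 ∧
      (signMatrix n * (-Complex.I • A)).PosDef := by
  have key : Aᴴ * signMatrix n * A = signMatrix n → A * A = -1 →
      Aᴴ * signMatrix n = -(signMatrix n * A) := by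
    intro h1 h2
    have h3 := congrArg (fun X => X * A) h1
    simp only [Matrix.mul_assoc, h2] at h3
    rw [mul_neg, mul_neg, mul_one] at h3
    rw [← h3, neg_neg]
  have hform : Aᴴ * signMatrix n * A = signMatrix n → A * A = -1 → ∀ v : ModelSpace n,
      modelForm n (-(matrixEnd A (modelI n v))) v =
        (star v ⬝ᵥ ((signMatrix n * (-Complex.I • A)) *ᵥ v)).re := by
    intro h1 h2 v
    have h3 : -(matrixEnd A (modelI n v)) = (-Complex.I • A) *ᵥ v := by
      rw [matrixEnd_apply, modelI_apply, Matrix.mulVec_smul, Matrix.smul_mulVec, neg_smul]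
    have h4 := modelForm_mulVec (-Complex.I • A) 1 v v
    rw [Matrix.one_mulVec] at h4
    rw [h3, h4, mul_one, conjTranspose_smul, Matrix.smul_mul, key h1 h2]
    simp
  constructor
  · rintro ⟨h1, -, -, h4⟩
    obtain ⟨ha, hb⟩ := (isGenComplex_matrixEnd_iff A).1 h1
    refine ⟨ha, hb, ?_⟩
    have hH : (signMatrix n * (-Complex.I • A)).IsHermitian := by
      rw [Matrix.IsHermitian, conjTranspose_mul, conjTranspose_smul, signMatrix_conjTranspose,
        Matrix.smul_mul, key ha hb]
      simp
    refine Matrix.PosDef.of_dotProduct_mulVec_pos hH fun v hv => ?_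
    have h5 := h4 v hv
    rw [hform ha hb] at h5
    rw [Complex.lt_def]
    refine ⟨h5, ?_⟩
    have := hH.im_star_dotProduct_mulVec_self v
    exact this.symm
  · rintro ⟨ha, hb, hp⟩
    refine ⟨(isGenComplex_matrixEnd_iff A).2 ⟨ha, hb⟩, isGenComplex_modelI,
      matrixEnd_comm_modelI A, fun v hv => ?_⟩
    rw [hform ha hb]
    exact (Complex.lt_def.1 (hp.dotProduct_mulVec_pos hv)).1

/-- The square root of the positive matrix attached to an element of the model fibre is
pseudo-unitary. -/
theorem msqrt_mul_sign_mul_msqrt {A : Matrix (Fin n ⊕ Fin n) (Fin n ⊕ Fin n) ℂ}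
    (hA : matrixEnd A ∈ modelFibre n) :
    msqrt (signMatrix n * (-Complex.I • A)) * signMatrix n *
      msqrt (signMatrix n * (-Complex.I • A)) = signMatrix n := by
  obtain ⟨h1, h2, hp⟩ := (matrixEnd_mem_modelFibre_iff A).1 hA
  have he := signMatrix_sq n
  set P := signMatrix n * (-Complex.I • A) with hP
  have hQ := msqrt_mul_self hp.posSemidef
  have hQp := posSemidef_msqrt P
  set Q := msqrt P
  have hPu := hp.isUnit
  have hQu : IsUnit Q := by
    have : IsUnit (Q * Q) := by rw [hQ]; exact hPu
    exact isUnit_of_mul_isUnit_left this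
  have hPP : signMatrix n * P * (signMatrix n * P) = 1 := by
    have : signMatrix n * P = -Complex.I • A := by
      rw [hP, ← Matrix.mul_assoc, he, Matrix.one_mul]
    rw [this, Matrix.smul_mul, Matrix.mul_smul, smul_smul, h2]
    simp
  have hdet : IsUnit Q.det := (Matrix.isUnit_iff_isUnit_det Q).1 hQu
  -- the inverse of `Q`, conjugated by the sign matrix, is another positive square root of `P`
  have hR : msqrt P = signMatrix n * Q⁻¹ * signMatrix n := by
    apply msqrt_unique
    · have e1 : signMatrix n * Q⁻¹ * signMatrix n * (signMatrix n * Q⁻¹ * signMatrix n) =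
          signMatrix n * (Q⁻¹ * Q⁻¹) * signMatrix n := by
        calc _ = signMatrix n * Q⁻¹ * (signMatrix n * signMatrix n) * (Q⁻¹ * signMatrix n) := by
              simp only [Matrix.mul_assoc]
          _ = _ := by rw [he, Matrix.mul_one]; simp only [Matrix.mul_assoc]
      have e2 : Q⁻¹ * Q⁻¹ = P⁻¹ := by rw [← Matrix.mul_inv_rev, hQ]
      have e3 : P⁻¹ = signMatrix n * P * signMatrix n := by
        apply Matrix.inv_eq_left_inv
        rw [Matrix.mul_assoc, hPP]
      rw [e1, e2, e3]
      calc _ = (signMatrix n * signMatrix n) * P * (signMatrix n * signMatrix n) := by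
            simp only [Matrix.mul_assoc]
        _ = P := by rw [he, Matrix.one_mul, Matrix.mul_one]
    · have := hQp.inv.conjTranspose_mul_mul_same (signMatrix n)
      rwa [signMatrix_conjTranspose] at this
  have hR' : Q = signMatrix n * Q⁻¹ * signMatrix n := hR
  calc Q * signMatrix n * Q = Q * signMatrix n * (signMatrix n * Q⁻¹ * signMatrix n) := by
        rw [← hR']
    _ = Q * (signMatrix n * signMatrix n) * Q⁻¹ * signMatrix n := by
        simp only [Matrix.mul_assoc]
    _ = signMatrix n := by
        rw [he, Matrix.mul_one, Matrix.mul_nonsing_inv _ hdet, Matrix.one_mul]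

/-- The positive element of `U(n,n)` which carries the base point to a given element of the model
fibre. -/
noncomputable def modelSection (J : modelFibre n) : Unn n :=
  have hJ : matrixEnd (endMatrix J.1) ∈ modelFibre n := by
    rw [matrixEnd_endMatrix J.2.2.2.1]; exact J.2
  ⟨⟨signMatrix n * msqrt (signMatrix n * (-Complex.I • endMatrix J.1)) * signMatrix n,
    msqrt (signMatrix n * (-Complex.I • endMatrix J.1)),
    by
      rw [Matrix.mul_assoc, Matrix.mul_assoc, ← Matrix.mul_assoc (msqrt _),
        msqrt_mul_sign_mul_msqrt hJ, signMatrix_sq],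
    by
      rw [← Matrix.mul_assoc, ← Matrix.mul_assoc, msqrt_mul_sign_mul_msqrt hJ, signMatrix_sq]⟩, by
    change (signMatrix n * msqrt _ * signMatrix n)ᴴ * signMatrix n *
      (signMatrix n * msqrt _ * signMatrix n) = signMatrix n
    rw [conjTranspose_mul, conjTranspose_mul, signMatrix_conjTranspose,
      (posSemidef_msqrt _).isHermitian.eq]
    generalize hQ : msqrt (signMatrix n * (-Complex.I • endMatrix J.1)) = Q
    have h := msqrt_mul_sign_mul_msqrt hJ
    rw [hQ] at h
    have he := signMatrix_sq n
    calc _ = signMatrix n * (Q * (signMatrix n * signMatrix n * signMatrix n) * Q) *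
          signMatrix n := by simp only [Matrix.mul_assoc]
      _ = signMatrix n * (Q * signMatrix n * Q) * signMatrix n := by rw [he, Matrix.one_mul]
      _ = signMatrix n := by rw [h, he, Matrix.one_mul]⟩

theorem continuous_modelSection : Continuous (modelSection : modelFibre n → Unn n) := by
  have hP : Continuous fun J : modelFibre n =>
      signMatrix n * (-Complex.I • endMatrix J.1) :=
    continuous_const.matrix_mul (Continuous.const_smul
      (continuous_endMatrix.comp continuous_subtype_val : Continuous fun J : modelFibre n =>
        endMatrix J.1) (-Complex.I))
  have hQ : Continuous fun J : modelFibre n =>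
      msqrt (signMatrix n * (-Complex.I • endMatrix J.1)) := by
    refine continuousOn_msqrt.comp_continuous hP fun J => ?_
    have hJ : matrixEnd (endMatrix J.1) ∈ modelFibre n := by
      rw [matrixEnd_endMatrix J.2.2.2.1]; exact J.2
    exact ((matrixEnd_mem_modelFibre_iff _).1 hJ).2.2.posSemidef
  apply Continuous.subtype_mk
  rw [Units.continuous_iff]
  exact ⟨(continuous_const.matrix_mul hQ).matrix_mul continuous_const, hQ⟩

/-- The action of `U(n,n)` on the base point. -/
noncomputable def orbitMatrix (g : Unn n) : Matrix (Fin n ⊕ Fin n) (Fin n ⊕ Fin n) ℂ :=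
  (g : GL (Fin n ⊕ Fin n) ℂ).val * modelBase n * ((g : GL (Fin n ⊕ Fin n) ℂ)⁻¹).val

theorem Unn_mem (g : Unn n) : (g : GL (Fin n ⊕ Fin n) ℂ).valᴴ * signMatrix n *
    (g : GL (Fin n ⊕ Fin n) ℂ).val = signMatrix n := g.2

theorem Unn_inv (g : Unn n) : signMatrix n * ((g : GL (Fin n ⊕ Fin n) ℂ)⁻¹).val =
    (g : GL (Fin n ⊕ Fin n) ℂ).valᴴ * signMatrix n := by
  have h := congrArg (fun X => X * ((g : GL (Fin n ⊕ Fin n) ℂ)⁻¹).val) (Unn_mem g)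
  simp only [Matrix.mul_assoc, ← Units.val_mul, mul_inv_cancel] at h
  simpa using h.symm

/-- The positive matrix attached to `g · diag(√-1, -√-1) · g⁻¹` is `(g⁻¹)ᴴ g⁻¹`. -/
theorem orbit_mem (g : Unn n) : matrixEnd (orbitMatrix g) ∈ modelFibre n := by
  have hu : ((g : GL (Fin n ⊕ Fin n) ℂ)⁻¹).val * (g : GL (Fin n ⊕ Fin n) ℂ).val = 1 := by
    rw [← Units.val_mul]; simp
  have hu' : (g : GL (Fin n ⊕ Fin n) ℂ).val * ((g : GL (Fin n ⊕ Fin n) ℂ)⁻¹).val = 1 := by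
    rw [← Units.val_mul]; simp
  have h1 := Unn_mem g
  have h2 := Unn_inv g
  have h1' := Unn_mem g⁻¹
  rw [Subgroup.coe_inv] at h1'
  have he := signMatrix_sq n
  rw [matrixEnd_mem_modelFibre_iff, orbitMatrix, modelBase]
  generalize (g : GL (Fin n ⊕ Fin n) ℂ).val = G at *
  generalize ((g : GL (Fin n ⊕ Fin n) ℂ)⁻¹).val = H at *
  refine ⟨?_, ?_, ?_⟩
  · rw [conjTranspose_mul, conjTranspose_mul, conjTranspose_smul, signMatrix_conjTranspose]
    calc _ = (Complex.I * star Complex.I) • (Hᴴ * (signMatrix n *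
          (Gᴴ * signMatrix n * G) * signMatrix n) * H) := by
          simp only [Matrix.smul_mul, Matrix.mul_smul, smul_smul, Matrix.mul_assoc]
      _ = signMatrix n := by rw [h1, he, Matrix.one_mul, h1']; simp
  · calc _ = (Complex.I * Complex.I) • (G * (signMatrix n * (H * G) * signMatrix n) * H) := by
          simp only [Matrix.smul_mul, Matrix.mul_smul, smul_smul, Matrix.mul_assoc]
      _ = -1 := by rw [hu, Matrix.mul_one, he, Matrix.mul_one, hu']; simp
  · have e : signMatrix n * (-Complex.I • (G * (Complex.I • signMatrix n) * H)) = Hᴴ * H := by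
      have e1 : Hᴴ * Gᴴ = 1 := by rw [← conjTranspose_mul, hu', conjTranspose_one]
      have e2 : signMatrix n * G = Hᴴ * signMatrix n := by
        calc _ = (Hᴴ * Gᴴ) * (signMatrix n * G) := by rw [e1, Matrix.one_mul]
          _ = Hᴴ * (Gᴴ * signMatrix n * G) := by simp only [Matrix.mul_assoc]
          _ = _ := by rw [h1]
      calc _ = (-Complex.I * Complex.I) • ((signMatrix n * G) * (signMatrix n * H)) := by
            simp only [Matrix.smul_mul, Matrix.mul_smul, smul_smul, Matrix.mul_assoc]
        _ = Hᴴ * (signMatrix n * signMatrix n) * H := by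
            rw [e2]; simp [Matrix.mul_assoc]
        _ = _ := by rw [he, Matrix.mul_one]
    rw [e]
    apply Matrix.PosDef.conjTranspose_mul_self
    intro x y hxy
    have := congrArg (fun v => G *ᵥ v) hxy
    simpa [Matrix.mulVec_mulVec, hu'] using this

/-- The stabilizer of the base point is `U(n) × U(n)`: a pseudo-unitary matrix commuting with the
sign matrix is block diagonal with unitary blocks. -/
theorem orbitMatrix_eq_iff (g g' : Unn n) :
    orbitMatrix g = orbitMatrix g' ↔ g⁻¹ * g' ∈ UnUn n := by
  have h1 : orbitMatrix g = orbitMatrix g' ↔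
      signMatrix n * ((g⁻¹ * g' : Unn n) : GL (Fin n ⊕ Fin n) ℂ).val =
        ((g⁻¹ * g' : Unn n) : GL (Fin n ⊕ Fin n) ℂ).val * signMatrix n := by
    have hu : ∀ g : Unn n, ((g : GL (Fin n ⊕ Fin n) ℂ)⁻¹).val *
        (g : GL (Fin n ⊕ Fin n) ℂ).val = 1 := by
      intro g; rw [← Units.val_mul]; simp
    have hu' : ∀ g : Unn n, (g : GL (Fin n ⊕ Fin n) ℂ).val *
        ((g : GL (Fin n ⊕ Fin n) ℂ)⁻¹).val = 1 := by
      intro g; rw [← Units.val_mul]; simp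
    have a1 := hu g
    have a2 := hu' g
    have b1 := hu g'
    have b2 := hu' g'
    rw [Subgroup.coe_mul, Subgroup.coe_inv, Units.val_mul, orbitMatrix, orbitMatrix, modelBase]
    generalize (g : GL (Fin n ⊕ Fin n) ℂ).val = G at *
    generalize ((g : GL (Fin n ⊕ Fin n) ℂ)⁻¹).val = H at *
    generalize (g' : GL (Fin n ⊕ Fin n) ℂ).val = G' at *
    generalize ((g' : GL (Fin n ⊕ Fin n) ℂ)⁻¹).val = H' at *
    simp only [Matrix.mul_smul, Matrix.smul_mul]
    rw [(smul_right_injective _ Complex.I_ne_zero).eq_iff]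
    constructor
    · intro h
      calc signMatrix n * (H * G') = (H * G) * signMatrix n * H * G' := by
            rw [a1, Matrix.one_mul, Matrix.mul_assoc]
        _ = H * (G * signMatrix n * H) * G' := by simp only [Matrix.mul_assoc]
        _ = H * G' * signMatrix n * (H' * G') := by rw [h]; simp only [Matrix.mul_assoc]
        _ = _ := by rw [b1, Matrix.mul_one]
    · intro h
      calc G * signMatrix n * H = G * signMatrix n * H * (G' * H') := by
            rw [b2, Matrix.mul_one]
        _ = G * (signMatrix n * (H * G')) * H' := by simp only [Matrix.mul_assoc]
        _ = (G * H) * G' * signMatrix n * H' := by rw [h]; simp only [Matrix.mul_assoc]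
        _ = _ := by rw [a2, Matrix.one_mul]
  rw [h1]
  have hK := Unn_mem (g⁻¹ * g')
  change _ ↔ ∃ a ∈ Matrix.unitaryGroup (Fin n) ℂ, ∃ b ∈ Matrix.unitaryGroup (Fin n) ℂ,
    (((g⁻¹ * g' : Unn n) : GL (Fin n ⊕ Fin n) ℂ) : Matrix _ _ ℂ) = Matrix.fromBlocks a 0 0 b
  generalize ((g⁻¹ * g' : Unn n) : GL (Fin n ⊕ Fin n) ℂ).val = K at *
  constructor
  · intro h
    have hblock : K = Matrix.fromBlocks K.toBlocks₁₁ 0 0 K.toBlocks₂₂ := by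
      rw [← Matrix.fromBlocks_toBlocks K, signMatrix, Matrix.fromBlocks_multiply,
        Matrix.fromBlocks_multiply, Matrix.fromBlocks_inj] at h
      simp only [Matrix.one_mul, Matrix.zero_mul, Matrix.mul_zero, Matrix.mul_one, add_zero,
        zero_add, Matrix.mul_neg, Matrix.neg_mul] at h
      have e1 : K.toBlocks₁₂ = 0 := by
        ext i j; exact self_eq_neg.1 (congrFun (congrFun h.2.1 i) j)
      have e2 : K.toBlocks₂₁ = 0 := by
        ext i j; exact neg_eq_self.1 (congrFun (congrFun h.2.2.1 i) j)
      conv_lhs => rw [← Matrix.fromBlocks_toBlocks K, e1, e2]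
    rw [hblock, signMatrix, Matrix.fromBlocks_conjTranspose, Matrix.fromBlocks_multiply,
      Matrix.fromBlocks_multiply, Matrix.fromBlocks_inj] at hK
    simp only [Matrix.mul_one, Matrix.mul_zero, add_zero, zero_add, Matrix.mul_neg,
      conjTranspose_zero, Matrix.zero_mul, Matrix.neg_mul, neg_inj] at hK
    exact ⟨_, Matrix.mem_unitaryGroup_iff'.2 hK.1, _, Matrix.mem_unitaryGroup_iff'.2 hK.2.2.2,
      hblock⟩
  · rintro ⟨a, -, b, -, rfl⟩
    simp [signMatrix, Matrix.fromBlocks_multiply]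

theorem orbitMatrix_modelSection (J : modelFibre n) :
    matrixEnd (orbitMatrix (modelSection J)) = J.1 := by
  have hJ : matrixEnd (endMatrix J.1) ∈ modelFibre n := by
    rw [matrixEnd_endMatrix J.2.2.2.1]; exact J.2
  have h := msqrt_mul_sign_mul_msqrt hJ
  have hp := msqrt_mul_self ((matrixEnd_mem_modelFibre_iff _).1 hJ).2.2.posSemidef
  have he := signMatrix_sq n
  conv_rhs => rw [← matrixEnd_endMatrix J.2.2.2.1]
  congr 1
  change signMatrix n * msqrt (signMatrix n * (-Complex.I • endMatrix J.1)) * signMatrix n *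
    (Complex.I • signMatrix n) * msqrt (signMatrix n * (-Complex.I • endMatrix J.1)) =
      endMatrix J.1
  generalize hQ : msqrt (signMatrix n * (-Complex.I • endMatrix J.1)) = Q at *
  calc _ = Complex.I • (signMatrix n * Q * (signMatrix n * signMatrix n) * Q) := by
        simp only [Matrix.smul_mul, Matrix.mul_smul, Matrix.mul_assoc]
    _ = Complex.I • (signMatrix n * (Q * Q)) := by
        rw [he, Matrix.mul_one, Matrix.mul_assoc]
    _ = _ := by
        rw [hp, ← Matrix.mul_assoc, he, Matrix.one_mul, smul_smul]; simp

/-- The orbit map of the base point is a homeomorphism because the positive square root provides a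
continuous section. -/
theorem exists_modelHomeomorph (n : ℕ) :
    ∃ Θ : (Unn n ⧸ UnUn n) ≃ₜ modelFibre n, ∀ g : Unn n,
      (Θ (QuotientGroup.mk g) : ModelSpace n →L[ℝ] ModelSpace n) =
        matrixEnd ((g : GL (Fin n ⊕ Fin n) ℂ).val * modelBase n *
          ((g : GL (Fin n ⊕ Fin n) ℂ)⁻¹).val) := by
  have hcont : Continuous (orbitMatrix : Unn n → _) := by
    unfold orbitMatrix
    exact ((Units.continuous_val.comp continuous_subtype_val).matrix_mul
      continuous_const).matrix_mul
        (Units.continuous_val.comp (continuous_inv.comp continuous_subtype_val))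
  let F : Unn n → modelFibre n := fun g => ⟨matrixEnd (orbitMatrix g), orbit_mem g⟩
  have hF : Continuous F := (continuous_matrixEnd.comp hcont).subtype_mk _
  have hFeq : ∀ g g', F g = F g' ↔ g⁻¹ * g' ∈ UnUn n := by
    intro g g'
    rw [← orbitMatrix_eq_iff, Subtype.ext_iff]
    constructor
    · intro h
      have := congrArg endMatrix h
      rwa [endMatrix_matrixEnd, endMatrix_matrixEnd] at this
    · intro h; exact congrArg matrixEnd h
  have hFs : ∀ J, F (modelSection J) = J := fun J => Subtype.ext (orbitMatrix_modelSection J)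
  let f : Unn n ⧸ UnUn n → modelFibre n := Quotient.lift F fun g g' h => by
    rw [hFeq]; exact QuotientGroup.leftRel_apply.1 h
  refine ⟨{ toFun := f
            invFun := fun J => QuotientGroup.mk (modelSection J)
            left_inv := ?_
            right_inv := hFs
            continuous_toFun := continuous_quot_lift _ hF
            continuous_invFun := continuous_quot_mk.comp continuous_modelSection }, fun g => rfl⟩
  intro q
  induction q using QuotientGroup.induction_on with
  | H g =>
    apply QuotientGroup.eq.2
    rw [← hFeq, hFs]
    rfl

end Model

/-! ### Complex linear isometries with the model -/

section Frame

open Matrix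

variable {W : Type*} [AddCommGroup W] [Module ℝ W] [TopologicalSpace W]

/-- A real vector space with a complex structure `J` has complex linear coordinates. -/
lemma exists_complexCoord [FiniteDimensional ℝ W] {d : ℕ} (hd : Module.finrank ℝ W = 2 * d)
    (J : W →ₗ[ℝ] W) (hJ : ∀ e, J (J e) = -e) :
    ∃ ℓ : (Fin d → ℂ) ≃ₗ[ℝ] W, ∀ v, ℓ (Complex.I • v) = J (ℓ v) := by
  have hJ2 : (J : Module.End ℝ W) * J = -1 := by ext e; simpa using hJ e
  let C : ℂ →ₐ[ℝ] Module.End ℝ W := Complex.lift ⟨J, hJ2⟩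
  letI : Module ℂ W := Module.compHom W C.toRingHom
  have hsm : ∀ (z : ℂ) (w : W), z • w = C z w := fun _ _ => rfl
  haveI : IsScalarTower ℝ ℂ W := ⟨fun r z w => by simp [hsm, map_smul]⟩
  haveI : Module.Finite ℂ W := Module.Finite.of_restrictScalars_finite ℝ ℂ W
  have hr : Module.finrank ℂ W = d := by
    have := Module.finrank_mul_finrank ℝ ℂ W
    rw [Complex.finrank_real_complex, hd] at this
    omega
  let b := Module.finBasisOfFinrankEq ℂ W hr
  refine ⟨(b.equivFun.symm.restrictScalars ℝ), fun v => ?_⟩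
  have : b.equivFun.symm (Complex.I • v) = Complex.I • b.equivFun.symm v := map_smul _ _ _
  simp only [LinearEquiv.restrictScalars_apply, this, hsm]
  simp [C]

/-- The real part of the Hermitian form with matrix `H`. -/
lemma exists_hermitian_gram {d : ℕ} (B : LinearMap.BilinForm ℝ (Fin d → ℂ))
    (hs : ∀ v w, B v w = B w v) (hI : ∀ v w, B (Complex.I • v) (Complex.I • w) = B v w) :
    ∃ H : Matrix (Fin d) (Fin d) ℂ, H.IsHermitian ∧ ∀ v w, B v w = (star v ⬝ᵥ (H *ᵥ w)).re := by
  have hI' : ∀ v w, B (Complex.I • v) w = -B v (Complex.I • w) := by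
    intro v w
    rw [← hI v (Complex.I • w), smul_smul, Complex.I_mul_I, neg_one_smul, map_neg, neg_neg]
  let e : Fin d → (Fin d → ℂ) := fun i => Pi.single i 1
  let H : Matrix (Fin d) (Fin d) ℂ :=
    Matrix.of fun i j => (⟨B (e i) (e j), -B (e i) (Complex.I • e j)⟩ : ℂ)
  refine ⟨H, ?_, fun v w => ?_⟩
  · ext i j
    apply Complex.ext
    · simp [H, hs (e j) (e i)]
    · simp only [H, conjTranspose_apply, of_apply, RCLike.star_def, Complex.conj_im, neg_neg]
      rw [hs, hI']
  · have hexp : ∀ v : Fin d → ℂ,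
        v = ∑ i, ((v i).re • e i + (v i).im • (Complex.I • e i)) := by
      intro v
      funext k
      simp only [Finset.sum_apply, Pi.add_apply, Pi.smul_apply, e, Pi.single_apply]
      simp only [smul_ite, smul_zero, Finset.sum_add_distrib, Finset.sum_ite_eq,
        Finset.mem_univ, if_true]
      simp [Complex.re_add_im]
    have h1 : B v w = ∑ i, ∑ j, B ((v i).re • e i + (v i).im • (Complex.I • e i))
        ((w j).re • e j + (w j).im • (Complex.I • e j)) := by
      conv_lhs => rw [hexp v, hexp w]
      simp only [map_sum, LinearMap.sum_apply]
      exact Finset.sum_comm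
    rw [h1]
    simp only [dotProduct, mulVec, Finset.mul_sum, Complex.re_sum]
    refine Finset.sum_congr rfl fun i _ => Finset.sum_congr rfl fun j _ => ?_
    simp only [map_add, map_smul, LinearMap.add_apply, LinearMap.smul_apply, hI, hI' (e i) (e j),
      smul_eq_mul, H, of_apply, Pi.star_apply, RCLike.star_def, Complex.mul_re, Complex.mul_im,
      Complex.conj_re, Complex.conj_im]
    ring

/-- A definite subspace meets an isotropic subspace trivially, so it has at most the
complementary dimension. -/
lemma card_le_of_isotropic [FiniteDimensional ℝ W] {n : ℕ} (hd : Module.finrank ℝ W = 4 * n)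
    (β : LinearMap.BilinForm ℝ W) (Z : Submodule ℝ W) (hZ : Module.finrank ℝ Z = 2 * n)
    (hiso : ∀ z ∈ Z, β z z = 0) {κ : Type*} [Fintype κ] (f : (κ → ℂ) →ₗ[ℝ] W)
    (hf : ∀ u, u ≠ 0 → β (f u) (f u) ≠ 0) : Fintype.card κ ≤ n := by
  have hinj : Function.Injective f := by
    refine (injective_iff_map_eq_zero f).2 fun u hu => ?_
    by_contra h
    exact hf u h (by simp [hu])
  have hdis : Disjoint (LinearMap.range f) Z := by
    rw [Submodule.disjoint_def]
    rintro _ ⟨u, rfl⟩ hz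
    by_contra h
    exact hf u (fun h0 => h (by simp [h0])) (hiso _ hz)
  have h1 := Submodule.finrank_add_finrank_le_of_disjoint hdis
  rw [LinearMap.finrank_range_of_inj hinj, hZ, hd, Module.finrank_pi_fintype] at h1
  simp only [Complex.finrank_real_complex, Finset.sum_const, Finset.card_univ, smul_eq_mul] at h1
  omega

/-- A nondegenerate Hermitian form is diagonal with entries `± 1` in suitable coordinates. -/
lemma exists_diagonal {d : ℕ} (B : LinearMap.BilinForm ℝ (Fin d → ℂ))
    (hs : ∀ v w, B v w = B w v) (hI : ∀ v w, B (Complex.I • v) (Complex.I • w) = B v w)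
    (hnd : ∀ v, (∀ w, B v w = 0) → v = 0) :
    ∃ (ℓ : (Fin d → ℂ) ≃ₗ[ℂ] (Fin d → ℂ)) (ε : Fin d → ℝ), (∀ i, ε i = 1 ∨ ε i = -1) ∧
      ∀ v w, B (ℓ v) (ℓ w) = (∑ i, star (v i) * (ε i * w i)).re := by
  obtain ⟨H, hH, hB⟩ := exists_hermitian_gram B hs hI
  let U : Matrix (Fin d) (Fin d) ℂ := hH.eigenvectorUnitary
  have hU : Uᴴ * U = 1 := (Matrix.mem_unitaryGroup_iff').1 hH.eigenvectorUnitary.2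
  have hU' : U * Uᴴ = 1 := (Matrix.mem_unitaryGroup_iff).1 hH.eigenvectorUnitary.2
  let lam := hH.eigenvalues
  have hUHU : Uᴴ * H * U = diagonal fun i => (lam i : ℂ) := by
    have h := hH.spectral_theorem
    rw [Unitary.conjStarAlgAut_apply] at h
    have h' : H = U * diagonal (fun i => (lam i : ℂ)) * Uᴴ := h
    rw [h']
    calc _ = (Uᴴ * U) * diagonal (fun i => (lam i : ℂ)) * (Uᴴ * U) := by
          simp only [Matrix.mul_assoc]
      _ = _ := by rw [hU]; simp
  have hdiag : ∀ v w, B (U *ᵥ v) (U *ᵥ w) = (∑ i, star (v i) * (lam i * w i)).re := by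
    intro v w
    have h1 : star (U *ᵥ v) ⬝ᵥ (H *ᵥ (U *ᵥ w)) = star v ⬝ᵥ ((Uᴴ * H * U) *ᵥ w) := by
      rw [star_mulVec, ← Matrix.dotProduct_mulVec]
      simp [Matrix.mul_assoc]
    rw [hB, h1, hUHU]
    simp [dotProduct, mulVec_diagonal]
  have hinj : ∀ v, U *ᵥ v = 0 → v = 0 := by
    intro v hv
    have : Uᴴ *ᵥ (U *ᵥ v) = 0 := by rw [hv]; simp
    simpa [hU] using this
  have hlam : ∀ i, lam i ≠ 0 := by
    intro i hi
    have h1 : U *ᵥ (Pi.single i 1) = 0 := by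
      apply hnd
      intro w
      have hw : w = U *ᵥ (Uᴴ *ᵥ w) := by simp [hU']
      rw [hw, hdiag]
      have : ∀ j, star ((Pi.single i (1 : ℂ) : Fin d → ℂ) j) * (lam j * (Uᴴ *ᵥ w) j) = 0 := by
        intro j
        by_cases hj : j = i
        · subst hj; simp [hi]
        · simp [Pi.single_apply, hj]
      rw [Finset.sum_eq_zero fun j _ => this j, Complex.zero_re]
    have := congrFun (hinj _ h1) i
    simp at this
  -- Rescaling the eigenvectors makes the eigenvalues equal to `± 1`.
  let r : Fin d → ℝ := fun i => (Real.sqrt |lam i|)⁻¹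
  have hr : ∀ i, r i ≠ 0 := fun i =>
    inv_ne_zero (Real.sqrt_ne_zero'.2 (abs_pos.2 (hlam i)))
  have hrr : ∀ i, r i * r i * |lam i| = 1 := by
    intro i
    have := Real.mul_self_sqrt (abs_nonneg (lam i))
    have h0 := (Real.sqrt_ne_zero'.2 (abs_pos.2 (hlam i)))
    simp only [r]
    field_simp
    rw [sq, this]
  let T : Matrix (Fin d) (Fin d) ℂ := U * diagonal (fun i => (r i : ℂ))
  have hTi : Function.Injective (Matrix.toLin' T) := by
    refine (injective_iff_map_eq_zero _).2 fun v hv => ?_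
    rw [Matrix.toLin'_apply] at hv
    simp only [T] at hv
    rw [← Matrix.mulVec_mulVec] at hv
    have := hinj _ hv
    funext i
    have h := congrFun this i
    simp only [mulVec_diagonal, Pi.zero_apply, mul_eq_zero, Complex.ofReal_eq_zero] at h
    exact h.resolve_left (hr i)
  refine ⟨LinearEquiv.ofInjectiveEndo _ hTi, fun i => r i * r i * lam i, fun i => ?_,
    fun v w => ?_⟩
  · have := hrr i
    rcases lt_or_gt_of_ne (hlam i) with h | h
    · rw [abs_of_neg h] at this
      right; linarith
    · rw [abs_of_pos h] at this
      left; exact this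
  · have hT : ∀ v, (LinearEquiv.ofInjectiveEndo _ hTi) v
        = U *ᵥ (fun i => (r i : ℂ) * v i) := by
      intro v
      rw [LinearEquiv.coe_ofInjectiveEndo, Matrix.toLin'_apply]
      simp only [T]
      rw [← Matrix.mulVec_mulVec]
      congr 1
      funext i
      simp [mulVec_diagonal]
    rw [hT, hT, hdiag]
    congr 1
    refine Finset.sum_congr rfl fun i _ => ?_
    simp only [star_mul', RCLike.star_def, Complex.conj_ofReal]
    push_cast
    ring

/-- A generalized complex structure on a real vector space of dimension `4n` with a nondegenerate
symmetric form that has an isotropic subspace of dimension `2n` is isometric to the model. -/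
theorem exists_frame [FiniteDimensional ℝ W] [IsTopologicalAddGroup W] [ContinuousSMul ℝ W]
    [T2Space W] {n : ℕ} (hd : Module.finrank ℝ W = 4 * n)
    {β : LinearMap.BilinForm ℝ W} (hs : ∀ e f, β e f = β f e)
    (hnd : ∀ e, (∀ f, β e f = 0) → e = 0) (Z : Submodule ℝ W)
    (hZ : Module.finrank ℝ Z = 2 * n) (hiso : ∀ z ∈ Z, β z z = 0)
    {J : W →L[ℝ] W} (hJ : IsGenComplex β J) :
    ∃ L : ModelSpace n ≃L[ℝ] W, (∀ v, L (modelI n v) = J (L v)) ∧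
      ∀ v w, β (L v) (L w) = modelForm n v w := by
  obtain ⟨ℓ, hℓ⟩ := exists_complexCoord (d := 2 * n) (by omega) (J : W →ₗ[ℝ] W) hJ.2
  obtain ⟨T, ε, hε, hT⟩ := exists_diagonal
    (B := (β.compl₁₂ (ℓ : (Fin (2 * n) → ℂ) →ₗ[ℝ] W) (ℓ : (Fin (2 * n) → ℂ) →ₗ[ℝ] W)))
    (fun v w => by simp [hs (ℓ v)])
    (fun v w => by simpa [hℓ] using hJ.1 (ℓ v) (ℓ w))
    (fun v hv => by
      have : ℓ v = 0 := hnd _ fun f => by simpa using hv (ℓ.symm f)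
      simpa using this)
  simp only [LinearMap.compl₁₂_apply, LinearEquiv.coe_coe] at hT
  -- The isotropic subspace bounds the number of positive and of negative entries by `n`; as there
  -- are `2n` entries, the signature is `(n, n)`.
  have key : ∀ (δ : ℝ), δ = 1 ∨ δ = -1 → Fintype.card {i // ε i = δ} ≤ n := by
    intro δ hδ
    let g : ({i // ε i = δ} → ℂ) →ₗ[ℝ] (Fin (2 * n) → ℂ) :=
      { toFun := fun u i => if h : ε i = δ then u ⟨i, h⟩ else 0
        map_add' := by intro u v; funext i; by_cases h : ε i = δ <;> simp [h]
        map_smul' := by intro r v; funext i; by_cases h : ε i = δ <;> simp [h] }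
    refine card_le_of_isotropic hd β Z hZ hiso
      ((ℓ : (Fin (2 * n) → ℂ) →ₗ[ℝ] W).comp
        (((T : (Fin (2 * n) → ℂ) →ₗ[ℂ] _).restrictScalars ℝ).comp g)) fun u hu => ?_
    have h1 : (∑ i, star (g u i) * (ε i * g u i)).re = δ * ∑ i, Complex.normSq (g u i) := by
      rw [Complex.re_sum, Finset.mul_sum]
      refine Finset.sum_congr rfl fun i _ => ?_
      by_cases h : ε i = δ
      · simp only [RCLike.star_def, Complex.mul_re, Complex.mul_im, Complex.conj_re,
          Complex.conj_im, Complex.ofReal_re, Complex.ofReal_im, Complex.normSq_apply, h]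
        ring
      · simp [g, h]
    have h2 : β (ℓ (T (g u))) (ℓ (T (g u))) = δ * ∑ i, Complex.normSq (g u i) := by
      rw [hT, h1]
    change β (ℓ (T (g u))) (ℓ (T (g u))) ≠ 0
    rw [h2]
    refine mul_ne_zero (by rcases hδ with h | h <;> simp [h]) ?_
    intro h0
    rw [Finset.sum_eq_zero_iff_of_nonneg fun i _ => Complex.normSq_nonneg _] at h0
    apply hu
    funext i
    have := h0 i.1 (Finset.mem_univ _)
    rw [Complex.normSq_eq_zero] at this
    simpa [g, i.2] using this
  have hp := key 1 (Or.inl rfl)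
  have hq := key (-1) (Or.inr rfl)
  have hneg : ∀ i, ε i = -1 ↔ ¬ ε i = 1 := by
    intro i
    rcases hε i with h | h <;> rw [h] <;> norm_num
  have hq' : Fintype.card {i // ¬ ε i = 1} ≤ n := by
    rw [Fintype.card_congr (Equiv.subtypeEquivRight fun i => (hneg i).symm)]
    exact hq
  have hpq : Fintype.card {i // ε i = 1} + Fintype.card {i // ¬ ε i = 1} = 2 * n := by
    rw [← Fintype.card_sum, Fintype.card_congr (Equiv.sumCompl _), Fintype.card_fin]
  -- Reorder the coordinates so that the positive entries come first.
  let s : Fin n ⊕ Fin n ≃ Fin (2 * n) :=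
    (Equiv.sumCongr (Fintype.equivFinOfCardEq (by omega : Fintype.card {i // ε i = 1} = n)).symm
      (Fintype.equivFinOfCardEq (by omega : Fintype.card {i // ¬ ε i = 1} = n)).symm).trans
      (Equiv.sumCompl _)
  have hs1 : ∀ i, ε (s (Sum.inl i)) = 1 := fun i =>
    ((Fintype.equivFinOfCardEq (by omega : Fintype.card {i // ε i = 1} = n)).symm i).2
  have hs2 : ∀ i, ε (s (Sum.inr i)) = -1 := fun i => (hneg _).2
    ((Fintype.equivFinOfCardEq (by omega : Fintype.card {i // ¬ ε i = 1} = n)).symm i).2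
  let S : ModelSpace n ≃ₗ[ℂ] (Fin (2 * n) → ℂ) := LinearEquiv.funCongrLeft ℂ ℂ s.symm
  have hS : ∀ v i, S v (s i) = v i := by
    intro v i
    simp [S, LinearEquiv.funCongrLeft, LinearMap.funLeft]
  refine ⟨(((S.trans T).restrictScalars ℝ).trans ℓ).toContinuousLinearEquiv, fun v => ?_,
    fun v w => ?_⟩
  · change ℓ (T (S (Complex.I • v))) = J (ℓ (T (S v)))
    rw [map_smul, map_smul, hℓ]
    rfl
  · change β (ℓ (T (S v))) (ℓ (T (S w))) = _
    rw [hT, modelForm_apply, ← Equiv.sum_comp s]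
    simp only [hS, Fintype.sum_sum_type, hs1, hs2]
    simp [dotProduct, signMatrix, Matrix.fromBlocks_mulVec, Matrix.neg_mulVec,
      Fintype.sum_sum_type]

end Frame

/-! ### Isometries depending smoothly on the generalized complex structure -/

section LocalIsometry

/-- A subspace of a finite-dimensional algebra which is closed under squaring and contains `1`
contains smooth square roots near `1`. -/
lemma exists_local_sqrt {E : Type*} [NormedRing E] [NormedAlgebra ℝ E] [FiniteDimensional ℝ E]
    (E₀ : Submodule ℝ E) (h1 : (1 : E) ∈ E₀) (hsq : ∀ a ∈ E₀, a * a ∈ E₀) :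
    ∃ Q : E → E, Q 1 = 1 ∧ (∀ᶠ Z in 𝓝 (1 : E), ContDiffAt ℝ ∞ Q Z) ∧ (∀ Z, Q Z ∈ E₀) ∧
      ∀ᶠ Z in 𝓝 (1 : E), Z ∈ E₀ → Q Z * Q Z = Z := by
  haveI : CompleteSpace E := FiniteDimensional.complete ℝ E
  haveI : CompleteSpace E₀ := FiniteDimensional.complete ℝ E₀
  obtain ⟨p', hp'⟩ := LinearMap.exists_leftInverse_of_injective E₀.subtype (by simp)
  -- A linear projection onto the subspace extends the square root to a map defined on all of `E`.
  let p : E →L[ℝ] E₀ := LinearMap.toContinuousLinearMap p'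
  have hp : ∀ a : E₀, p a = a := fun a => LinearMap.congr_fun hp' a
  let F : E₀ → E₀ := fun a => p ((a : E) * a)
  have hF : ContDiff ℝ ω F := by
    have h : ContDiff ℝ ω fun a : E₀ => (a : E) := E₀.subtypeL.contDiff
    exact p.contDiff.comp (h.mul h)
  have hFa : ∀ a : E₀, (F a : E) = a * a := fun a =>
    congrArg Subtype.val (hp ⟨_, hsq a a.2⟩)
  let one : E₀ := ⟨1, h1⟩
  have hF1 : F one = one := Subtype.ext (by rw [hFa]; simp [one])
  let two : E₀ ≃L[ℝ] E₀ := ContinuousLinearEquiv.smulLeft (Units.mk0 (2 : ℝ) two_ne_zero)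
  have hd : HasFDerivAt F (two : E₀ →L[ℝ] E₀) one := by
    have h : HasFDerivAt (fun a : E₀ => (a : E)) E₀.subtypeL one := E₀.subtypeL.hasFDerivAt
    refine (p.hasFDerivAt.comp one (h.mul' h)).congr_fderiv ?_
    ext a
    have h2 : p ((1 : E) * a + a * 1) = (2 : ℝ) • a := by
      rw [one_mul, mul_one, map_add, hp, two_smul]
    exact congrArg Subtype.val h2
  -- The derivative of squaring at `1` is multiplication by `2`, so it has a smooth local inverse.
  let R := hF.contDiffAt.localInverse hd (by simp)
  have hR1 : R one = one := by
    have := hF.contDiffAt.localInverse_apply_image hd (by simp)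
    rwa [hF1] at this
  have hRs : ContDiffAt ℝ ω R one := by
    have := hF.contDiffAt.to_localInverse hd (by simp)
    rwa [hF1] at this
  have hRi : ∀ᶠ y in 𝓝 one, F (R y) = y := by
    have := (hF.contDiffAt.hasStrictFDerivAt' hd (by simp)).eventually_right_inverse
    rwa [hF1] at this
  have hp1 : p 1 = one := hp one
  have hpt : Filter.Tendsto p (𝓝 1) (𝓝 one) := by
    have := p.continuous.tendsto 1
    rwa [hp1] at this
  refine ⟨fun Z => R (p Z), by simp [hp1, hR1, one], ?_, fun Z => (R (p Z)).2, ?_⟩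
  · have h : ContDiffAt ℝ ω (fun Z => (R (p Z) : E)) 1 := by
      refine E₀.subtypeL.contDiff.contDiffAt.comp (1 : E) (ContDiffAt.comp (1 : E) ?_
        p.contDiff.contDiffAt)
      rw [hp1]; exact hRs
    filter_upwards [h.eventually (by simp)] with Z hZ
    exact hZ.of_le (by simp)
  · filter_upwards [hpt.eventually hRi] with Z hZ hZ0
    have h := congrArg Subtype.val hZ
    rw [hFa] at h
    rw [h]
    exact congrArg Subtype.val (hp ⟨Z, hZ0⟩)

variable {W : Type*} [NormedAddCommGroup W] [NormedSpace ℝ W] [FiniteDimensional ℝ W]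

/-- For `J` near `J₀`, the polar part of `(1 - J J₀) / 2` is an isometry which conjugates `J₀` into
`J` and which depends smoothly on `J`. -/
theorem exists_local_isometry {β : LinearMap.BilinForm ℝ W}
    (hnd : ∀ e, (∀ f, β e f = 0) → e = 0) {J₀ : W →L[ℝ] W} (h₀ : IsGenComplex β J₀) :
    ∃ G : (W →L[ℝ] W) → (W →L[ℝ] W), (∀ᶠ J in 𝓝 J₀, ContDiffAt ℝ ∞ G J) ∧
      ∀ᶠ J in 𝓝 J₀, IsGenComplex β J → G J * J₀ = J * G J ∧
        (∀ e f, β (G J e) (G J f) = β e f) ∧ IsUnit (G J) := by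
  -- The symmetric endomorphisms which commute with `J₀`.
  let E₀ : Submodule ℝ (W →L[ℝ] W) :=
    { carrier := {A | (∀ e f, β (A e) f = β e (A f)) ∧ A * J₀ = J₀ * A}
      add_mem' := by
        rintro A B ⟨hA, hA'⟩ ⟨hB, hB'⟩
        exact ⟨fun e f => by simp [hA, hB], by rw [add_mul, mul_add, hA', hB']⟩
      zero_mem' := ⟨fun e f => by simp, by simp⟩
      smul_mem' := by
        rintro r A ⟨hA, hA'⟩
        exact ⟨fun e f => by simp [hA], by rw [smul_mul_assoc, mul_smul_comm, hA']⟩ }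
  obtain ⟨Q, hQ1, hQs, hQm, hQQ⟩ := exists_local_sqrt E₀ ⟨fun e f => rfl, by simp⟩ (by
    rintro A ⟨hA, hA'⟩
    refine ⟨fun e f => ?_, by rw [mul_assoc, hA', ← mul_assoc, hA', mul_assoc]⟩
    simp [mul_apply_eq_comp, hA])
  -- For orthogonal `J`, `Z J` is the product of `(1 - J J₀) / 2` with its adjoint.
  let Z : (W →L[ℝ] W) → (W →L[ℝ] W) := fun J => (1 / 4 : ℝ) • ((2 : ℝ) • 1 - J₀ * J - J * J₀)
  have hJJ := h₀.mul_self
  have hZ0 : Z J₀ = 1 := by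
    simp only [Z, hJJ]
    module
  have hZs : ContDiff ℝ ∞ Z := by
    simp only [Z]
    fun_prop
  have hZt : Filter.Tendsto Z (𝓝 J₀) (𝓝 1) := by
    have := hZs.continuous.tendsto J₀
    rwa [hZ0] at this
  have hQc : ContinuousAt Q 1 := hQs.self_of_nhds.continuousAt
  have hQu : ∀ᶠ A in 𝓝 (1 : W →L[ℝ] W), IsUnit (Q A) := by
    refine hQc.eventually (p := IsUnit) ?_
    rw [hQ1]
    exact Units.isOpen.mem_nhds isUnit_one
  refine ⟨fun J => ((1 / 2 : ℝ) • (1 - J * J₀)) * Ring.inverse (Q (Z J)), ?_, ?_⟩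
  · filter_upwards [hZt.eventually hQs, hZt.eventually hQu] with J h1 h2
    refine ContDiffAt.mul (by fun_prop) ?_
    obtain ⟨u, hu⟩ := h2
    have h3 : ContDiffAt ℝ ∞ (fun J => Q (Z J)) J := ContDiffAt.comp J h1 hZs.contDiffAt
    refine ContDiffAt.comp (g := Ring.inverse) J ?_ h3
    rw [← hu]
    exact contDiffAt_ringInverse ℝ u
  · filter_upwards [hZt.eventually hQQ, hZt.eventually hQu] with J h1 h2 hJ
    have hJJ' := hJ.mul_self
    have hZm : Z J ∈ E₀ := by
      refine ⟨fun e f => ?_, ?_⟩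
      · simp only [Z, smul_apply, sub_apply, map_smul,
          map_sub, mul_apply_eq_comp, LinearMap.smul_apply,
          LinearMap.sub_apply, hJ.skew, h₀.skew, one_apply_eq_self,
          map_neg, neg_neg]
        simp only [smul_eq_mul]
        ring
      · have e1 : J₀ * J * J₀ = J₀ * (J * J₀) := mul_assoc _ _ _
        have e2 : J * J₀ * J₀ = -J := by rw [mul_assoc, hJJ, mul_neg, mul_one]
        have e3 : J₀ * (J₀ * J) = -J := by rw [← mul_assoc, hJJ, neg_mul, one_mul]
        simp only [Z, smul_mul_assoc, mul_smul_comm, sub_mul, mul_sub, one_mul, mul_one, e1, e2,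
          e3]
        congr 1
        abel
    have hsq := h1 hZm
    obtain ⟨hQa, hQc'⟩ := hQm (Z J)
    set R := Ring.inverse (Q (Z J)) with hR
    have hRl : R * Q (Z J) = 1 := Ring.inverse_mul_cancel _ h2
    have hRr : Q (Z J) * R = 1 := Ring.mul_inverse_cancel _ h2
    have hRc : R * J₀ = J₀ * R := by
      calc R * J₀ = R * (J₀ * Q (Z J)) * R := by rw [mul_assoc, mul_assoc, hRr, mul_one]
        _ = (R * Q (Z J)) * J₀ * R := by rw [← hQc']; simp only [mul_assoc]
        _ = J₀ * R := by rw [hRl, one_mul]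
    -- `Z J` measures the failure of `(1 - J J₀) / 2` to be an isometry; its square root
    -- corrects it.
    have hiso : ∀ e f, β (((1 / 2 : ℝ) • (1 - J * J₀)) e) (((1 / 2 : ℝ) • (1 - J * J₀)) f)
        = β e (Z J f) := by
      intro e f
      simp only [Z, smul_apply, sub_apply, map_smul,
        map_sub, mul_apply_eq_comp, LinearMap.smul_apply,
        LinearMap.sub_apply, one_apply_eq_self]
      simp only [hJ.skew, h₀.skew, hJ.2, h₀.2, map_neg, smul_eq_mul]
      ring
    have hiso' : ∀ e f, β ((((1 / 2 : ℝ) • (1 - J * J₀)) * R) e)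
        ((((1 / 2 : ℝ) • (1 - J * J₀)) * R) f) = β e f := by
      intro e f
      rw [mul_apply_eq_comp, mul_apply_eq_comp, hiso,
        ← hsq, mul_apply_eq_comp, ← hQa]
      have a1 : Q (Z J) (R e) = e := DFunLike.congr_fun hRr e
      have a2 : Q (Z J) (R f) = f := DFunLike.congr_fun hRr f
      rw [a1, a2]
    refine ⟨?_, hiso', isUnit_of_injective _ fun e he => hnd e fun f => ?_⟩
    · have e1 : (1 - J * J₀) * J₀ = J * (1 - J * J₀) := by
        rw [sub_mul, mul_sub, mul_assoc, hJJ, ← mul_assoc, hJJ']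
        simp only [one_mul, mul_one, mul_neg, neg_mul]
        abel
      rw [mul_assoc, hRc, ← mul_assoc, smul_mul_assoc, e1, ← mul_smul_comm, mul_assoc]
    · rw [← hiso', he]; simp

end LocalIsometry

/-! ### Coordinate expressions of sections -/

section Coordinates

variable {n : ℕ} {M : Type*} [TopologicalSpace M] [ChartedSpace (Eu n) M]

/-- The space of endomorphisms of `ℝ²ⁿ ⊕ (ℝ²ⁿ)*`, in which coordinate expressions of sections of
`End (TM ⊕ T*M)` take their values. -/
abbrev EuEnd (n : ℕ) : Type := GenTangent (Eu n) →L[ℝ] GenTangent (Eu n)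

instance (x : M) : FiniteDimensional ℝ (Tan n x) := inferInstanceAs (FiniteDimensional ℝ (Eu n))

instance (x : M) : T2Space (Tan n x) := inferInstanceAs (T2Space (Eu n))

instance (x : M) : FiniteDimensional ℝ (GenTangent (Tan n x)) :=
  inferInstanceAs (FiniteDimensional ℝ (GenTangent (Eu n)))

instance (x : M) : T2Space (GenTangent (Tan n x)) :=
  inferInstanceAs (T2Space (GenTangent (Eu n)))

variable [IsManifold (𝓡 (2 * n)) ∞ M]

section ClmSmoothness

variable {E W : Type*} [NormedAddCommGroup E] [NormedSpace ℝ E] [NormedAddCommGroup W]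
  [NormedSpace ℝ W] {s : Set E}

lemma contDiffOn_clm_mul {f g : E → W →L[ℝ] W} (hf : ContDiffOn ℝ ∞ f s)
    (hg : ContDiffOn ℝ ∞ g s) : ContDiffOn ℝ ∞ (fun x => f x * g x) s := hf.mul hg

lemma contDiffOn_clm_smul {r : E → ℝ} {f : E → W →L[ℝ] W} (hr : ContDiffOn ℝ ∞ r s)
    (hf : ContDiffOn ℝ ∞ f s) : ContDiffOn ℝ ∞ (fun x => r x • f x) s := hr.smul hf

lemma contDiffOn_clm_inverse [FiniteDimensional ℝ W] {f : E → W →L[ℝ] W}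
    (hf : ContDiffOn ℝ ∞ f s) (hu : ∀ x ∈ s, IsUnit (f x)) :
    ContDiffOn ℝ ∞ (fun x => Ring.inverse (f x)) s := by
  haveI : CompleteSpace W := FiniteDimensional.complete ℝ W
  intro x hx
  obtain ⟨u, hu'⟩ := hu x hx
  refine ContDiffAt.comp_contDiffWithinAt (g := Ring.inverse) x ?_ (hf x hx)
  rw [← hu']
  exact contDiffAt_ringInverse ℝ u

end ClmSmoothness

section Smoothness

variable {F : Type*} [NormedAddCommGroup F] [NormedSpace ℝ F]
  {P : Type*} [NormedAddCommGroup P] [NormedSpace ℝ P]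

/-- Smoothness over a chart domain, jointly with a parameter, is smoothness in the coordinates. -/
lemma contMDiffOn_family_iff (c : M) {U : Set P} {f : P × M → F} :
    ContMDiffOn (𝓘(ℝ, P).prod (𝓡 (2 * n))) 𝓘(ℝ, F) ∞ f (U ×ˢ (chartAt (Eu n) c).source) ↔
      ContDiffOn ℝ ∞ (fun q : P × Eu n => f (q.1, (chartAt (Eu n) c).symm q.2))
        (U ×ˢ (chartAt (Eu n) c).target) := by
  have key : ∀ (g : P × Eu n → F) (s : Set (P × Eu n)),
      ContMDiffOn (𝓘(ℝ, P).prod 𝓘(ℝ, Eu n)) 𝓘(ℝ, F) ∞ g s ↔ ContDiffOn ℝ ∞ g s := by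
    intro g s
    rw [← contMDiffOn_iff_contDiffOn, modelWithCornersSelf_prod, ← chartedSpaceSelf_prod]
  rw [← key]
  constructor
  · intro h
    refine ContMDiffOn.comp (t := U ×ˢ (chartAt (Eu n) c).source) (g := f)
      (f := fun q : P × Eu n => (q.1, (chartAt (Eu n) c).symm q.2)) h ?_ ?_
    · refine ContMDiffOn.prodMk contMDiffOn_fst ?_
      exact ContMDiffOn.comp (contMDiffOn_chart_symm (x := c)) contMDiffOn_snd fun q hq => hq.2
    · rintro q ⟨h1, h2⟩
      exact ⟨h1, (chartAt (Eu n) c).map_target h2⟩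
  · intro h
    have h2 := ContMDiffOn.comp (t := U ×ˢ (chartAt (Eu n) c).target)
      (s := U ×ˢ (chartAt (Eu n) c).source)
      (f := fun q : P × M => (q.1, chartAt (Eu n) c q.2)) (I := 𝓘(ℝ, P).prod (𝓡 (2 * n))) h
      (ContMDiffOn.prodMk contMDiffOn_fst
        (ContMDiffOn.comp (contMDiffOn_chart (x := c)) contMDiffOn_snd fun q hq => hq.2))
      (fun q hq => ⟨hq.1, (chartAt (Eu n) c).map_source hq.2⟩)
    refine h2.congr ?_
    rintro q ⟨-, hq⟩
    simp [(chartAt (Eu n) c).left_inv hq]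

lemma contMDiffOn_chart_iff (c : M) {f : M → F} {s : Set M} :
    ContMDiffOn (𝓡 (2 * n)) 𝓘(ℝ, F) ∞ f (s ∩ (chartAt (Eu n) c).source) ↔
      ContDiffOn ℝ ∞ (fun y => f ((chartAt (Eu n) c).symm y))
        ((chartAt (Eu n) c).target ∩ (chartAt (Eu n) c).symm ⁻¹' s) := by
  rw [← contMDiffOn_iff_contDiffOn]
  constructor
  · intro h
    exact h.comp ((contMDiffOn_chart_symm (x := c)).mono Set.inter_subset_left) fun y hy =>
      ⟨hy.2, (chartAt (Eu n) c).map_target hy.1⟩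
  · intro h
    refine (h.comp ((contMDiffOn_chart (x := c)).mono Set.inter_subset_right) fun x hx =>
      ⟨(chartAt (Eu n) c).map_source hx.2, ?_⟩).congr ?_
    · simp [(chartAt (Eu n) c).left_inv hx.2, hx.1]
    · rintro x ⟨-, hx⟩
      simp [(chartAt (Eu n) c).left_inv hx]

end Smoothness

lemma tanCoord_tanFrame {c x : M} (hx : x ∈ (chartAt (Eu n) c).source) (v : Eu n) :
    tanCoord c x (tanFrame c x v) = v :=
  Bundle.Trivialization.continuousLinearMapAt_symmL _
    (by rwa [TangentBundle.trivializationAt_baseSet]) v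

lemma tanFrame_tanCoord {c x : M} (hx : x ∈ (chartAt (Eu n) c).source) (v : Tan n x) :
    tanFrame c x (tanCoord c x v) = v :=
  Bundle.Trivialization.symmL_continuousLinearMapAt _
    (by rwa [TangentBundle.trivializationAt_baseSet]) v

/-- The coordinate frame at a point of the chart domain, as an isomorphism. -/
noncomputable def tanEquiv {c x : M} (hx : x ∈ (chartAt (Eu n) c).source) : Eu n ≃L[ℝ] Tan n x :=
  ContinuousLinearEquiv.equivOfInverse (tanFrame c x) (tanCoord c x) (tanCoord_tanFrame hx)
    (tanFrame_tanCoord hx)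

lemma genCoord_genFrame {c x : M} (hx : x ∈ (chartAt (Eu n) c).source) (e : GenTangent (Eu n)) :
    genCoord c x (genFrame c x e) = e := (genMap (tanEquiv hx)).symm_apply_apply e

lemma genFrame_genCoord {c x : M} (hx : x ∈ (chartAt (Eu n) c).source) (e : GenTangent (Tan n x)) :
    genFrame c x (genCoord c x e) = e := (genMap (tanEquiv hx)).apply_symm_apply e

lemma genPairing_genFrame {c x : M} (hx : x ∈ (chartAt (Eu n) c).source)
    (e f : GenTangent (Eu n)) :
    genPairing (Tan n x) (genFrame c x e) (genFrame c x f) = genPairing (Eu n) e f :=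
  genPairing_genMap (tanEquiv hx) e f

lemma endCoord_apply (c x : M) (A : GenTangent (Tan n x) →L[ℝ] GenTangent (Tan n x))
    (e : GenTangent (Eu n)) : endCoord c x A e = genCoord c x (A (genFrame c x e)) := rfl

/-- The coordinate expression of endomorphisms at a point of the chart domain is an isomorphism
of algebras. -/
noncomputable def endEquiv {c x : M} (hx : x ∈ (chartAt (Eu n) c).source) :
    (GenTangent (Tan n x) →L[ℝ] GenTangent (Tan n x)) ≃A[ℝ] EuEnd n :=
  (genMap (tanEquiv hx)).symm.conjContinuousAlgEquiv

lemma endEquiv_apply {c x : M} (hx : x ∈ (chartAt (Eu n) c).source)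
    (A : GenTangent (Tan n x) →L[ℝ] GenTangent (Tan n x)) :
    endEquiv hx A = endCoord c x A := rfl

lemma endCoord_mul {c x : M} (hx : x ∈ (chartAt (Eu n) c).source)
    (A B : GenTangent (Tan n x) →L[ℝ] GenTangent (Tan n x)) :
    endCoord c x (A * B) = endCoord c x A * endCoord c x B := map_mul (endEquiv hx) A B

lemma endCoord_one {c x : M} (hx : x ∈ (chartAt (Eu n) c).source) :
    endCoord c x (1 : GenTangent (Tan n x) →L[ℝ] GenTangent (Tan n x)) = 1 := map_one (endEquiv hx)

lemma endCoord_add (c x : M) (A B : GenTangent (Tan n x) →L[ℝ] GenTangent (Tan n x)) :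
    endCoord c x (A + B) = endCoord c x A + endCoord c x B := by
  refine ContinuousLinearMap.ext fun e => ?_
  simp [endCoord_apply]

lemma endCoord_sub (c x : M) (A B : GenTangent (Tan n x) →L[ℝ] GenTangent (Tan n x)) :
    endCoord c x (A - B) = endCoord c x A - endCoord c x B := by
  refine ContinuousLinearMap.ext fun e => ?_
  simp [endCoord_apply]

lemma endCoord_smul (c x : M) (r : ℝ) (A : GenTangent (Tan n x) →L[ℝ] GenTangent (Tan n x)) :
    endCoord c x (r • A) = r • endCoord c x A := by
  refine ContinuousLinearMap.ext fun e => ?_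
  simp [endCoord_apply]

lemma endCoord_inverse {c x : M} (hx : x ∈ (chartAt (Eu n) c).source)
    (A : GenTangent (Tan n x) →L[ℝ] GenTangent (Tan n x)) :
    endCoord c x (Ring.inverse A) = Ring.inverse (endCoord c x A) := by
  by_cases h : IsUnit A
  · have h' : IsUnit (endCoord c x A) := h.map (endEquiv hx)
    apply h'.mul_left_cancel
    rw [Ring.mul_inverse_cancel _ h', ← endCoord_mul hx, Ring.mul_inverse_cancel _ h,
      endCoord_one hx]
  · have h' : ¬ IsUnit (endCoord c x A) := fun h' => h ((MulEquiv.isUnit_map (endEquiv hx)).1 h')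
    rw [Ring.inverse_non_unit _ h, Ring.inverse_non_unit _ h', ← endEquiv_apply hx, map_zero]

lemma isUnit_endCoord {c x : M} (hx : x ∈ (chartAt (Eu n) c).source)
    {A : GenTangent (Tan n x) →L[ℝ] GenTangent (Tan n x)} (h : IsUnit A) :
    IsUnit (endCoord c x A) := h.map (endEquiv hx)

lemma tr_endCoord {c x : M} (hx : x ∈ (chartAt (Eu n) c).source)
    (A : GenTangent (Tan n x) →L[ℝ] GenTangent (Tan n x)) : tr (endCoord c x A) = tr A :=
  LinearMap.trace_conj' (A : GenTangent (Tan n x) →ₗ[ℝ] GenTangent (Tan n x))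
    (genMap (tanEquiv hx)).symm.toLinearEquiv

lemma isGenComplex_endCoord {c x : M} (hx : x ∈ (chartAt (Eu n) c).source)
    {J : GenTangent (Tan n x) →L[ℝ] GenTangent (Tan n x)}
    (h : IsGenComplex (genPairing (Tan n x)) J) :
    IsGenComplex (genPairing (Eu n)) (endCoord c x J) := by
  refine ⟨fun e f => ?_, fun e => ?_⟩
  · rw [← genPairing_genFrame hx, ← genPairing_genFrame hx e f, endCoord_apply, endCoord_apply,
      genFrame_genCoord hx, genFrame_genCoord hx, h.1]
  · rw [endCoord_apply, endCoord_apply, genFrame_genCoord hx, h.2, map_neg, genCoord_genFrame hx]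

/-- The coordinate expression, as a function on `ℝ²ⁿ`, of a section of `End (TM ⊕ T*M)`. -/
noncomputable def coordField {n : ℕ} {M : Type*} [TopologicalSpace M] [ChartedSpace (Eu n) M]
    [IsManifold (𝓡 (2 * n)) ∞ M] (c : M) (A : EndField n M) (y : Eu n) : EuEnd n :=
  endCoord c ((chartAt (Eu n) c).symm y) (A ((chartAt (Eu n) c).symm y))

lemma isSmoothField_iff {A : EndField n M} :
    IsSmoothField A ↔ ∀ c : M, ContDiffOn ℝ ∞ (coordField c A) (chartAt (Eu n) c).target := by
  refine forall_congr' fun c => ?_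
  have := contMDiffOn_chart_iff (n := n) c (f := fun x : M => endCoord c x (A x)) (s := Set.univ)
  simpa using! this

variable {P : Type*} [NormedAddCommGroup P] [NormedSpace ℝ P]

lemma isSmoothFamily_iff {U : Set P} {A : P → EndField n M} :
    IsSmoothFamily U A ↔ ∀ c : M, ContDiffOn ℝ ∞ (fun q : P × Eu n => coordField c (A q.1) q.2)
      (U ×ˢ (chartAt (Eu n) c).target) :=
  forall_congr' fun c => contMDiffOn_family_iff c

lemma IsSmoothField.isSmoothFamily {A : EndField n M} (h : IsSmoothField A) (U : Set P) :
    IsSmoothFamily U fun _ => A := by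
  rw [isSmoothFamily_iff]
  intro c
  exact (isSmoothField_iff.1 h c).comp contDiffOn_snd fun q hq => hq.2

lemma IsSmoothFamily.isSmoothField {U : Set P} {A : P → EndField n M} (h : IsSmoothFamily U A)
    {t : P} (ht : t ∈ U) : IsSmoothField (A t) := by
  rw [isSmoothField_iff]
  intro c
  exact (isSmoothFamily_iff.1 h c).comp (f := fun y => (t, y))
    (contDiffOn_const.prodMk contDiffOn_id) fun y hy => ⟨ht, hy⟩

section Algebra

variable {U : Set P} {A B : P → EndField n M}

lemma coordField_mul {c : M} (A B : EndField n M) {y : Eu n} (hy : y ∈ (chartAt (Eu n) c).target) :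
    coordField c (fun x => A x * B x) y = coordField c A y * coordField c B y :=
  endCoord_mul ((chartAt (Eu n) c).map_target hy) _ _

lemma IsSmoothFamily.mul (hA : IsSmoothFamily U A) (hB : IsSmoothFamily U B) :
    IsSmoothFamily U fun t x => A t x * B t x := by
  rw [isSmoothFamily_iff] at *
  intro c
  have h : ContDiffOn ℝ ∞ (fun q : P × Eu n => coordField c (A q.1) q.2 * coordField c (B q.1) q.2)
      (U ×ˢ (chartAt (Eu n) c).target) :=
    contDiffOn_clm_mul (W := GenTangent (Eu n)) (hA c) (hB c)
  exact h.congr fun q hq => coordField_mul _ _ hq.2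

lemma IsSmoothFamily.add (hA : IsSmoothFamily U A) (hB : IsSmoothFamily U B) :
    IsSmoothFamily U fun t x => A t x + B t x := by
  rw [isSmoothFamily_iff] at *
  intro c
  exact ((hA c).add (hB c)).congr fun q hq => endCoord_add _ _ _ _

lemma IsSmoothFamily.sub (hA : IsSmoothFamily U A) (hB : IsSmoothFamily U B) :
    IsSmoothFamily U fun t x => A t x - B t x := by
  rw [isSmoothFamily_iff] at *
  intro c
  exact ((hA c).sub (hB c)).congr fun q hq => endCoord_sub _ _ _ _

lemma IsSmoothFamily.smul (hA : IsSmoothFamily U A) {f : P → ℝ} (hf : ContDiffOn ℝ ∞ f U) :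
    IsSmoothFamily U fun t x => f t • A t x := by
  rw [isSmoothFamily_iff] at *
  intro c
  have hf' : ContDiffOn ℝ ∞ (fun q : P × Eu n => f q.1) (U ×ˢ (chartAt (Eu n) c).target) :=
    hf.comp contDiffOn_fst fun q hq => hq.1
  have h : ContDiffOn ℝ ∞ (fun q : P × Eu n => f q.1 • coordField c (A q.1) q.2)
      (U ×ˢ (chartAt (Eu n) c).target) :=
    contDiffOn_clm_smul (W := GenTangent (Eu n)) hf' (hA c)
  exact h.congr fun q hq => endCoord_smul _ _ _ _

lemma isSmoothFamily_one (U : Set P) :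
    IsSmoothFamily U fun (_ : P) (_ : M) => (1 : GenTangent (Tan n _) →L[ℝ] _) := by
  rw [isSmoothFamily_iff]
  intro c
  exact contDiffOn_const.congr
    fun q hq => endCoord_one ((chartAt (Eu n) c).map_target hq.2)

lemma IsSmoothFamily.inverse (hA : IsSmoothFamily U A) (hu : ∀ t ∈ U, ∀ x, IsUnit (A t x)) :
    IsSmoothFamily U fun t x => Ring.inverse (A t x) := by
  rw [isSmoothFamily_iff] at *
  intro c
  have h : ContDiffOn ℝ ∞ (fun q : P × Eu n => Ring.inverse (coordField c (A q.1) q.2))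
      (U ×ˢ (chartAt (Eu n) c).target) := by
    exact contDiffOn_clm_inverse (W := GenTangent (Eu n)) (hA c) fun q hq =>
      isUnit_endCoord ((chartAt (Eu n) c).map_target hq.2) (hu q.1 hq.1 _)
  exact h.congr fun q hq => endCoord_inverse ((chartAt (Eu n) c).map_target hq.2) _

lemma IsSmoothFamily.congr (hA : IsSmoothFamily U A) (h : ∀ t ∈ U, ∀ x, B t x = A t x) :
    IsSmoothFamily U B := by
  rw [isSmoothFamily_iff] at *
  intro c
  refine (hA c).congr fun q hq => ?_
  simp only [coordField]
  rw [h q.1 hq.1]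

end Algebra

end Coordinates

/-! ### Smoothness of the structure induced by a spinor -/

section SpinorSmooth

variable {n : ℕ} {M : Type*} [TopologicalSpace M] [ChartedSpace (Eu n) M]
  [IsManifold (𝓡 (2 * n)) ∞ M] {ψ : FormField n M}

open Classical in
/-- The coordinate expression of a differential form in the chart at `c` (zero outside the target
of the chart). -/
noncomputable def coordForm (c : M) (ψ : FormField n M) (y : Eu n) : Forms (Eu n) :=
  if hy : y ∈ (chartAt (Eu n) c).target then
    pullForm (tanEquiv ((chartAt (Eu n) c).map_target hy)) (ψ ((chartAt (Eu n) c).symm y))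
  else 0

lemma coordForm_of_mem {c : M} {y : Eu n} (hy : y ∈ (chartAt (Eu n) c).target) :
    coordForm c ψ y =
      pullForm (tanEquiv ((chartAt (Eu n) c).map_target hy)) (ψ ((chartAt (Eu n) c).symm y)) :=
  dif_pos hy

lemma contDiffOn_evalForm_coordForm (hψ : IsSmoothForm ψ) (c : M) {k : ℕ} (w : Fin k → Eu n) :
    ContDiffOn ℝ ∞ (fun y => evalForm w (coordForm c ψ y)) (chartAt (Eu n) c).target := by
  have h := hψ c k w
  have h1 := (contMDiffOn_chart_iff (n := n) c (s := Set.univ)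
    (f := fun x : M => evalForm (fun j => tanFrame c x (w j)) (ψ x))).1 (by simpa using h)
  simp only [Set.preimage_univ, Set.inter_univ] at h1
  refine h1.congr fun y hy => ?_
  rw [coordForm_of_mem hy, evalForm_pullForm]
  rfl

lemma intertwines_coordForm (hpure : ∀ x, IsPure (ψ x)) (hnondeg : ∀ x, IsNondegenerate (ψ x))
    {c : M} {y : Eu n} (hy : y ∈ (chartAt (Eu n) c).target) :
    Intertwines (coordForm c ψ y) (coordField c (spinorStructure ψ) y) := by
  rw [coordForm_of_mem hy]
  exact (inducedStructure_intertwines (hpure _) (hnondeg _)).pullForm _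

/-- The coefficient of `⟨ψ, ψ̄⟩` in the chart at `c`. -/
lemma topCoeff_spinNorm {c : M} {y : Eu n} (hy : y ∈ (chartAt (Eu n) c).target) :
    topCoeff (spinNorm ψ) c ((chartAt (Eu n) c).symm y) =
      spinPairing (coordForm c ψ y) (conjC _ (coordForm c ψ y))
        (EuclideanSpace.basisFun (Fin (2 * n)) ℝ).toBasis := by
  rw [coordForm_of_mem hy, conjC_pullForm, spinPairing_pullForm]
  simp only [topCoeff, spinNorm, OrthonormalBasis.coe_toBasis]
  rfl

lemma spinPairing_coordForm_ne_zero (hpure : ∀ x, IsPure (ψ x))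
    (hnondeg : ∀ x, IsNondegenerate (ψ x)) {c : M} {y : Eu n}
    (hy : y ∈ (chartAt (Eu n) c).target) :
    spinPairing (coordForm c ψ y) (conjC _ (coordForm c ψ y))
        (EuclideanSpace.basisFun (Fin (2 * n)) ℝ).toBasis ≠ 0 := by
  rw [coordForm_of_mem hy, conjC_pullForm, spinPairing_pullForm]
  have hx := (chartAt (Eu n) c).map_target hy
  have := spinPairing_conj_ne_zero
    ((EuclideanSpace.basisFun (Fin (2 * n)) ℝ).toBasis.map (tanEquiv hx).toLinearEquiv)
    (hpure _).1 (inducedStructure_intertwines (hpure _) (hnondeg _))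
  convert! this using 1

/-- In a chart, the matrix coefficients of the structure are quotients of spin pairings, whose
denominator does not vanish. -/
theorem isSmoothField_spinorStructure (hψ : IsSmoothForm ψ) (hpure : ∀ x, IsPure (ψ x))
    (hnondeg : ∀ x, IsNondegenerate (ψ x)) : IsSmoothField (spinorStructure ψ) := by
  rw [isSmoothField_iff]
  intro c
  exact contDiffOn_of_intertwines (EuclideanSpace.basisFun (Fin (2 * n)) ℝ).toBasis
    (fun k w => contDiffOn_evalForm_coordForm hψ c w)
    (fun y hy => intertwines_coordForm hpure hnondeg hy)
    (fun y hy => spinPairing_coordForm_ne_zero hpure hnondeg hy)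

theorem isGenComplex_spinorStructure (hpure : ∀ x, IsPure (ψ x))
    (hnondeg : ∀ x, IsNondegenerate (ψ x)) (x : M) :
    IsGenComplex (genPairing (Tan n x)) (spinorStructure ψ x) :=
  (inducedStructure_intertwines (hpure x) (hnondeg x)).isGenComplex (hpure x).1 (hnondeg x)

theorem mem_compatible_iff (hψ : IsSmoothForm ψ) (hpure : ∀ x, IsPure (ψ x))
    (hnondeg : ∀ x, IsNondegenerate (ψ x)) {J : EndField n M} :
    J ∈ Compatible ψ ↔ IsSmoothField J ∧ ∀ x, J x ∈ fibre ψ x :=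
  ⟨fun h => ⟨h.1.1, h.2.2⟩, fun h => ⟨⟨h.1, fun x => (h.2 x).1⟩,
    ⟨isSmoothField_spinorStructure hψ hpure hnondeg,
      isGenComplex_spinorStructure hpure hnondeg⟩, h.2⟩⟩

end SpinorSmooth

/-! ### Local frames of the bundle of fibres -/

section LocalFrames

/-- Generalized Kähler pairs are invariant under isometries. -/
lemma isGenKahlerPair_conj_iff {W W' : Type*} [AddCommGroup W] [Module ℝ W] [TopologicalSpace W]
    [AddCommGroup W'] [Module ℝ W'] [TopologicalSpace W'] {β : LinearMap.BilinForm ℝ W}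
    {β' : LinearMap.BilinForm ℝ W'} {I : W →L[ℝ] W} {I' : W' →L[ℝ] W'} (L : W' ≃L[ℝ] W)
    (hL : ∀ v w, β (L v) (L w) = β' v w) (hI : ∀ v, L (I' v) = I (L v)) (J : W →L[ℝ] W) :
    IsGenKahlerPair β J I ↔ IsGenKahlerPair β' ((L.symm : W →L[ℝ] W').comp
      (J.comp (L : W' →L[ℝ] W))) I' := by
  have hL' : ∀ v w, β' (L.symm v) (L.symm w) = β v w := fun v w => by rw [← hL]; simp
  have hI' : ∀ v, I' v = L.symm (I (L v)) := fun v => by rw [← hI]; simp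
  simp only [IsGenKahlerPair, IsGenComplex, ContinuousLinearMap.comp_apply,
    ContinuousLinearEquiv.coe_coe, hI', L.apply_symm_apply, hL']
  have hb : ∀ v w, β' (L.symm v) w = β v (L w) := fun v w => by rw [← hL]; simp
  simp only [← map_neg, hb]
  constructor
  · rintro ⟨⟨h1, h2⟩, ⟨h3, h4⟩, h5, h6⟩
    exact ⟨⟨fun e f => by rw [h1, hL], fun e => by rw [h2, map_neg, L.symm_apply_apply]⟩,
      ⟨fun e f => by rw [h3, hL], fun e => by rw [h4, map_neg, L.symm_apply_apply]⟩,
      fun e => by rw [h5], fun e he => by simpa using h6 (L e) (by simpa using he)⟩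
  · rintro ⟨⟨h1, h2⟩, ⟨h3, h4⟩, h5, h6⟩
    refine ⟨⟨fun e f => ?_, fun e => ?_⟩, ⟨fun e f => ?_, fun e => ?_⟩, fun e => ?_,
      fun e he => ?_⟩
    · simpa [← hL] using h1 (L.symm e) (L.symm f)
    · simpa using congrArg L (h2 (L.symm e))
    · simpa [← hL] using h3 (L.symm e) (L.symm f)
    · simpa using congrArg L (h4 (L.symm e))
    · simpa using congrArg L (h5 (L.symm e))
    · simpa using h6 (L.symm e) (by simpa using he)

/-- The endomorphism `(v, ξ) ↦ (T v, ξ ∘ T')` of `V ⊕ V*` depends smoothly on `T` and `T'`. -/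
lemma contDiff_transition (V : Type*) [NormedAddCommGroup V] [NormedSpace ℝ V]
    [FiniteDimensional ℝ V] :
    ContDiff ℝ ∞ fun p : (V →L[ℝ] V) × (V →L[ℝ] V) =>
      ((p.1.comp (ContinuousLinearMap.fst ℝ V (V →L[ℝ] ℝ))).prod
        ((ContinuousLinearMap.precomp ℝ p.2).comp (ContinuousLinearMap.snd ℝ V (V →L[ℝ] ℝ))) :
        GenTangent V →L[ℝ] GenTangent V) := by
  haveI : FiniteDimensional ℝ (V →L[ℝ] ℝ) := inferInstance
  rw [contDiff_clm_apply_iff]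
  rintro ⟨v, ξ⟩
  have h1 : ContDiff ℝ ∞ fun p : (V →L[ℝ] V) × (V →L[ℝ] V) => p.1 v :=
    contDiff_fst.clm_apply contDiff_const
  have h2 : ContDiff ℝ ∞ fun p : (V →L[ℝ] V) × (V →L[ℝ] V) => ξ.comp p.2 :=
    contDiff_const.clm_comp contDiff_snd
  exact h1.prodMk h2

lemma contDiffOn_clm_comp_comp {E W X : Type*} [NormedAddCommGroup E] [NormedSpace ℝ E]
    [NormedAddCommGroup W] [NormedSpace ℝ W] [NormedAddCommGroup X] [NormedSpace ℝ X] {s : Set E}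
    {f g : E → W →L[ℝ] W} (hf : ContDiffOn ℝ ∞ f s) (hg : ContDiffOn ℝ ∞ g s) (L : X →L[ℝ] W) :
    ContDiffOn ℝ ∞ (fun x => (f x).comp ((g x).comp L)) s :=
  hf.clm_comp (hg.clm_comp contDiffOn_const)

variable {n : ℕ} {M : Type*} [TopologicalSpace M] [ChartedSpace (Eu n) M]
  [IsManifold (𝓡 (2 * n)) ∞ M] {ψ : FormField n M}

lemma contMDiffOn_tanCoord_tanFrame (c c' : M) :
    ContMDiffOn (𝓡 (2 * n)) 𝓘(ℝ, Eu n →L[ℝ] Eu n) ∞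
      (fun x : M => (tanCoord (n := n) c' x).comp (tanFrame c x))
      ((chartAt (Eu n) c).source ∩ (chartAt (Eu n) c').source) := by
  have h := contMDiffOn_coordChangeL (n := ∞) (IB := 𝓡 (2 * n)) (𝕜 := ℝ)
    (trivializationAt (Eu n) (TangentSpace (𝓡 (2 * n)) : M → Type _) c)
    (trivializationAt (Eu n) (TangentSpace (𝓡 (2 * n)) : M → Type _) c')
  simp only [TangentBundle.trivializationAt_baseSet] at h
  refine h.congr fun x hx => ?_
  ext1 v
  rw [ContinuousLinearEquiv.coe_coe, Bundle.Trivialization.coordChangeL_apply _ _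
    (by simpa only [TangentBundle.trivializationAt_baseSet] using hx)]
  have hx' : x ∈ (trivializationAt (Eu n) (TangentSpace (𝓡 (2 * n)) : M → Type _) c').baseSet := by
    rw [TangentBundle.trivializationAt_baseSet]; exact hx.2
  rw [ContinuousLinearMap.comp_apply, tanCoord, Bundle.Trivialization.continuousLinearMapAt_apply,
    Bundle.Trivialization.linearMapAt_apply, if_pos hx', tanFrame,
    Bundle.Trivialization.symmL_apply _ (by
      rw [TangentBundle.trivializationAt_baseSet]; exact hx.1)]

lemma genPairing_nondegenerate {V : Type*} [NormedAddCommGroup V] [NormedSpace ℝ V]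
    (e : GenTangent V) (h : ∀ f, genPairing V e f = 0) : e = 0 := by
  have h1 : e.2 = 0 := by
    ext v
    simpa [genPairing_apply] using h (v, 0)
  have h2 : e.1 = 0 := by
    by_contra h0
    obtain ⟨ξ, -, hξ⟩ := exists_dual_vector ℝ e.1 (norm_ne_zero_iff.2 h0)
    have := h (0, ξ)
    rw [genPairing_apply] at this
    simp at this
    rw [this] at hξ
    simp at hξ
    exact h0 (norm_eq_zero.1 hξ.symm)
  exact Prod.ext h2 h1

lemma finrank_genTangent (V : Type*) [NormedAddCommGroup V] [NormedSpace ℝ V]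
    [FiniteDimensional ℝ V] : Module.finrank ℝ (GenTangent V) = 2 * Module.finrank ℝ V := by
  have : Module.finrank ℝ (V →L[ℝ] ℝ) = Module.finrank ℝ V := by
    rw [← LinearEquiv.finrank_eq
      (LinearMap.toContinuousLinearMap (𝕜 := ℝ) (E := V) (F' := ℝ))]
    exact Subspace.dual_finrank_eq
  rw [Module.finrank_prod, this, two_mul]

/-- At a point, the isotropic subspace `T M` determines the signature, so that `exists_frame`
applies. -/
lemma exists_frame_genTangent {V : Type*} [NormedAddCommGroup V] [NormedSpace ℝ V]
    [FiniteDimensional ℝ V] {n : ℕ} (hd : Module.finrank ℝ V = 2 * n)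
    {J : GenTangent V →L[ℝ] GenTangent V} (hJ : IsGenComplex (genPairing V) J) :
    ∃ L : ModelSpace n ≃L[ℝ] GenTangent V, (∀ v, L (modelI n v) = J (L v)) ∧
      ∀ v w, genPairing V (L v) (L w) = modelForm n v w := by
  refine exists_frame (by rw [finrank_genTangent, hd]; ring) genPairing_comm
    genPairing_nondegenerate (LinearMap.range (LinearMap.inl ℝ V (V →L[ℝ] ℝ))) ?_ ?_ hJ
  · rw [LinearMap.finrank_range_of_inj LinearMap.inl_injective, hd]
  · rintro _ ⟨v, rfl⟩
    simp [genPairing_apply]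

open Classical in
/-- The bundle of fibres is locally trivial: an isometric complex linear frame at `x₀` is carried to
the points near `x₀` by the isometries of `exists_local_isometry`. -/
theorem exists_localFrame (hψ : IsSmoothForm ψ) (hpure : ∀ x, IsPure (ψ x))
    (hnondeg : ∀ x, IsNondegenerate (ψ x)) (x₀ : M) :
    ∃ U : Set M, IsOpen U ∧ x₀ ∈ U ∧ ∃ L : ∀ x : M, ModelSpace n ≃L[ℝ] GenTangent (Tan n x),
      (∀ c : M, ContMDiffOn (𝓡 (2 * n)) 𝓘(ℝ, ModelSpace n →L[ℝ] GenTangent (Eu n)) ∞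
        (fun x => (genCoord c x).comp (L x : ModelSpace n →L[ℝ] GenTangent (Tan n x)))
        (U ∩ (chartAt (Eu n) c).source)) ∧
      ∀ x ∈ U, (∀ v, L x (modelI n v) = spinorStructure ψ x (L x v)) ∧
        ∀ v w, genPairing (Tan n x) (L x v) (L x w) = modelForm n v w := by
  let e := chartAt (Eu n) x₀
  let Jc := coordField x₀ (spinorStructure ψ)
  have hJs : ContDiffOn ℝ ∞ Jc e.target :=
    isSmoothField_iff.1 (isSmoothField_spinorStructure hψ hpure hnondeg) x₀
  have hJc : ∀ y ∈ e.target, IsGenComplex (genPairing (Eu n)) (Jc y) := fun y hy =>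
    isGenComplex_endCoord (e.map_target hy) (isGenComplex_spinorStructure hpure hnondeg _)
  have hy₀ : e x₀ ∈ e.target := e.map_source (mem_chart_source _ x₀)
  obtain ⟨L₀, hL₀I, hL₀⟩ := exists_frame_genTangent (n := n) (by simp) (hJc _ hy₀)
  obtain ⟨G, hG1, hG2⟩ := exists_local_isometry (W := GenTangent (Eu n))
    genPairing_nondegenerate (hJc _ hy₀)
  obtain ⟨N, hN, hNo, hN₀⟩ := eventually_nhds_iff.1 (hG1.and hG2)
  have hGJ : ∀ y ∈ e.target, Jc y ∈ N → G (Jc y) * Jc (e x₀) = Jc y * G (Jc y) ∧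
      (∀ a b, genPairing (Eu n) (G (Jc y) a) (G (Jc y) b) = genPairing (Eu n) a b) ∧
      IsUnit (G (Jc y)) := fun y hy hyN => (hN _ hyN).2 (hJc y hy)
  -- On `V` the coordinate expression of the structure is close to its value at `x₀`.
  let V : Set (Eu n) := e.target ∩ Jc ⁻¹' N
  have hV : IsOpen V := hJs.continuousOn.isOpen_inter_preimage e.open_target hNo
  let U : Set M := e.source ∩ e ⁻¹' V
  have hU : IsOpen U := e.isOpen_inter_preimage hV
  have hunit : ∀ x ∈ U, IsUnit (G (Jc (e x))) := fun x hx => (hGJ _ hx.2.1 hx.2.2).2.2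
  let Q : ∀ x, x ∈ U → GenTangent (Eu n) ≃L[ℝ] GenTangent (Eu n) := fun x hx =>
    ContinuousLinearEquiv.unitsEquiv ℝ _ (hunit x hx).unit
  have hQ : ∀ x (hx : x ∈ U) a, Q x hx a = G (Jc (e x)) a := fun x hx a => rfl
  -- `L₀` off `U` is an arbitrary value.
  let L : ∀ x : M, ModelSpace n ≃L[ℝ] GenTangent (Tan n x) := fun x =>
    if hx : x ∈ U then (L₀.trans (Q x hx)).trans (genMap (tanEquiv (c := x₀) hx.1)) else L₀
  have hL : ∀ x (hx : x ∈ U) v, L x v = genFrame x₀ x (G (Jc (e x)) (L₀ v)) := by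
    intro x hx v
    have : L x = (L₀.trans (Q x hx)).trans (genMap (tanEquiv (c := x₀) hx.1)) := dif_pos hx
    rw [this]
    rfl
  refine ⟨U, hU, ⟨mem_chart_source _ x₀, hy₀, hN₀⟩, L, fun c => ?_, fun x hx => ⟨fun v => ?_,
    fun v w => ?_⟩⟩
  · have hsub : U ∩ (chartAt (Eu n) c).source =
        (U ∩ (chartAt (Eu n) c).source) ∩ e.source := by
      ext x; simp only [Set.mem_inter_iff, U]; tauto
    rw [hsub, contMDiffOn_chart_iff (n := n) x₀]
    set s : Set (Eu n) := e.target ∩ e.symm ⁻¹' (U ∩ (chartAt (Eu n) c).source) with hs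
    have hT : ∀ a b : M, s ⊆ e.target ∩ e.symm ⁻¹' ((chartAt (Eu n) a).source ∩
          (chartAt (Eu n) b).source) →
        ContDiffOn ℝ ∞ (fun y => (tanCoord (n := n) b (e.symm y)).comp
          (tanFrame a (e.symm y))) s := by
      intro a b hab
      have hsub' : (chartAt (Eu n) a).source ∩ (chartAt (Eu n) b).source ∩ e.source ⊆
        (chartAt (Eu n) a).source ∩ (chartAt (Eu n) b).source := Set.inter_subset_left
      exact ((contMDiffOn_chart_iff (n := n) x₀).1
        ((contMDiffOn_tanCoord_tanFrame a b).mono hsub')).mono hab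
    have h1 := hT x₀ c fun y hy => ⟨hy.1, e.map_target hy.1, hy.2.2⟩
    have h2 := hT c x₀ fun y hy => ⟨hy.1, hy.2.2, e.map_target hy.1⟩
    have h3 := (contDiff_transition (Eu n)).comp_contDiffOn (h1.prodMk h2)
    have h4 : ContDiffOn ℝ ∞ (fun y => G (Jc y)) s := by
      intro y hy
      have hyN : Jc y ∈ N := by
        have := hy.2.1.2.2
        rwa [Set.mem_preimage, e.right_inv hy.1] at this
      exact ContDiffAt.comp_contDiffWithinAt y (hN _ hyN).1 ((hJs y hy.1).mono fun z hz => hz.1)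
    refine (contDiffOn_clm_comp_comp (W := GenTangent (Eu n)) h3 h4
      (L₀ : ModelSpace n →L[ℝ] GenTangent (Eu n))).congr fun y hy => ?_
    refine ContinuousLinearMap.ext fun v => ?_
    change genCoord c (e.symm y) (L (e.symm y) v) = _
    rw [hL _ hy.2.1, e.right_inv hy.1]
    rfl
  · have h1 := (hGJ _ hx.2.1 hx.2.2).1
    have h2 : ∀ a, genFrame x₀ x (Jc (e x) a) = spinorStructure ψ x (genFrame x₀ x a) := by
      intro a
      have : Jc (e x) = endCoord x₀ x (spinorStructure ψ x) := by
        simp only [Jc, coordField]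
        rw [e.left_inv hx.1]
      rw [this, endCoord_apply, genFrame_genCoord hx.1]
    rw [hL x hx, hL x hx, ← h2, hL₀I]
    exact congrArg _ (DFunLike.congr_fun h1 (L₀ v))
  · rw [hL x hx, hL x hx, genPairing_genFrame hx.1, (hGJ _ hx.2.1 hx.2.2).2.1, hL₀]

end LocalFrames

/-! ### Velocities of families of sections -/

section ClmCalculus

variable {W : Type*} [NormedAddCommGroup W] [NormedSpace ℝ W]
  {P : Type*} [NormedAddCommGroup P] [NormedSpace ℝ P]

lemma fderiv_clm_mul {f g : P → W →L[ℝ] W} {t : P} (hf : DifferentiableAt ℝ f t)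
    (hg : DifferentiableAt ℝ g t) (v : P) :
    fderiv ℝ (fun s => f s * g s) t v = fderiv ℝ f t v * g t + f t * fderiv ℝ g t v := by
  rw [fderiv_fun_mul' hf hg]
  simp [add_comm]

lemma fderiv_clm_add {f g : P → W →L[ℝ] W} {t : P} (hf : DifferentiableAt ℝ f t)
    (hg : DifferentiableAt ℝ g t) (v : P) :
    fderiv ℝ (fun s => f s + g s) t v = fderiv ℝ f t v + fderiv ℝ g t v := by
  rw [fderiv_fun_add hf hg]
  rfl

lemma fderiv_clm_sub {f g : P → W →L[ℝ] W} {t : P} (hf : DifferentiableAt ℝ f t)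
    (hg : DifferentiableAt ℝ g t) (v : P) :
    fderiv ℝ (fun s => f s - g s) t v = fderiv ℝ f t v - fderiv ℝ g t v := by
  rw [fderiv_fun_sub hf hg]
  rfl

lemma fderiv_linear_comp [FiniteDimensional ℝ W] {F : Type*} [NormedAddCommGroup F]
    [NormedSpace ℝ F] (ℓ : (W →L[ℝ] W) →ₗ[ℝ] F) {f : P → W →L[ℝ] W} {t : P}
    (hf : DifferentiableAt ℝ f t) (v : P) :
    fderiv ℝ (fun s => ℓ (f s)) t v = ℓ (fderiv ℝ f t v) := by
  have h := (LinearMap.toContinuousLinearMap ℓ).hasFDerivAt.comp t hf.hasFDerivAt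
  exact congrArg (fun B => B v) h.fderiv

lemma contDiffOn_linear_comp [FiniteDimensional ℝ W] {F : Type*} [NormedAddCommGroup F]
    [NormedSpace ℝ F] (ℓ : (W →L[ℝ] W) →ₗ[ℝ] F) {f : P → W →L[ℝ] W} {U : Set P}
    (hf : ContDiffOn ℝ ∞ f U) : ContDiffOn ℝ ∞ (fun s => ℓ (f s)) U :=
  (LinearMap.toContinuousLinearMap ℓ).contDiff.comp_contDiffOn hf

lemma fderiv_linear_comp_end [FiniteDimensional ℝ W] (ℓ : (W →L[ℝ] W) →ₗ[ℝ] (W →L[ℝ] W))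
    {f : P → W →L[ℝ] W} {t : P} (hf : DifferentiableAt ℝ f t) (v : P) :
    fderiv ℝ (fun s => ℓ (f s)) t v = ℓ (fderiv ℝ f t v) := fderiv_linear_comp ℓ hf v

lemma contDiffOn_linear_comp_end [FiniteDimensional ℝ W] (ℓ : (W →L[ℝ] W) →ₗ[ℝ] (W →L[ℝ] W))
    {f : P → W →L[ℝ] W} {U : Set P} (hf : ContDiffOn ℝ ∞ f U) :
    ContDiffOn ℝ ∞ (fun s => ℓ (f s)) U := contDiffOn_linear_comp ℓ hf

lemma contDiffOn_fderiv_fst {E F : Type*} [NormedAddCommGroup E] [NormedSpace ℝ E]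
    [NormedAddCommGroup F] [NormedSpace ℝ F] {f : P × E → F} {U : Set P} {T : Set E}
    (hU : IsOpen U) (hT : IsOpen T) (hf : ContDiffOn ℝ ∞ f (U ×ˢ T)) (v : P) :
    ContDiffOn ℝ ∞ (fun q : P × E => fderiv ℝ (fun s => f (s, q.2)) q.1 v) (U ×ˢ T) := by
  have hO : IsOpen (U ×ˢ T) := hU.prod hT
  have h1 : ContDiffOn ℝ ∞ (fun q => fderiv ℝ f q (v, 0)) (U ×ˢ T) :=
    (hf.fderiv_of_isOpen hO (by simp)).clm_apply contDiffOn_const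
  refine h1.congr fun q hq => ?_
  have hd : DifferentiableAt ℝ f q :=
    (hf.contDiffAt (hO.mem_nhds hq)).differentiableAt (by simp)
  have h2 : HasFDerivAt (fun s : P => (s, q.2)) (ContinuousLinearMap.inl ℝ P E) q.1 :=
    (hasFDerivAt_id q.1).prodMk (hasFDerivAt_const q.2 q.1)
  have h3 := HasFDerivAt.comp (g := f) (f := fun s : P => (s, q.2)) q.1 hd.hasFDerivAt h2
  exact congrArg (fun B => B v) h3.fderiv

end ClmCalculus

section Velocity

variable {n : ℕ} {M : Type*} [TopologicalSpace M] [ChartedSpace (Eu n) M]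
  [IsManifold (𝓡 (2 * n)) ∞ M] {P : Type*} [NormedAddCommGroup P] [NormedSpace ℝ P]
  {U : Set P} {A B : P → EndField n M} {t : P}

/-- The values of a family at a point of `M`. The tangent space at the point is identified with
`ℝ²ⁿ`, to which it is definitionally equal. -/
def valueAt (A : P → EndField n M) (x : M) (s : P) : EuEnd n := A s x

lemma IsSmoothFamily.contDiffOn_apply (hA : IsSmoothFamily U A) (x : M) :
    ContDiffOn ℝ ∞ (valueAt A x) U := by
  have hx : x ∈ (chartAt (Eu n) x).source := mem_chart_source _ x
  have h1 : ContDiffOn ℝ ∞ (fun s => coordField x (A s) (chartAt (Eu n) x x)) U :=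
    (isSmoothFamily_iff.1 hA x).comp (f := fun s => (s, chartAt (Eu n) x x))
      (contDiffOn_id.prodMk contDiffOn_const) fun s hs => ⟨hs, (chartAt (Eu n) x).map_source hx⟩
  have h2 : ContDiffOn ℝ ∞ (fun s => endCoord x x (A s x)) U := by
    refine h1.congr fun s _ => ?_
    simp only [coordField]
    rw [(chartAt (Eu n) x).left_inv hx]
  have hK : ∀ (B : GenTangent (Tan n x) →L[ℝ] GenTangent (Tan n x)) e,
      genFrame x x (endCoord x x B (genCoord x x e)) = B e := fun B e => by
    rw [endCoord_apply, genFrame_genCoord hx, genFrame_genCoord hx]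
  let K : EuEnd n →ₗ[ℝ] EuEnd n :=
    { toFun := fun B => (genFrame x x).comp (B.comp (genCoord x x))
      map_add' := fun B C => ContinuousLinearMap.ext fun e => map_add (genFrame x x) _ _
      map_smul' := fun r B => ContinuousLinearMap.ext fun e => map_smul (genFrame x x) r _ }
  exact (contDiffOn_linear_comp_end (W := GenTangent (Eu n)) K h2).congr fun s _ =>
    ContinuousLinearMap.ext fun e => (hK (A s x) e).symm

lemma IsSmoothFamily.differentiableAt (hA : IsSmoothFamily U A) (hU : IsOpen U) (ht : t ∈ U)
    (x : M) : DifferentiableAt ℝ (valueAt A x) t :=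
  ((hA.contDiffOn_apply x).contDiffAt (hU.mem_nhds ht)).differentiableAt (by simp)

lemma velocity_mul (hA : IsSmoothFamily U A) (hB : IsSmoothFamily U B) (hU : IsOpen U)
    (ht : t ∈ U) (v : P) (x : M) : velocity (fun s x => A s x * B s x) t v x =
      velocity A t v x * B t x + A t x * velocity B t v x :=
  fderiv_clm_mul (W := GenTangent (Eu n)) (hA.differentiableAt hU ht x)
    (hB.differentiableAt hU ht x) v

lemma velocity_add (hA : IsSmoothFamily U A) (hB : IsSmoothFamily U B) (hU : IsOpen U)
    (ht : t ∈ U) (v : P) (x : M) : velocity (fun s x => A s x + B s x) t v x =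
      velocity A t v x + velocity B t v x :=
  fderiv_clm_add (W := GenTangent (Eu n)) (hA.differentiableAt hU ht x)
    (hB.differentiableAt hU ht x) v

lemma velocity_sub (hA : IsSmoothFamily U A) (hB : IsSmoothFamily U B) (hU : IsOpen U)
    (ht : t ∈ U) (v : P) (x : M) : velocity (fun s x => A s x - B s x) t v x =
      velocity A t v x - velocity B t v x :=
  fderiv_clm_sub (W := GenTangent (Eu n)) (hA.differentiableAt hU ht x)
    (hB.differentiableAt hU ht x) v

lemma velocity_const (a : EndField n M) (t v : P) (x : M) : velocity (fun _ => a) t v x = 0 := by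
  have h : fderiv ℝ (valueAt (fun _ : P => a) x) t = 0 :=
    fderiv_const_apply (E := P) (F := EuEnd n) (a x)
  exact DFunLike.congr_fun h v

lemma velocity_congr (hU : IsOpen U) (ht : t ∈ U) {x : M} (h : ∀ s ∈ U, A s x = B s x) (v : P) :
    velocity A t v x = velocity B t v x := by
  have h1 : valueAt A x =ᶠ[𝓝 t] valueAt B x :=
    Filter.eventuallyEq_of_mem (hU.mem_nhds ht) h
  have h2 := h1.fderiv_eq (𝕜 := ℝ)
  exact DFunLike.congr_fun h2 v

/-- A linear equation satisfied by the values of a family is satisfied by its velocities. -/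
lemma linear_velocity_eq_zero (hA : IsSmoothFamily U A) (hU : IsOpen U) (ht : t ∈ U) (v : P)
    {x : M} {F : Type*} [NormedAddCommGroup F] [NormedSpace ℝ F]
    (ℓ : (GenTangent (Tan n x) →L[ℝ] GenTangent (Tan n x)) →ₗ[ℝ] F)
    (h : ∀ s ∈ U, ℓ (A s x) = 0) : ℓ (velocity A t v x) = 0 := by
  let ℓ' : EuEnd n →ₗ[ℝ] F := ℓ
  have h1 : (fun s => ℓ' (valueAt A x s)) =ᶠ[𝓝 t] fun _ => (0 : F) :=
    Filter.eventuallyEq_of_mem (hU.mem_nhds ht) h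
  have h2 := fderiv_linear_comp (W := GenTangent (Eu n)) ℓ' (hA.differentiableAt hU ht x) v
  rw [h1.fderiv_eq (𝕜 := ℝ), fderiv_const_apply] at h2
  exact h2.symm

lemma endCoord_velocity (hA : IsSmoothFamily U A) (hU : IsOpen U) (ht : t ∈ U) (v : P) (c x : M) :
    endCoord c x (velocity A t v x) = fderiv ℝ (fun s => endCoord c x (A s x)) t v := by
  let ℓ : EuEnd n →ₗ[ℝ] EuEnd n :=
    { toFun := fun B => endCoord c x B
      map_add' := endCoord_add c x
      map_smul' := endCoord_smul c x }
  exact (fderiv_linear_comp_end (W := GenTangent (Eu n)) ℓ (hA.differentiableAt hU ht x) v).symm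

lemma IsSmoothFamily.velocity (hA : IsSmoothFamily U A) (hU : IsOpen U) (v : P) :
    IsSmoothFamily U fun t => velocity A t v := by
  rw [isSmoothFamily_iff]
  intro c
  exact (contDiffOn_fderiv_fst hU (chartAt (Eu n) c).open_target (isSmoothFamily_iff.1 hA c) v).congr
    fun q hq => endCoord_velocity hA hU hq.1 v c _

end Velocity

/-! ### Pointwise identities for the Cayley chart -/

section PointwiseIdentities

variable {W : Type*} [AddCommGroup W] [Module ℝ W] [TopologicalSpace W]
  [IsTopologicalAddGroup W] [ContinuousSMul ℝ W] {β : LinearMap.BilinForm ℝ W}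
  {I J J₀ a : W →L[ℝ] W}

lemma IsTangent.acs (hp : IsGenKahlerPair β J I) (ht : IsTangent β I J a) :
    IsTangent β I J (J.comp a) := by
  have hm := ht.mul_J
  refine ⟨fun e f => ?_, ?_, ?_⟩
  · have h1 : a (J f) = -(J (a f)) := DFunLike.congr_fun hm f
    have h2 := ht.1 e (J f)
    change β (J (a e)) f + β e (J (a f)) = 0
    rw [hp.1.skew, ← neg_eq_iff_eq_neg.2 h1, map_neg]
    linarith
  · change (J * a) * J + J * (J * a) = 0
    rw [mul_assoc, hm, mul_neg, neg_add_cancel]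
  · change (J * a) * I = I * (J * a)
    rw [mul_assoc, ht.comm, ← mul_assoc, hp.comm, mul_assoc]

lemma IsTangent.smul (ht : IsTangent β I J a) (r : ℝ) : IsTangent β I J (r • a) := by
  refine ⟨fun e f => ?_, ?_, ?_⟩
  · have := ht.1 e f
    simp only [smul_apply, map_smul, LinearMap.smul_apply, ← smul_add, this, smul_zero]
  · change (r • a) * J + J * (r • a) = 0
    rw [smul_mul_assoc, mul_smul_comm, ← smul_add]
    exact (congrArg _ ht.2.1).trans (smul_zero _)
  · change (r • a) * I = I * (r • a)
    rw [smul_mul_assoc, mul_smul_comm, ht.comm]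

lemma cayleyInv_zero (J₀ : W →L[ℝ] W) : cayleyInv J₀ 0 = J₀ := by
  rw [cayleyInv, sub_zero, one_mul, Ring.inverse_one, mul_one]

lemma comp_comp_self (hJ : IsGenComplex β J) (a : W →L[ℝ] W) : J.comp (J.comp a) = -a := by
  change J * (J * a) = -a
  rw [← mul_assoc, hJ.mul_self, neg_one_mul]

/-- The derivative `N` of the Cayley transform `μ` of `A`, from the differentiated equation
`A - J₀ = (A + J₀) μ`; the zeros are the derivative of the constant `J₀`. -/
lemma derivative_cayley {A V μ N : W →L[ℝ] W} (h : V - 0 = (V + 0) * μ + (A + J₀) * N) :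
    (A + J₀) * N = V * (1 - μ) := by
  rw [sub_zero, add_zero] at h
  rw [mul_sub, mul_one, eq_sub_iff_add_eq, add_comm]
  exact h.symm

/-- Multiplication by `J` on velocities corresponds to multiplication by `J₀` in the Cayley
chart. -/
lemma derivative_cayley_acs [FiniteDimensional ℝ W] [T2Space W] (hp : IsGenKahlerPair β J I)
    (hp₀ : IsGenKahlerPair β J₀ I) {V μ N N' : W →L[ℝ] W} (h1 : (J + J₀) * N = V * (1 - μ))
    (h2 : (J + J₀) * N' = J.comp V * (1 - μ)) : N' = J₀.comp N := by
  apply (isUnit_add hp hp₀).mul_left_cancel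
  change (J + J₀) * N' = (J + J₀) * (J₀ * N)
  have h3 : (J + J₀) * J₀ = J * (J + J₀) := by
    rw [add_mul, mul_add, hp.1.mul_self, hp₀.1.mul_self, add_comm]
  rw [h2, ← mul_assoc, h3, mul_assoc, h1, ← mul_assoc]
  rfl

/-- The derivative at `0` of the inverse Cayley transform, from the differentiated equation
`A (1 - μ) = (1 - μ) J` with `μ' = -J a / 2`; the zeros are the values of `μ` and of the derivative
of the constant `J`. -/
lemma derivative_cayleyInv (hp : IsGenKahlerPair β J I) (ht : IsTangent β I J a) {A V : W →L[ℝ] W}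
    (h : V * (1 - 0) + A * (0 - (-1 / 2 : ℝ) • J.comp a) =
      (0 - (-1 / 2 : ℝ) • J.comp a) * J + (1 - 0) * 0) (hA : A = J) : V = a := by
  have hJJ := hp.1.mul_self
  have hma := ht.mul_J
  have hc : J.comp a = J * a := rfl
  rw [sub_zero, mul_one, one_mul, add_zero, zero_sub, neg_mul, mul_neg, smul_mul_assoc,
    mul_smul_comm, hA, hc, mul_assoc J a J, hma, mul_neg, ← mul_assoc, hJJ, neg_one_mul,
    neg_neg] at h
  rw [← sub_eq_zero] at h ⊢
  rw [← h]
  module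

end PointwiseIdentities

/-! ### Openness of the domain of the inverse Cayley transform -/

section OpenBall

lemma fderiv_smul_clm {W : Type*} [NormedAddCommGroup W] [NormedSpace ℝ W] (b : W →L[ℝ] W) :
    fderiv ℝ (fun t : ℝ => (-t / 2) • b) 0 1 = (-1 / 2 : ℝ) • b := by
  have h : HasDerivAt (fun t : ℝ => (-t / 2) • b) ((-1 / 2 : ℝ) • b) 0 :=
    ((hasDerivAt_id (0 : ℝ)).neg.div_const 2).smul_const b
  exact h.deriv

/-- Positivity on the compact unit sphere is an open condition. -/
lemma eventually_inBall {W : Type*} [NormedAddCommGroup W] [NormedSpace ℝ W]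
    [FiniteDimensional ℝ W] {β : LinearMap.BilinForm ℝ W}
    (hβ : Continuous fun p : W × W => β p.1 p.2) {I J₀ μ : W →L[ℝ] W} (h : InBall β I J₀ μ) :
    ∀ᶠ p : (W →L[ℝ] W) × (W →L[ℝ] W) × (W →L[ℝ] W) in 𝓝 (I, J₀, μ),
      InBall β p.1 p.2.1 p.2.2 := by
  have hK := isCompact_sphere (0 : W) 1
  have hc : Continuous fun z : ((W →L[ℝ] W) × (W →L[ℝ] W) × (W →L[ℝ] W)) × W =>
      β ((1 - z.1.2.2) (-(z.1.2.1 (z.1.1 z.2)))) ((1 - z.1.2.2) z.2) := by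
    refine hβ.comp (Continuous.prodMk ?_ ?_)
    · exact Continuous.clm_apply (by fun_prop) (Continuous.neg
        (Continuous.clm_apply (by fun_prop) (Continuous.clm_apply (by fun_prop) (by fun_prop))))
    · exact Continuous.clm_apply (by fun_prop) (by fun_prop)
  have h1 := hK.eventually_forall_of_forall_eventually
    (x₀ := ((I, J₀, μ) : (W →L[ℝ] W) × (W →L[ℝ] W) × (W →L[ℝ] W)))
    (P := fun p e => 0 < β ((1 - p.2.2) (-(p.2.1 (p.1 e)))) ((1 - p.2.2) e)) (by
      intro e he
      have he0 : e ≠ 0 := by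
        rintro rfl
        simp at he
      exact hc.continuousAt.eventually (p := fun r => 0 < r) (lt_mem_nhds (h e he0)))
  filter_upwards [h1] with p hp e he
  have hn : 0 < ‖e‖ := norm_pos_iff.2 he
  have h2 := hp (‖e‖⁻¹ • e) (by simp [norm_smul, hn.ne'])
  simp only [map_smul, ← smul_neg, LinearMap.smul_apply, smul_eq_mul] at h2
  exact pos_of_mul_pos_right (pos_of_mul_pos_right h2 (by positivity)) (by positivity)

lemma continuous_genPairing {V : Type*} [NormedAddCommGroup V] [NormedSpace ℝ V] :
    Continuous fun p : GenTangent V × GenTangent V => genPairing V p.1 p.2 := by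
  simp only [genPairing_apply]
  exact continuous_const.mul ((Continuous.clm_apply (by fun_prop) (by fun_prop)).add
    (Continuous.clm_apply (by fun_prop) (by fun_prop)))

variable {n : ℕ} {M : Type*} [TopologicalSpace M] [ChartedSpace (Eu n) M]
  [IsManifold (𝓡 (2 * n)) ∞ M] {P : Type*} [NormedAddCommGroup P] [NormedSpace ℝ P]

lemma inBall_endCoord_iff {c x : M} (hx : x ∈ (chartAt (Eu n) c).source)
    (I J₀ μ : GenTangent (Tan n x) →L[ℝ] GenTangent (Tan n x)) :
    InBall (genPairing (Eu n)) (endCoord c x I) (endCoord c x J₀) (endCoord c x μ) ↔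
      InBall (genPairing (Tan n x)) I J₀ μ := by
  have key : ∀ e, genPairing (Eu n) ((1 - endCoord c x μ) (-(endCoord c x J₀ (endCoord c x I e))))
      ((1 - endCoord c x μ) e) = genPairing (Tan n x) ((1 - μ) (-(J₀ (I (genFrame c x e)))))
        ((1 - μ) (genFrame c x e)) := by
    intro e
    have h1 : ∀ f, genFrame c x ((1 - endCoord c x μ) f) = (1 - μ) (genFrame c x f) := by
      intro f
      rw [← endCoord_one hx, ← endCoord_sub, endCoord_apply, genFrame_genCoord hx]
    rw [← genPairing_genFrame hx, h1, h1, map_neg, endCoord_apply, genFrame_genCoord hx,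
      endCoord_apply, genFrame_genCoord hx]
  simp only [InBall, key]
  constructor
  · intro h e he
    have := h (genCoord c x e) (fun h0 => he (by rw [← genFrame_genCoord hx e, h0, map_zero]))
    rwa [genFrame_genCoord hx] at this
  · intro h e he
    exact h _ (fun h0 => he (by rw [← genCoord_genFrame hx e, h0, map_zero]))

/-- On a compact manifold, positivity at all points is an open condition on the parameter. -/
theorem isOpen_inBall [CompactSpace M] {I J₀ : EndField n M} (hI : IsSmoothField I)
    (hJ₀ : IsSmoothField J₀) {U : Set P} (hU : IsOpen U) {A : P → EndField n M}
    (hA : IsSmoothFamily U A) :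
    IsOpen {t | t ∈ U ∧ ∀ x, InBall (genPairing (Tan n x)) (I x) (J₀ x) (A t x)} := by
  rw [isOpen_iff_mem_nhds]
  rintro t₀ ⟨ht₀, hb⟩
  have h1 : ∀ᶠ t in 𝓝 t₀, ∀ x ∈ (Set.univ : Set M),
      InBall (genPairing (Tan n x)) (I x) (J₀ x) (A t x) := by
    refine isCompact_univ.eventually_forall_of_forall_eventually fun x₀ _ => ?_
    let e := chartAt (Eu n) x₀
    have hx₀ : x₀ ∈ e.source := mem_chart_source _ x₀
    have hO : IsOpen (U ×ˢ e.target) := hU.prod e.open_target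
    have hq : (t₀, e x₀) ∈ U ×ˢ e.target := ⟨ht₀, e.map_source hx₀⟩
    have c1 : ContinuousAt (fun q : P × Eu n => coordField x₀ I q.2) (t₀, e x₀) :=
      ((isSmoothFamily_iff.1 (hI.isSmoothFamily U) x₀).continuousOn).continuousAt (hO.mem_nhds hq)
    have c2 : ContinuousAt (fun q : P × Eu n => coordField x₀ J₀ q.2) (t₀, e x₀) :=
      ((isSmoothFamily_iff.1 (hJ₀.isSmoothFamily U) x₀).continuousOn).continuousAt
        (hO.mem_nhds hq)
    have c3 : ContinuousAt (fun q : P × Eu n => coordField x₀ (A q.1) q.2) (t₀, e x₀) :=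
      ((isSmoothFamily_iff.1 hA x₀).continuousOn).continuousAt (hO.mem_nhds hq)
    have hb₀ : InBall (genPairing (Eu n)) (coordField x₀ I (e x₀)) (coordField x₀ J₀ (e x₀))
        (coordField x₀ (A t₀) (e x₀)) :=
      (inBall_endCoord_iff (e.map_target hq.2) _ _ _).2 (hb _)
    have h2 := (c1.prodMk (c2.prodMk c3)).eventually
      (eventually_inBall (W := GenTangent (Eu n)) continuous_genPairing hb₀)
    have h3 : Filter.Tendsto (fun z : P × M => (z.1, e z.2)) (𝓝 (t₀, x₀)) (𝓝 (t₀, e x₀)) := by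
      have : ContinuousAt (fun z : P × M => (z.1, e z.2)) (t₀, x₀) :=
        continuousAt_fst.prodMk ((e.continuousAt hx₀).comp continuousAt_snd)
      exact this
    have h4 : ∀ᶠ z : P × M in 𝓝 (t₀, x₀), z.2 ∈ e.source :=
      continuousAt_snd.eventually (e.open_source.mem_nhds hx₀)
    filter_upwards [h3.eventually h2, h4] with z hz hz2
    have h5 := (inBall_endCoord_iff (e.map_target (e.map_source hz2)) _ _ _).1 hz
    rwa [e.left_inv hz2] at h5
  filter_upwards [h1, hU.mem_nhds ht₀] with t ht htU
  exact ⟨htU, fun x => ht x (Set.mem_univ x)⟩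

end OpenBall

/-! ### Tangent spaces and the Cayley chart -/

section Chart

variable {n : ℕ} {M : Type*} [TopologicalSpace M] [ChartedSpace (Eu n) M]
  [IsManifold (𝓡 (2 * n)) ∞ M] {P : Type*} [NormedAddCommGroup P] [NormedSpace ℝ P]
  {ψ : FormField n M}

lemma tangentAt_iff {J a : EndField n M} : a ∈ tangentAt ψ J ↔ IsSmoothField a ∧
    ∀ x, IsTangent (genPairing (Tan n x)) (spinorStructure ψ x) (J x) (a x) := Iff.rfl

/-- The linear conditions follow by differentiation from those satisfied by the family, the
anticommutation with `A t` from `A² = -1`. -/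
theorem velocity_mem_tangentAt {U : Set P} {A : P → EndField n M} (hU : IsOpen U)
    (hA : IsSmoothFamily U A) (hc : ∀ t ∈ U, A t ∈ Compatible ψ) {t : P} (ht : t ∈ U) (v : P) :
    velocity A t v ∈ tangentAt ψ (A t) := by
  refine ⟨(hA.velocity hU v).isSmoothField ht, fun x => ⟨fun e f => ?_, ?_, ?_⟩⟩
  · let ℓ : (GenTangent (Tan n x) →L[ℝ] GenTangent (Tan n x)) →ₗ[ℝ] ℝ :=
      { toFun := fun B => genPairing _ (B e) f + genPairing _ e (B f)
        map_add' := fun B C => by simp; ring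
        map_smul' := fun r B => by simp; ring }
    refine linear_velocity_eq_zero hA hU ht v ℓ fun s hs => ?_
    change genPairing _ (A s x e) f + genPairing _ e (A s x f) = 0
    rw [((hc s hs).1.2 x).skew, neg_add_cancel]
  · have h1 := velocity_mul hA hA hU ht v x
    have h2 : velocity (fun s x => A s x * A s x) t v x = 0 := by
      rw [velocity_congr (B := fun _ _ => -1) hU ht
        (fun s hs => ((hc s hs).1.2 x).mul_self) v, velocity_const]
    rw [h2] at h1
    exact h1.symm
  · refine ContinuousLinearMap.ext fun e => ?_
    rw [← sub_eq_zero]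
    have key : ∀ ξ : Module.Dual ℝ (GenTangent (Tan n x)),
        ξ ((velocity A t v x).comp (spinorStructure ψ x) e -
          (spinorStructure ψ x).comp (velocity A t v x) e) = 0 := by
      intro ξ
      let ℓ : (GenTangent (Tan n x) →L[ℝ] GenTangent (Tan n x)) →ₗ[ℝ] ℝ :=
        { toFun := fun B => ξ (B (spinorStructure ψ x e) - spinorStructure ψ x (B e))
          map_add' := fun B C => by simp; ring
          map_smul' := fun r B => by simp; ring }
      refine linear_velocity_eq_zero hA hU ht v ℓ fun s hs => ?_
      change ξ (A s x (spinorStructure ψ x e) - spinorStructure ψ x (A s x e)) = 0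
      rw [(hc s hs).2.2 x |>.2.2.1 e, sub_self, map_zero]
    exact (Module.forall_dual_apply_eq_zero_iff ℝ _).1 key

variable {J₀ : EndField n M}

lemma isGenKahlerPair_of_mem {J : EndField n M} (h : J ∈ Compatible ψ) (x : M) :
    IsGenKahlerPair (genPairing (Tan n x)) (J x) (spinorStructure ψ x) := h.2.2 x

/-- A smooth family of compatible structures has smooth Cayley transforms. -/
lemma IsSmoothFamily.cayley {U : Set P} {A : P → EndField n M} (hA : IsSmoothFamily U A)
    (hc : ∀ t ∈ U, A t ∈ Compatible ψ) (h₀ : J₀ ∈ Compatible ψ) :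
    IsSmoothFamily U fun t x => GenKahler.cayley (J₀ x) (A t x) := by
  have h0 := h₀.1.1.isSmoothFamily U
  exact ((hA.add h0).inverse fun t ht x =>
    isUnit_add (isGenKahlerPair_of_mem (hc t ht) x) (isGenKahlerPair_of_mem h₀ x)).mul (hA.sub h0)

lemma IsSmoothFamily.cayleyInv {U : Set P} {A : P → EndField n M} (hA : IsSmoothFamily U A)
    (hb : ∀ t ∈ U, ∀ x, InBall (genPairing (Tan n x)) (spinorStructure ψ x) (J₀ x) (A t x))
    (h₀ : J₀ ∈ Compatible ψ) :
    IsSmoothFamily U fun t x => GenKahler.cayleyInv (J₀ x) (A t x) := by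
  have h0 := h₀.1.1.isSmoothFamily U
  have h1 := (isSmoothFamily_one (n := n) (M := M) U).sub hA
  exact (h1.mul h0).mul (h1.inverse fun t ht x => isUnit_one_sub (hb t ht x))

lemma cayley_mem_tangentAt {J : EndField n M} (h : J ∈ Compatible ψ) (h₀ : J₀ ∈ Compatible ψ) :
    (fun x => cayley (J₀ x) (J x)) ∈ tangentAt ψ J₀ :=
  ⟨((h.1.1.isSmoothFamily (Set.univ : Set ℝ)).cayley (fun _ _ => h) h₀).isSmoothField
    (Set.mem_univ 0), fun x => isTangent_cayley (isGenKahlerPair_of_mem h x)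
      (isGenKahlerPair_of_mem h₀ x)⟩

lemma cayleyInv_mem_compatible (h₀ : J₀ ∈ Compatible ψ) {μ : EndField n M}
    (hμ : μ ∈ tangentAt ψ J₀)
    (hb : ∀ x, InBall (genPairing (Tan n x)) (spinorStructure ψ x) (J₀ x) (μ x)) :
    (fun x => cayleyInv (J₀ x) (μ x)) ∈ Compatible ψ := by
  have hp : ∀ x, IsGenKahlerPair (genPairing (Tan n x)) (cayleyInv (J₀ x) (μ x))
      (spinorStructure ψ x) := fun x =>
    isGenKahlerPair_cayleyInv (isGenKahlerPair_of_mem h₀ x) (hμ.2 x) (hb x)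
  exact ⟨⟨((hμ.1.isSmoothFamily (Set.univ : Set ℝ)).cayleyInv (fun _ _ => hb) h₀).isSmoothField
    (Set.mem_univ 0), fun x => (hp x).1⟩, h₀.2.1, hp⟩

/-- The image of the Cayley chart consists of the tangent vectors whose values lie in the bounded
symmetric domains. -/
lemma cayley_image (h₀ : J₀ ∈ Compatible ψ) :
    (fun (J : EndField n M) x => cayley (J₀ x) (J x)) '' Compatible ψ = {μ | μ ∈ tangentAt ψ J₀ ∧
      ∀ x, InBall (genPairing (Tan n x)) (spinorStructure ψ x) (J₀ x) (μ x)} := by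
  ext μ
  constructor
  · rintro ⟨J, hJ, rfl⟩
    exact ⟨cayley_mem_tangentAt hJ h₀, fun x =>
      inBall_cayley (isGenKahlerPair_of_mem hJ x) (isGenKahlerPair_of_mem h₀ x)⟩
  · rintro ⟨hμ, hb⟩
    exact ⟨_, cayleyInv_mem_compatible h₀ hμ hb, funext fun x =>
      cayley_cayleyInv (isGenKahlerPair_of_mem h₀ x) (hμ.2 x) (hb x)⟩

/-- Differentiation of `(A + J₀) μ = A - J₀`, where `μ` is the Cayley transform of `A`. -/
lemma add_mul_velocity_cayley {U : Set P} {A : P → EndField n M} (hU : IsOpen U)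
    (hA : IsSmoothFamily U A) (hc : ∀ t ∈ U, A t ∈ Compatible ψ) (h₀ : J₀ ∈ Compatible ψ)
    {t : P} (ht : t ∈ U) (v : P) (x : M) :
    (A t x + J₀ x) * velocity (fun t x => cayley (J₀ x) (A t x)) t v x =
      velocity A t v x * (1 - cayley (J₀ x) (A t x)) := by
  have h0 := h₀.1.1.isSmoothFamily U
  have h1 := velocity_mul (hA.add h0) (hA.cayley hc h₀) hU ht v x
  rw [velocity_add hA h0 hU ht v x, velocity_const,
    velocity_congr (B := fun s x => A s x - J₀ x) hU ht (fun s hs => add_mul_cayley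
      (isGenKahlerPair_of_mem (hc s hs) x) (isGenKahlerPair_of_mem h₀ x)) v,
    velocity_sub hA h0 hU ht v x, velocity_const] at h1
  exact derivative_cayley h1

/-- The Cayley transform is a global chart, defined on all of `Ã_ψ(M)`. -/
theorem isHolomorphicChart_cayley [CompactSpace M] (h₀ : J₀ ∈ Compatible ψ) :
    IsHolomorphicChart ψ J₀ (Compatible ψ) fun J x => cayley (J₀ x) (J x) where
  mem := h₀
  isOpen_source := ⟨subset_rfl, fun m U A hU hA _ => by
    have : {t | t ∈ U ∧ A t ∈ Compatible ψ} = U := by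
      ext t; exact ⟨fun h => h.1, fun h => ⟨h, hA t h⟩⟩
    rwa [this]⟩
  isOpen_target := by
    rw [cayley_image h₀]
    refine ⟨fun μ h => h.1, fun m U A hU hA hs => ?_⟩
    have h := isOpen_inBall h₀.2.1.1 h₀.1.1 hU hs
    refine (congrArg IsOpen (Set.ext fun t => ?_)).mpr h
    exact ⟨fun h => ⟨h.1, h.2.2⟩, fun h => ⟨h.1, hA t h.1, h.2⟩⟩
  injOn := by
    intro A hA B hB hAB
    funext x
    rw [← cayleyInv_cayley (isGenKahlerPair_of_mem hA x) (isGenKahlerPair_of_mem h₀ x),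
      ← cayleyInv_cayley (isGenKahlerPair_of_mem hB x) (isGenKahlerPair_of_mem h₀ x)]
    exact congrArg _ (congrFun hAB x)
  fibrewise := fun A _ B _ x h => by simp only [h]
  smooth := by
    intro m U A hU hA
    refine ⟨fun h => h.cayley hA h₀, fun h => ?_⟩
    refine (h.cayleyInv (ψ := ψ) (J₀ := J₀) (fun t ht x => ?_) h₀).congr fun t ht x => ?_
    · exact inBall_cayley (isGenKahlerPair_of_mem (hA t ht) x) (isGenKahlerPair_of_mem h₀ x)
    · exact (cayleyInv_cayley (isGenKahlerPair_of_mem (hA t ht) x)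
        (isGenKahlerPair_of_mem h₀ x)).symm
  holomorphic := by
    intro U A B hU h0 hA hB hsA hsB hAB hv
    funext x
    have hp := isGenKahlerPair_of_mem (hA 0 h0) x
    have hp₀ := isGenKahlerPair_of_mem h₀ x
    have h1 := add_mul_velocity_cayley hU hsA hA h₀ h0 (1 : ℝ) x
    have h2 := add_mul_velocity_cayley hU hsB hB h₀ h0 (1 : ℝ) x
    rw [hv, ← hAB] at h2
    exact derivative_cayley_acs hp hp₀ h1 h2

theorem isIntegrable [CompactSpace M] (ψ : FormField n M) : IsIntegrable ψ where
  mem_tangent := fun J hJ a ha => by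
    refine ⟨(((hJ.1.1.isSmoothFamily (Set.univ : Set ℝ)).mul
      (ha.1.isSmoothFamily Set.univ)).isSmoothField (Set.mem_univ 0)), fun x => ?_⟩
    exact IsTangent.acs (isGenKahlerPair_of_mem hJ x) (ha.2 x)
  square := fun J hJ a _ => funext fun x =>
    comp_comp_self (isGenKahlerPair_of_mem hJ x).1 (a x)
  exists_chart := fun J₀ h₀ => ⟨_, _, isHolomorphicChart_cayley h₀⟩

/-- Every tangent vector `a` at `J` is a velocity: of the family whose Cayley transform is the
segment with direction `-J a / 2`. -/
theorem exists_family_of_mem_tangentAt [CompactSpace M] {J a : EndField n M}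
    (hJ : J ∈ Compatible ψ) (ha : a ∈ tangentAt ψ J) :
    ∃ (U : Set ℝ) (A : ℝ → EndField n M), IsOpen U ∧ 0 ∈ U ∧ (∀ t ∈ U, A t ∈ Compatible ψ) ∧
      IsSmoothFamily U A ∧ A 0 = J ∧ velocity A 0 1 = a := by
  have hJa : acs J a ∈ tangentAt ψ J := (isIntegrable ψ).mem_tangent J hJ a ha
  let μ : ℝ → EndField n M := fun t x => (-t / 2) • acs J a x
  have hμs : IsSmoothFamily Set.univ μ :=
    (hJa.1.isSmoothFamily Set.univ).smul (f := fun t => -t / 2) (by fun_prop)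
  have hμ0 : ∀ x, μ 0 x = 0 := fun x => by
    simp only [μ, neg_zero, zero_div]
    exact ContinuousLinearMap.ext fun e => zero_smul ℝ (acs J a x e)
  have hμt : ∀ t, μ t ∈ tangentAt ψ J := fun t =>
    ⟨hμs.isSmoothField (Set.mem_univ t), fun x => IsTangent.smul (hJa.2 x) _⟩
  let U : Set ℝ := {t | t ∈ Set.univ ∧
    ∀ x, InBall (genPairing (Tan n x)) (spinorStructure ψ x) (J x) (μ t x)}
  have hU : IsOpen U := isOpen_inBall hJ.2.1.1 hJ.1.1 isOpen_univ hμs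
  have h0 : (0 : ℝ) ∈ U := ⟨Set.mem_univ _, fun x => by
    rw [hμ0]; exact inBall_zero (isGenKahlerPair_of_mem hJ x)⟩
  let A : ℝ → EndField n M := fun t x => cayleyInv (J x) (μ t x)
  have hA0 : ∀ x, A 0 x = J x := fun x => by
    simp only [A, hμ0]
    exact cayleyInv_zero _
  have hμU : IsSmoothFamily U μ := fun c => (hμs c).mono
    (Set.prod_mono (Set.subset_univ _) subset_rfl)
  have hAs : IsSmoothFamily U A := hμU.cayleyInv (ψ := ψ) (fun t ht => ht.2) hJ
  refine ⟨U, A, hU, h0, fun t ht => cayleyInv_mem_compatible hJ (hμt t) ht.2, hAs, funext hA0,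
    funext fun x => ?_⟩
  have hp := isGenKahlerPair_of_mem hJ x
  let ν : ℝ → EndField n M := fun t x => 1 - μ t x
  have hν : IsSmoothFamily U ν := (isSmoothFamily_one U).sub hμU
  have hJs := hJ.1.1.isSmoothFamily U
  have hvμ : velocity μ 0 1 x = (-1 / 2 : ℝ) • acs J a x :=
    fderiv_smul_clm (W := GenTangent (Eu n)) (acs J a x)
  -- differentiate `A (1 - μ) = (1 - μ) J`
  have h1 := velocity_mul hAs hν hU h0 1 x
  have h2 := velocity_mul hν hJs hU h0 1 x
  have h3 := velocity_congr (A := fun t x => A t x * ν t x) (B := fun t x => ν t x * J x) hU h0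
    (x := x) (fun s hs => cayleyInv_mul (hs.2 x)) 1
  have h4 : velocity ν 0 1 x = 0 - (-1 / 2 : ℝ) • acs J a x := by
    rw [← hvμ, ← velocity_const (fun _ => 1) (0 : ℝ) 1 x]
    exact velocity_sub (isSmoothFamily_one U) hμU hU h0 1 x
  have h5 : ν 0 x = 1 - 0 := congrArg (fun B => 1 - B) (hμ0 x)
  rw [h1, h2, velocity_const, h4, h5] at h3
  exact derivative_cayleyInv hp (ha.2 x) h3 (hA0 x)

end Chart

/-! ### Integrals of compactly supported functions with parameters -/

section ParametricIntegral

open MeasureTheory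

variable {P E : Type*} [NormedAddCommGroup P] [NormedSpace ℝ P] [NormedAddCommGroup E]
  [NormedSpace ℝ E] [FiniteDimensional ℝ E] [MeasurableSpace E] [BorelSpace E]
  {μ : Measure E} [μ.IsAddHaarMeasure] {U : Set P} {k : Set E} {F : P × E → ℝ}

/-- The integral is a value of the convolution with the constant `1`, whose smoothness in parameters
is known. -/
lemma contDiffOn_integral_of_compact (hU : IsOpen U) (hk : IsCompact k)
    (hF : ContDiffOn ℝ ∞ F (U ×ˢ Set.univ)) (hz : ∀ t ∈ U, ∀ y ∉ k, F (t, y) = 0) :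
    ContDiffOn ℝ ∞ (fun t => ∫ y, F (t, y) ∂μ) U := by
  have h := contDiffOn_convolution_right_with_param (μ := μ) (f := fun _ : E => (1 : ℝ)) (n := ⊤)
    (ContinuousLinearMap.mul ℝ ℝ) (g := fun t y => F (t, y)) hU hk
    (fun t y ht hy => hz t ht y hy) (locallyIntegrable_const 1) hF
  have h2 := h.comp (f := fun t : P => (t, (0 : E)))
    (contDiffOn_id.prodMk contDiffOn_const) fun t ht => ⟨ht, Set.mem_univ _⟩
  refine h2.congr fun t _ => ?_
  simp only [Function.comp_apply, MeasureTheory.convolution, ContinuousLinearMap.mul_apply',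
    one_mul, zero_sub]
  exact (integral_neg_eq_self (fun y => F (t, y)) μ).symm

lemma integrable_of_compact (hk : IsCompact k) (hF : ContDiffOn ℝ ∞ F (U ×ˢ Set.univ))
    (hz : ∀ t ∈ U, ∀ y ∉ k, F (t, y) = 0) {t : P} (ht : t ∈ U) :
    Integrable (fun y => F (t, y)) μ := by
  have hc : Continuous fun y => F (t, y) :=
    hF.continuousOn.comp_continuous (by fun_prop) fun y => ⟨ht, Set.mem_univ _⟩
  exact hc.integrable_of_hasCompactSupport (HasCompactSupport.intro hk fun y hy => hz t ht y hy)

lemma fderiv_integral_of_compact (hU : IsOpen U) (hk : IsCompact k)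
    (hF : ContDiffOn ℝ ∞ F (U ×ˢ Set.univ)) (hz : ∀ t ∈ U, ∀ y ∉ k, F (t, y) = 0) {t : P}
    (ht : t ∈ U) (v : P) :
    fderiv ℝ (fun t => ∫ y, F (t, y) ∂μ) t v = ∫ y, fderiv ℝ (fun s => F (s, y)) t v ∂μ := by
  have hO : IsOpen (U ×ˢ (Set.univ : Set E)) := hU.prod isOpen_univ
  have hd : ∀ s ∈ U, ∀ y, HasFDerivAt (fun s => F (s, y))
      ((fderiv ℝ F (s, y)).comp (ContinuousLinearMap.inl ℝ P E)) s := by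
    intro s hs y
    have h1 : DifferentiableAt ℝ F (s, y) :=
      (hF.contDiffAt (hO.mem_nhds ⟨hs, Set.mem_univ _⟩)).differentiableAt (by simp)
    exact HasFDerivAt.comp (f := fun s : P => (s, y)) s h1.hasFDerivAt
      ((hasFDerivAt_id s).prodMk (hasFDerivAt_const y s))
  have hcF : ContinuousOn (fun q => (fderiv ℝ F q).comp (ContinuousLinearMap.inl ℝ P E))
      (U ×ˢ Set.univ) :=
    ((hF.continuousOn_fderiv_of_isOpen hO (by simp))).clm_comp continuousOn_const
  have hct : Continuous fun y => (fderiv ℝ F (t, y)).comp (ContinuousLinearMap.inl ℝ P E) :=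
    hcF.comp_continuous (f := fun y => (t, y)) (by fun_prop) fun y => ⟨ht, Set.mem_univ _⟩
  have hz' : ∀ s ∈ U, ∀ y ∉ k, (fderiv ℝ F (s, y)).comp (ContinuousLinearMap.inl ℝ P E) = 0 := by
    intro s hs y hy
    have h1 : (fun s => F (s, y)) =ᶠ[𝓝 s] fun _ => 0 :=
      Filter.eventuallyEq_of_mem (hU.mem_nhds hs) fun r hr => hz r hr y hy
    rw [← (hd s hs y).fderiv, h1.fderiv_eq, fderiv_const_apply]
  obtain ⟨C, hC⟩ := (hk.image hct).isBounded.exists_norm_le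
  -- By compactness the derivative is bounded near `t`, uniformly in `y`.
  have hb : ∀ᶠ s in 𝓝 t, ∀ y ∈ k,
      ‖(fderiv ℝ F (s, y)).comp (ContinuousLinearMap.inl ℝ P E)‖ < C + 1 := by
    refine hk.eventually_forall_of_forall_eventually fun y hy => ?_
    have h1 : ContinuousAt (fun q => ‖(fderiv ℝ F q).comp (ContinuousLinearMap.inl ℝ P E)‖)
        (t, y) := (hcF.continuousAt (hO.mem_nhds ⟨ht, Set.mem_univ _⟩)).norm
    refine h1.eventually (gt_mem_nhds ?_)
    have := hC _ ⟨y, hy, rfl⟩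
    linarith
  have hC0 : ∀ᶠ s in 𝓝 t, s ∈ U := hU.mem_nhds ht
  have hint : Integrable (fun y => (fderiv ℝ F (t, y)).comp (ContinuousLinearMap.inl ℝ P E)) μ :=
    hct.integrable_of_hasCompactSupport (HasCompactSupport.intro hk fun y hy => hz' t ht y hy)
  have key := hasFDerivAt_integral_of_dominated_of_fderiv_le (𝕜 := ℝ) (μ := μ)
    (F := fun s y => F (s, y)) (x₀ := t)
    (F' := fun s y => (fderiv ℝ F (s, y)).comp (ContinuousLinearMap.inl ℝ P E))
    (bound := k.indicator fun _ => C + 1) (hb.and hC0)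
    (hC0.mono fun s hs => (integrable_of_compact hk hF hz hs).aestronglyMeasurable)
    (integrable_of_compact hk hF hz ht) hint.aestronglyMeasurable
    (Filter.Eventually.of_forall fun y s hs => by
      by_cases hy : y ∈ k
      · rw [Set.indicator_of_mem hy]
        exact (hs.1 y hy).le
      · rw [Set.indicator_of_notMem hy, hz' s hs.2 y hy, norm_zero])
    ((integrable_indicator_iff hk.measurableSet).2
      (integrableOn_const hk.measure_lt_top.ne))
    (Filter.Eventually.of_forall fun y s hs => hd s hs.2 y)
  rw [key.fderiv, ContinuousLinearMap.integral_apply hint]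
  refine integral_congr_ae (Filter.Eventually.of_forall fun y => ?_)
  simp only [(hd t ht y).fderiv]

end ParametricIntegral

/-! ### The integral against the volume form of the spinor -/

section SpinIntegral

open MeasureTheory

variable {n : ℕ} {M : Type*} [TopologicalSpace M] [T2Space M] [CompactSpace M]
  [ChartedSpace (Eu n) M] [IsManifold (𝓡 (2 * n)) ∞ M] {ψ : FormField n M}

/-- The coefficient, in the chart at `c`, of the real form `(√-1)^{-n} ⟨ψ, ψ̄⟩`. -/
noncomputable def spinCoeff (ψ : FormField n M) (c : M) (y : Eu n) : ℝ :=
  ((Complex.I ^ n)⁻¹ * topCoeff (spinNorm ψ) c ((chartAt (Eu n) c).symm y)).re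

lemma ofReal_spinCoeff (ψ : FormField n M) (c : M) (y : Eu n) :
    (spinCoeff ψ c y : ℂ) =
      (Complex.I ^ n)⁻¹ * topCoeff (spinNorm ψ) c ((chartAt (Eu n) c).symm y) := by
  apply Complex.ext
  · rfl
  · rw [Complex.ofReal_im]
    exact (spinPairing_conj_real _ _).symm

lemma contDiffOn_spinCoeff (hψ : IsSmoothForm ψ) (c : M) :
    ContDiffOn ℝ ∞ (spinCoeff ψ c) (chartAt (Eu n) c).target := by
  have h1 := contDiffOn_spinPairing (fun k w => contDiffOn_evalForm_coordForm hψ c (k := k) w)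
    LinearMap.id (EuclideanSpace.basisFun (Fin (2 * n)) ℝ).toBasis
  have h2 : ContDiffOn ℝ ∞ (fun y => Complex.reCLM ((Complex.I ^ n)⁻¹ *
      spinPairing (LinearMap.id (R := ℂ) (coordForm c ψ y)) (conjC _ (coordForm c ψ y))
        (EuclideanSpace.basisFun (Fin (2 * n)) ℝ).toBasis)) (chartAt (Eu n) c).target :=
    Complex.reCLM.contDiff.comp_contDiffOn (contDiffOn_const.mul h1)
  refine h2.congr fun y hy => ?_
  rw [spinCoeff, topCoeff_spinNorm hy]
  rfl

lemma spinCoeff_ne_zero (hpure : ∀ x, IsPure (ψ x)) (hnondeg : ∀ x, IsNondegenerate (ψ x)) {c : M}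
    {y : Eu n} (hy : y ∈ (chartAt (Eu n) c).target) : spinCoeff ψ c y ≠ 0 := by
  rw [← Complex.ofReal_ne_zero, ofReal_spinCoeff, topCoeff_spinNorm hy]
  exact mul_ne_zero (inv_ne_zero (pow_ne_zero _ Complex.I_ne_zero))
    (spinPairing_coordForm_ne_zero hpure hnondeg hy)

/-- The density of the measure `ρ_c (√-1)^{-n} ⟨ψ, ψ̄⟩` in the chart at `c`, where `ρ_c` is the
function with index `c` of the partition of unity. -/
noncomputable def spinDensity (ψ : FormField n M) (c : M) : Eu n → ℝ :=
  (chartAt (Eu n) c).target.indicator fun y =>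
    chartPartition n M c ((chartAt (Eu n) c).symm y) * |spinCoeff ψ c y|

/-- The points of the chart at `c` corresponding to the support of the partition function. -/
def chartSupport (n : ℕ) {M : Type*} [TopologicalSpace M] [T2Space M] [CompactSpace M]
    [ChartedSpace (Eu n) M] [IsManifold (𝓡 (2 * n)) ∞ M] (c : M) : Set (Eu n) :=
  chartAt (Eu n) c '' tsupport (chartPartition n M c)

lemma tsupport_chartPartition (c : M) :
    tsupport (chartPartition n M c) ⊆ (chartAt (Eu n) c).source :=
  (SmoothPartitionOfUnity.exists_isSubordinate_chartAt_source (𝓡 (2 * n)) M).choose_spec c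

lemma isCompact_chartSupport (c : M) : IsCompact (chartSupport n c) :=
  (isClosed_tsupport _).isCompact.image_of_continuousOn
    ((chartAt (Eu n) c).continuousOn.mono (tsupport_chartPartition c))

lemma chartSupport_subset (c : M) : chartSupport n c ⊆ (chartAt (Eu n) c).target := by
  rintro _ ⟨x, hx, rfl⟩
  exact (chartAt (Eu n) c).map_source (tsupport_chartPartition c hx)

lemma spinDensity_eq_zero {c : M} {y : Eu n} (hy : y ∉ chartSupport n c) :
    spinDensity ψ c y = 0 := by
  by_cases h : y ∈ (chartAt (Eu n) c).target
  · rw [spinDensity, Set.indicator_of_mem h]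
    have h1 : (chartAt (Eu n) c).symm y ∉ tsupport (chartPartition n M c) := fun h2 =>
      hy ⟨_, h2, (chartAt (Eu n) c).right_inv h⟩
    rw [image_eq_zero_of_notMem_tsupport h1, zero_mul]
  · exact Set.indicator_of_notMem h _

lemma spinDensity_nonneg (c : M) (y : Eu n) : 0 ≤ spinDensity ψ c y :=
  Set.indicator_nonneg (fun _ _ => mul_nonneg ((chartPartition n M).nonneg c _) (abs_nonneg _)) y

lemma contDiffOn_spinDensity (hψ : IsSmoothForm ψ) (hpure : ∀ x, IsPure (ψ x))
    (hnondeg : ∀ x, IsNondegenerate (ψ x)) (c : M) :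
    ContDiffOn ℝ ∞ (spinDensity ψ c) (chartAt (Eu n) c).target := by
  have h1 : ContDiffOn ℝ ∞ (fun y => chartPartition n M c ((chartAt (Eu n) c).symm y))
      (chartAt (Eu n) c).target := by
    have := (contMDiffOn_chart_iff (n := n) c (s := Set.univ)
      (f := chartPartition n M c)).1 ((chartPartition n M c).contMDiff.contMDiffOn)
    simpa using this
  refine (h1.mul ((contDiffOn_spinCoeff hψ c).abs
    fun y hy => spinCoeff_ne_zero hpure hnondeg hy)).congr fun y hy => ?_
  rw [spinDensity, Set.indicator_of_mem hy]

lemma finite_support_chartPartition :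
    {c : M | (Function.support (chartPartition n M c)).Nonempty}.Finite :=
  (chartPartition n M).locallyFinite.finite_nonempty_of_compact

/-- The real number `(√-1)^{-n} ∫_M f ⟨ψ, ψ̄⟩`. -/
noncomputable def spinReal (ψ : FormField n M) (f : M → ℝ) : ℝ :=
  ∑ c ∈ (finite_support_chartPartition (n := n) (M := M)).toFinset,
    ∫ y, spinDensity ψ c y * f ((chartAt (Eu n) c).symm y)

/-- The orientation sign turns the coefficient of `(√-1)^{-n} ⟨ψ, ψ̄⟩` into its absolute value. -/
theorem spinIntegral_eq (ψ : FormField n M) (f : M → ℝ) :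
    spinIntegral ψ f = (spinReal ψ f : ℂ) := by
  have h1 : ∀ (c : M) (y : Eu n), (Complex.I ^ n)⁻¹ *
      (((chartPartition n M c ((chartAt (Eu n) c).symm y) *
      Real.sign (topCoeff (fun x w => (Complex.I ^ n)⁻¹ * spinNorm ψ x w) c
        ((chartAt (Eu n) c).symm y)).re : ℝ) : ℂ) *
      topCoeff (fun x w => (f x : ℂ) * spinNorm ψ x w) c ((chartAt (Eu n) c).symm y)) =
      ((chartPartition n M c ((chartAt (Eu n) c).symm y) * |spinCoeff ψ c y| *
        f ((chartAt (Eu n) c).symm y) : ℝ) : ℂ) := by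
    intro c y
    have h2 : topCoeff (fun x w => (f x : ℂ) * spinNorm ψ x w) c ((chartAt (Eu n) c).symm y) =
      f ((chartAt (Eu n) c).symm y) * topCoeff (spinNorm ψ) c ((chartAt (Eu n) c).symm y) := rfl
    have h3 : (topCoeff (fun x w => (Complex.I ^ n)⁻¹ * spinNorm ψ x w) c
        ((chartAt (Eu n) c).symm y)).re = spinCoeff ψ c y := rfl
    have h4 : |spinCoeff ψ c y| = Real.sign (spinCoeff ψ c y) * spinCoeff ψ c y := by
      rcases lt_trichotomy (spinCoeff ψ c y) 0 with h | h | h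
      · rw [abs_of_neg h, Real.sign_of_neg h, neg_one_mul]
      · simp [h]
      · rw [abs_of_pos h, Real.sign_of_pos h, one_mul]
    rw [h2, h3, h4]
    push_cast
    rw [ofReal_spinCoeff]
    ring
  have h5 : ∀ c : M, (Complex.I ^ n)⁻¹ * ∫ y in (chartAt (Eu n) c).target,
      ((chartPartition n M c ((chartAt (Eu n) c).symm y) *
      Real.sign (topCoeff (fun x w => (Complex.I ^ n)⁻¹ * spinNorm ψ x w) c
        ((chartAt (Eu n) c).symm y)).re : ℝ) : ℂ) *
      topCoeff (fun x w => (f x : ℂ) * spinNorm ψ x w) c ((chartAt (Eu n) c).symm y) =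
      ((∫ y, spinDensity ψ c y * f ((chartAt (Eu n) c).symm y) : ℝ) : ℂ) := by
    intro c
    rw [← integral_const_mul]
    simp only [h1]
    rw [integral_complex_ofReal, ← integral_indicator (chartAt (Eu n) c).open_target.measurableSet]
    congr 2
    funext y
    by_cases h : y ∈ (chartAt (Eu n) c).target
    · simp [spinDensity, h]
    · simp [spinDensity, h]
  rw [spinIntegral, integralForm, spinReal, finsum_eq_sum_of_support_subset (s :=
    (finite_support_chartPartition (n := n) (M := M)).toFinset), Finset.mul_sum]
  · rw [Complex.ofReal_sum]
    exact Finset.sum_congr rfl fun c _ => h5 c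
  · intro c hc
    rw [Function.mem_support] at hc
    rw [Set.Finite.coe_toFinset, Set.mem_ofPred_eq]
    by_contra h
    rw [Set.not_nonempty_iff_eq_empty, Function.support_eq_empty_iff] at h
    exact hc (by simp [h])

variable {P : Type*} [NormedAddCommGroup P] [NormedSpace ℝ P] {U : Set P} {h : P → M → ℝ}

/-- A family of functions on `M` which is jointly smooth in the parameter and the point. -/
def IsSmoothScalarFamily (n : ℕ) {M : Type*} [TopologicalSpace M] [ChartedSpace (Eu n) M]
    {P : Type*} [NormedAddCommGroup P] [NormedSpace ℝ P] (U : Set P) (h : P → M → ℝ) : Prop :=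
  ∀ c : M, ContDiffOn ℝ ∞ (fun q : P × Eu n => h q.1 ((chartAt (Eu n) c).symm q.2))
    (U ×ˢ (chartAt (Eu n) c).target)

lemma contDiffOn_spinDensity_mul (hψ : IsSmoothForm ψ) (hpure : ∀ x, IsPure (ψ x))
    (hnondeg : ∀ x, IsNondegenerate (ψ x)) (hU : IsOpen U) (hh : IsSmoothScalarFamily n U h)
    (c : M) : ContDiffOn ℝ ∞ (fun q : P × Eu n =>
      spinDensity ψ c q.2 * h q.1 ((chartAt (Eu n) c).symm q.2)) (U ×ˢ Set.univ) := by
  rintro ⟨t, y⟩ ⟨ht, -⟩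
  apply ContDiffAt.contDiffWithinAt
  by_cases hy : y ∈ (chartAt (Eu n) c).target
  · have hO : IsOpen (U ×ˢ (chartAt (Eu n) c).target) := hU.prod (chartAt (Eu n) c).open_target
    have h1 : ContDiffOn ℝ ∞ (fun q : P × Eu n => spinDensity ψ c q.2)
        (U ×ˢ (chartAt (Eu n) c).target) :=
      (contDiffOn_spinDensity hψ hpure hnondeg c).comp contDiffOn_snd fun q hq => hq.2
    exact (h1.mul (hh c)).contDiffAt (hO.mem_nhds ⟨ht, hy⟩)
  · have hy' : y ∉ chartSupport n c := fun h0 => hy (chartSupport_subset c h0)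
    have hO : IsOpen ((Set.univ : Set P) ×ˢ (chartSupport n c)ᶜ) :=
      isOpen_univ.prod (isCompact_chartSupport c).isClosed.isOpen_compl
    have h1 : (fun q : P × Eu n => spinDensity ψ c q.2 * h q.1 ((chartAt (Eu n) c).symm q.2))
        =ᶠ[𝓝 (t, y)] fun _ => 0 :=
      Filter.eventuallyEq_of_mem (hO.mem_nhds ⟨Set.mem_univ _, hy'⟩) fun q hq => by
        simp only [spinDensity_eq_zero hq.2, zero_mul]
    exact contDiffAt_const.congr_of_eventuallyEq h1

lemma spinDensity_mul_eq_zero (c : M) (h : P → M → ℝ) : ∀ t ∈ U, ∀ y ∉ chartSupport n c,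
    spinDensity ψ c y * h t ((chartAt (Eu n) c).symm y) = 0 := fun t _ y hy => by
  rw [spinDensity_eq_zero hy, zero_mul]

theorem contDiffOn_spinReal (hψ : IsSmoothForm ψ) (hpure : ∀ x, IsPure (ψ x))
    (hnondeg : ∀ x, IsNondegenerate (ψ x)) (hU : IsOpen U) (hh : IsSmoothScalarFamily n U h) :
    ContDiffOn ℝ ∞ (fun t => spinReal ψ (h t)) U :=
  ContDiffOn.sum fun c _ => contDiffOn_integral_of_compact hU (isCompact_chartSupport c)
    (contDiffOn_spinDensity_mul hψ hpure hnondeg hU hh c) (spinDensity_mul_eq_zero c h)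

theorem fderiv_spinReal (hψ : IsSmoothForm ψ) (hpure : ∀ x, IsPure (ψ x))
    (hnondeg : ∀ x, IsNondegenerate (ψ x)) (hU : IsOpen U) (hh : IsSmoothScalarFamily n U h)
    {t : P} (ht : t ∈ U) (v : P) : fderiv ℝ (fun t => spinReal ψ (h t)) t v =
      spinReal ψ fun x => fderiv ℝ (fun s => h s x) t v := by
  have hF := contDiffOn_spinDensity_mul hψ hpure hnondeg hU hh
  have h1 : ∀ c : M, DifferentiableAt ℝ (fun t => ∫ y, spinDensity ψ c y *
      h t ((chartAt (Eu n) c).symm y)) t := fun c =>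
    ((contDiffOn_integral_of_compact hU (isCompact_chartSupport c) (hF c)
      (spinDensity_mul_eq_zero c h)).contDiffAt (hU.mem_nhds ht)).differentiableAt (by simp)
  have h2 : fderiv ℝ (fun t => spinReal ψ (h t)) t = _ := fderiv_fun_sum fun c _ => h1 c
  rw [h2, sum_apply, spinReal]
  refine Finset.sum_congr rfl fun c _ => ?_
  have h3 := fderiv_integral_of_compact (μ := volume) hU (isCompact_chartSupport c) (hF c)
    (spinDensity_mul_eq_zero c h) ht v
  refine h3.trans (integral_congr_ae (Filter.Eventually.of_forall fun y => ?_))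
  change fderiv ℝ (fun s => spinDensity ψ c y * h s ((chartAt (Eu n) c).symm y)) t v =
    spinDensity ψ c y * fderiv ℝ (fun s => h s ((chartAt (Eu n) c).symm y)) t v
  by_cases hy : y ∈ (chartAt (Eu n) c).target
  · have h4 : ContDiffOn ℝ ∞ (fun s => h s ((chartAt (Eu n) c).symm y)) U :=
      (hh c).comp (f := fun s => (s, y)) (contDiffOn_id.prodMk contDiffOn_const)
        fun s hs => ⟨hs, hy⟩
    rw [fderiv_const_mul ((h4.contDiffAt (hU.mem_nhds ht)).differentiableAt (by simp))]
    rfl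
  · rw [spinDensity, Set.indicator_of_notMem hy]
    simp

lemma integrable_spinDensity_mul (hψ : IsSmoothForm ψ) (hpure : ∀ x, IsPure (ψ x))
    (hnondeg : ∀ x, IsNondegenerate (ψ x)) {f : M → ℝ}
    (hf : IsSmoothScalarFamily n (Set.univ : Set ℝ) fun _ => f) (c : M) :
    Integrable fun y => spinDensity ψ c y * f ((chartAt (Eu n) c).symm y) :=
  integrable_of_compact (isCompact_chartSupport c)
    (contDiffOn_spinDensity_mul hψ hpure hnondeg isOpen_univ hf c)
    (spinDensity_mul_eq_zero c fun _ => f) (Set.mem_univ (0 : ℝ))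

theorem spinReal_add (hψ : IsSmoothForm ψ) (hpure : ∀ x, IsPure (ψ x))
    (hnondeg : ∀ x, IsNondegenerate (ψ x)) {f g : M → ℝ}
    (hf : IsSmoothScalarFamily n (Set.univ : Set ℝ) fun _ => f)
    (hg : IsSmoothScalarFamily n (Set.univ : Set ℝ) fun _ => g) :
    spinReal ψ (fun x => f x + g x) = spinReal ψ f + spinReal ψ g := by
  rw [spinReal, spinReal, spinReal, ← Finset.sum_add_distrib]
  refine Finset.sum_congr rfl fun c _ => ?_
  rw [← integral_add (integrable_spinDensity_mul hψ hpure hnondeg hf c)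
    (integrable_spinDensity_mul hψ hpure hnondeg hg c)]
  simp only [mul_add]

theorem spinReal_smul (r : ℝ) (f : M → ℝ) :
    spinReal ψ (fun x => r * f x) = r * spinReal ψ f := by
  rw [spinReal, spinReal, Finset.mul_sum]
  refine Finset.sum_congr rfl fun c _ => ?_
  rw [← integral_const_mul]
  congr 1
  funext y
  ring

theorem spinReal_pos (hψ : IsSmoothForm ψ) (hpure : ∀ x, IsPure (ψ x))
    (hnondeg : ∀ x, IsNondegenerate (ψ x)) {f : M → ℝ}
    (hf : IsSmoothScalarFamily n (Set.univ : Set ℝ) fun _ => f) (h0 : ∀ x, 0 ≤ f x) {x₀ : M}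
    (hx₀ : 0 < f x₀) : 0 < spinReal ψ f := by
  obtain ⟨c, hc⟩ : ∃ c, 0 < chartPartition n M c x₀ :=
    (chartPartition n M).exists_pos_of_mem (Set.mem_univ x₀)
  have hx : x₀ ∈ (chartAt (Eu n) c).source :=
    tsupport_chartPartition c (subset_tsupport _ hc.ne')
  have hnn : ∀ (c : M) (y : Eu n), 0 ≤ spinDensity ψ c y * f ((chartAt (Eu n) c).symm y) :=
    fun c y => mul_nonneg (spinDensity_nonneg c y) (h0 _)
  refine Finset.sum_pos' (fun c _ => integral_nonneg (hnn c)) ⟨c, ?_, ?_⟩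
  · rw [Set.Finite.mem_toFinset]
    exact ⟨x₀, hc.ne'⟩
  · have hcont : Continuous fun y => spinDensity ψ c y * f ((chartAt (Eu n) c).symm y) :=
      (contDiffOn_spinDensity_mul hψ hpure hnondeg isOpen_univ hf c).continuousOn.comp_continuous
        (f := fun y => ((0 : ℝ), y)) (by fun_prop) fun y => ⟨Set.mem_univ _, Set.mem_univ _⟩
    refine hcont.integral_pos_of_hasCompactSupport_nonneg_nonzero
      (HasCompactSupport.intro (isCompact_chartSupport c) fun y hy => by
        rw [spinDensity_eq_zero hy, zero_mul]) (hnn c) (x := chartAt (Eu n) c x₀) ?_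
    have hy := (chartAt (Eu n) c).map_source hx
    rw [spinDensity, Set.indicator_of_mem hy, (chartAt (Eu n) c).left_inv hx]
    exact mul_ne_zero (mul_ne_zero hc.ne'
      (abs_ne_zero.2 (spinCoeff_ne_zero hpure hnondeg hy))) hx₀.ne'

end SpinIntegral

/-! ### The Kähler form -/

section TraceCalculus

variable {P F : Type*} [NormedAddCommGroup P] [NormedSpace ℝ P] [NormedAddCommGroup F]
  [NormedSpace ℝ F]

/-- Symmetry of second derivatives. -/
lemma fderiv_fderiv_apply_comm {f : P → F} {U : Set P} (hU : IsOpen U) (hf : ContDiffOn ℝ ∞ f U)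
    {t : P} (ht : t ∈ U) (u v : P) :
    fderiv ℝ (fun s => fderiv ℝ f s v) t u = fderiv ℝ (fun s => fderiv ℝ f s u) t v := by
  have h1 : ∀ w z, fderiv ℝ (fun s => fderiv ℝ f s w) t z = fderiv ℝ (fderiv ℝ f) t z w := by
    intro w z
    have hd : DifferentiableAt ℝ (fderiv ℝ f) t :=
      ((hf.fderiv_of_isOpen (m := ∞) hU (by simp)).contDiffAt
        (hU.mem_nhds ht)).differentiableAt (by simp)
    rw [fderiv_clm_apply hd (differentiableAt_const w)]
    simp
  rw [h1, h1]
  exact (hf.contDiffAt (hU.mem_nhds ht)).isSymmSndFDerivAt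
    (by simpa using (WithTop.coe_le_coe.2 le_top : ((2 : ℕ∞) : WithTop ℕ∞) ≤ ∞)) u v

lemma contDiffOn_tr {W : Type*} [NormedAddCommGroup W] [NormedSpace ℝ W] [FiniteDimensional ℝ W]
    {f : P → W →L[ℝ] W} {U : Set P} (hf : ContDiffOn ℝ ∞ f U) :
    ContDiffOn ℝ ∞ (fun s => tr (f s)) U :=
  contDiffOn_linear_comp ((LinearMap.trace ℝ W).comp (ContinuousLinearMap.coeLM ℝ)) hf

lemma fderiv_tr {W : Type*} [NormedAddCommGroup W] [NormedSpace ℝ W] [FiniteDimensional ℝ W]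
    {f : P → W →L[ℝ] W} {t : P} (hf : DifferentiableAt ℝ f t) (v : P) :
    fderiv ℝ (fun s => tr (f s)) t v = tr (fderiv ℝ f t v) :=
  fderiv_linear_comp ((LinearMap.trace ℝ W).comp (ContinuousLinearMap.coeLM ℝ)) hf v

lemma tr_leibniz {W : Type*} [AddCommGroup W] [Module ℝ W] [TopologicalSpace W]
    [IsTopologicalAddGroup W] [ContinuousSMul ℝ W] (J dJ a b da db : W →L[ℝ] W) :
    tr (dJ * (a * b) + J * (da * b + a * db)) =
      tr (dJ * (a * b)) + tr (J * (da * b)) + tr (J * (a * db)) := by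
  rw [tr_add, mul_add, tr_add, add_assoc]

lemma tr_mul_add_mul {W : Type*} [AddCommGroup W] [Module ℝ W] [TopologicalSpace W]
    [IsTopologicalAddGroup W] [ContinuousSMul ℝ W] (J a b c : W →L[ℝ] W) :
    tr (J * ((a + b) * c)) = tr (J * (a * c)) + tr (J * (b * c)) := by
  rw [add_mul, mul_add, tr_add]

lemma tr_mul_smul_mul {W : Type*} [AddCommGroup W] [Module ℝ W] [TopologicalSpace W]
    [IsTopologicalAddGroup W] [ContinuousSMul ℝ W] (r : ℝ) (J a b : W →L[ℝ] W) :
    tr (J * ((r • a) * b)) = r * tr (J * (a * b)) := by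
  rw [smul_mul_assoc, mul_smul_comm, tr_smul]

end TraceCalculus

section TraceFamily

variable {n : ℕ} {M : Type*} [TopologicalSpace M] [ChartedSpace (Eu n) M]
  [IsManifold (𝓡 (2 * n)) ∞ M] {P : Type*} [NormedAddCommGroup P] [NormedSpace ℝ P]
  {U : Set P} {A : P → EndField n M} {t : P}

lemma IsSmoothFamily.trace (hA : IsSmoothFamily U A) :
    IsSmoothScalarFamily n U fun t (x : M) => tr (A t x) := fun c =>
  (contDiffOn_tr (W := GenTangent (Eu n)) (isSmoothFamily_iff.1 hA c)).congr fun q hq =>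
    (tr_endCoord ((chartAt (Eu n) c).map_target hq.2) (A q.1 _)).symm

lemma fderiv_trace (hA : IsSmoothFamily U A) (hU : IsOpen U) (ht : t ∈ U) (v : P) (x : M) :
    fderiv ℝ (fun s => tr (A s x)) t v = tr (velocity A t v x) :=
  fderiv_tr (W := GenTangent (Eu n)) (hA.differentiableAt hU ht x) v

lemma velocity_velocity_comm (hA : IsSmoothFamily U A) (hU : IsOpen U) (ht : t ∈ U) (u v : P)
    (x : M) : velocity (fun s => velocity A s v) t u x = velocity (fun s => velocity A s u) t v x :=
  fderiv_fderiv_apply_comm (F := EuEnd n) hU (hA.contDiffOn_apply x) ht u v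

/-- The trace of a product of smooth sections, as a constant family of functions. -/
lemma isSmoothScalarFamily_tr_mul {a b : EndField n M} (ha : IsSmoothField a)
    (hb : IsSmoothField b) :
    IsSmoothScalarFamily n (Set.univ : Set ℝ) fun _ (x : M) => tr (a x * b x) :=
  ((ha.isSmoothFamily (P := ℝ) Set.univ).mul (hb.isSmoothFamily Set.univ)).trace

lemma isSmoothScalarFamily_tr_mul_mul {a b c : EndField n M} (ha : IsSmoothField a)
    (hb : IsSmoothField b) (hc : IsSmoothField c) :
    IsSmoothScalarFamily n (Set.univ : Set ℝ) fun _ (x : M) => tr (a x * (b x * c x)) :=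
  ((ha.isSmoothFamily (P := ℝ) Set.univ).mul
    ((hb.isSmoothFamily Set.univ).mul (hc.isSmoothFamily Set.univ))).trace

end TraceFamily

section KahlerForm

variable {n : ℕ} {M : Type*} [TopologicalSpace M] [T2Space M] [CompactSpace M]
  [ChartedSpace (Eu n) M] [IsManifold (𝓡 (2 * n)) ∞ M] {ψ : FormField n M}

/-- The `L²` form as a real number. -/
noncomputable def kahlerForm (ψ : FormField n M) (J a b : EndField n M) : ℝ :=
  -spinReal ψ fun x => tr (J x * (a x * b x))

lemma ofReal_kahlerForm (J a b : EndField n M) : (kahlerForm ψ J a b : ℂ) = l2Form ψ J a b := by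
  rw [kahlerForm, l2Form, spinIntegral_eq, Complex.ofReal_neg]
  rfl

/-- Inserting `J a` produces the `L²` metric, because `J J a = -a`. -/
lemma kahlerForm_acs_left {J : EndField n M} (hJ : J ∈ Compatible ψ) (a b : EndField n M) :
    kahlerForm ψ J (acs J a) b = spinReal ψ fun x => tr (a x * b x) := by
  have h : (fun x => tr (J x * (acs J a x * b x))) = fun x : M => (-1) * tr (a x * b x) :=
    funext fun x => (tr_acs_left ((hJ.1.2 x).mul_self)).trans (neg_one_mul _).symm
  rw [kahlerForm, h, spinReal_smul, neg_one_mul, neg_neg]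

lemma ofReal_kahlerForm_acs_left {J : EndField n M} (hJ : J ∈ Compatible ψ) (a b : EndField n M) :
    (kahlerForm ψ J (acs J a) b : ℂ) = l2Metric ψ J a b := by
  rw [kahlerForm_acs_left hJ, l2Metric, spinIntegral_eq]
  rfl

section Families

variable {P : Type*} [NormedAddCommGroup P] [NormedSpace ℝ P] {U : Set P} {A : P → EndField n M}

lemma isSmoothFamily_mul_velocity_mul (hA : IsSmoothFamily U A) (hU : IsOpen U) (v w : P) :
    IsSmoothFamily U fun t (x : M) => A t x * (velocity A t v x * velocity A t w x) :=
  hA.mul ((hA.velocity hU v).mul (hA.velocity hU w))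

lemma contDiffOn_kahlerForm (hψ : IsSmoothForm ψ) (hpure : ∀ x, IsPure (ψ x))
    (hnondeg : ∀ x, IsNondegenerate (ψ x)) (hU : IsOpen U) (hA : IsSmoothFamily U A) (v w : P) :
    ContDiffOn ℝ ∞ (fun t => kahlerForm ψ (A t) (velocity A t v) (velocity A t w)) U :=
  (contDiffOn_spinReal hψ hpure hnondeg hU (isSmoothFamily_mul_velocity_mul hA hU v w).trace).neg

lemma fderiv_kahlerForm (hψ : IsSmoothForm ψ) (hpure : ∀ x, IsPure (ψ x))
    (hnondeg : ∀ x, IsNondegenerate (ψ x)) (hU : IsOpen U) (hA : IsSmoothFamily U A)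
    {t : P} (ht : t ∈ U) (u v w : P) :
    fderiv ℝ (fun t => kahlerForm ψ (A t) (velocity A t v) (velocity A t w)) t u =
      -spinReal ψ fun x => tr (velocity (fun s x => A s x *
        (velocity A s v x * velocity A s w x)) t u x) := by
  have hB := isSmoothFamily_mul_velocity_mul hA hU v w
  have h1 := fderiv_spinReal hψ hpure hnondeg hU hB.trace ht u
  have h2 : fderiv ℝ (fun t => kahlerForm ψ (A t) (velocity A t v) (velocity A t w)) t =
      -fderiv ℝ (fun t => spinReal ψ fun x => tr (A t x *
        (velocity A t v x * velocity A t w x))) t := fderiv_fun_neg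
  rw [h2, neg_apply, h1]
  congr 2
  exact funext fun x => fderiv_trace hB hU ht u x

lemma tr_velocity_mul (hU : IsOpen U) (hA : IsSmoothFamily U A) {t : P} (ht : t ∈ U) (u v w : P)
    (x : M) : tr (velocity (fun s x => A s x * (velocity A s v x * velocity A s w x)) t u x) =
      tr (velocity A t u x * (velocity A t v x * velocity A t w x)) +
      tr (A t x * (velocity (fun s => velocity A s v) t u x * velocity A t w x)) +
      tr (A t x * (velocity A t v x * velocity (fun s => velocity A s w) t u x)) := by
  have hv := hA.velocity hU v
  have hw := hA.velocity hU w
  rw [velocity_mul hA (hv.mul hw) hU ht u x, velocity_mul hv hw hU ht u x]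
  exact tr_leibniz _ _ _ _ _ _

/-- The integrand in the exterior derivative of the Kähler form vanishes. -/
lemma tr_velocity_mul_cyclic (hU : IsOpen U) (hA : IsSmoothFamily U A)
    (hc : ∀ t ∈ U, A t ∈ Compatible ψ) {t : P} (ht : t ∈ U) (u v w : P) (x : M) :
    tr (velocity (fun s x => A s x * (velocity A s v x * velocity A s w x)) t u x) +
      tr (velocity (fun s x => A s x * (velocity A s w x * velocity A s u x)) t v x) +
      tr (velocity (fun s x => A s x * (velocity A s u x * velocity A s v x)) t w x) = 0 := by
  have ha : ∀ v, velocity A t v x * A t x = -(A t x * velocity A t v x) := fun v =>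
    ((tangentAt_iff.1 (velocity_mem_tangentAt hU hA hc ht v)).2 x).mul_J
  rw [tr_velocity_mul hU hA ht u v w x, tr_velocity_mul hU hA ht v w u x,
    tr_velocity_mul hU hA ht w u v x, velocity_velocity_comm hA hU ht u w x,
    velocity_velocity_comm hA hU ht v u x, velocity_velocity_comm hA hU ht w v x]
  exact tr_closed ((hc t ht).1.2 x).mul_self (ha u) (ha v) (ha w) _ _ _

lemma isSmoothScalarFamily_const_add {f g : M → ℝ}
    (hf : IsSmoothScalarFamily n (Set.univ : Set ℝ) fun _ => f)
    (hg : IsSmoothScalarFamily n (Set.univ : Set ℝ) fun _ => g) :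
    IsSmoothScalarFamily n (Set.univ : Set ℝ) fun _ x => f x + g x := fun c => (hf c).add (hg c)

/-- The pullback of the Kähler form to a family is closed: after differentiation under the integral
sign the integrand vanishes pointwise. -/
theorem kahlerForm_closed (hψ : IsSmoothForm ψ) (hpure : ∀ x, IsPure (ψ x))
    (hnondeg : ∀ x, IsNondegenerate (ψ x)) (hU : IsOpen U) (hA : IsSmoothFamily U A)
    (hc : ∀ t ∈ U, A t ∈ Compatible ψ) {t : P} (ht : t ∈ U) (u v w : P) :
    fderiv ℝ (fun t => kahlerForm ψ (A t) (velocity A t v) (velocity A t w)) t u +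
      fderiv ℝ (fun t => kahlerForm ψ (A t) (velocity A t w) (velocity A t u)) t v +
      fderiv ℝ (fun t => kahlerForm ψ (A t) (velocity A t u) (velocity A t v)) t w = 0 := by
  have hs : ∀ u v w : P, IsSmoothScalarFamily n (Set.univ : Set ℝ) fun _ (x : M) =>
      tr (velocity (fun s x => A s x * (velocity A s v x * velocity A s w x)) t u x) :=
    fun u v w => ((((isSmoothFamily_mul_velocity_mul hA hU v w).velocity hU u).isSmoothField
      ht).isSmoothFamily Set.univ).trace
  rw [fderiv_kahlerForm hψ hpure hnondeg hU hA ht, fderiv_kahlerForm hψ hpure hnondeg hU hA ht,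
    fderiv_kahlerForm hψ hpure hnondeg hU hA ht, ← neg_add, ← neg_add, neg_eq_zero,
    ← spinReal_add hψ hpure hnondeg (hs u v w) (hs v w u),
    ← spinReal_add hψ hpure hnondeg (isSmoothScalarFamily_const_add (hs u v w) (hs v w u))
      (hs w u v)]
  have h0 : (fun x : M =>
      tr (velocity (fun s x => A s x * (velocity A s v x * velocity A s w x)) t u x) +
      tr (velocity (fun s x => A s x * (velocity A s w x * velocity A s u x)) t v x) +
      tr (velocity (fun s x => A s x * (velocity A s u x * velocity A s v x)) t w x)) =
      fun x => 0 * (0 : ℝ) := by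
    exact funext fun x => (tr_velocity_mul_cyclic hU hA hc ht u v w x).trans (zero_mul _).symm
  rw [h0, spinReal_smul, zero_mul]

end Families

theorem isKahlerForm_kahlerForm (hψ : IsSmoothForm ψ) (hpure : ∀ x, IsPure (ψ x))
    (hnondeg : ∀ x, IsNondegenerate (ψ x)) : IsKahlerForm ψ (kahlerForm ψ) where
  add_left := by
    intro J hJ a ha b hb c hc
    have hs : ∀ a ∈ tangentAt ψ J, IsSmoothScalarFamily n (Set.univ : Set ℝ) fun _ (x : M) =>
        tr (J x * (a x * c x)) := fun a ha =>
      isSmoothScalarFamily_tr_mul_mul hJ.1.1 ha.1 hc.1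
    rw [kahlerForm, kahlerForm, kahlerForm, ← neg_add,
      ← spinReal_add hψ hpure hnondeg (hs a ha) (hs b hb)]
    congr 2
    exact funext fun x => tr_mul_add_mul _ _ _ _
  smul_left := by
    intro J _ r a _ b _
    rw [kahlerForm, kahlerForm, mul_neg, ← spinReal_smul]
    congr 2
    exact funext fun x => tr_mul_smul_mul r _ _ _
  antisymm := by
    intro J _ a ha b _
    have h : (fun x => tr (J x * (a x * b x))) = fun x : M => (-1) * tr (J x * (b x * a x)) :=
      funext fun x => (tr_antisymm ((tangentAt_iff.1 ha).2 x).mul_J).trans (neg_one_mul _).symm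
    rw [kahlerForm, kahlerForm, h, spinReal_smul, neg_one_mul]
  smooth := fun m U A hU _ hA v w => contDiffOn_kahlerForm hψ hpure hnondeg hU hA v w
  closed := fun m U A hU hc hA t ht u v w => kahlerForm_closed hψ hpure hnondeg hU hA hc ht u v w
  invariant := by
    intro J hJ a ha b _
    rw [kahlerForm, kahlerForm]
    congr 2
    exact funext fun x => tr_invariant (hJ.1.2 x).mul_self ((tangentAt_iff.1 ha).2 x).mul_J
  pos := by
    intro J hJ a ha h0
    rw [kahlerForm_acs_left hJ]
    have hp : ∀ x, a x ≠ 0 → 0 < tr (a x * a x) := fun x hx =>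
      tr_mul_self_pos (genPairing_comm (V := Tan n x)) (hJ.2.2 x) ((tangentAt_iff.1 ha).2 x) hx
    obtain ⟨x₀, hx₀⟩ := Function.ne_iff.1 h0
    refine spinReal_pos hψ hpure hnondeg (isSmoothScalarFamily_tr_mul ha.1 ha.1) (fun x => ?_)
      (hp x₀ hx₀)
    by_cases hx : a x = 0
    · rw [hx, mul_zero, tr_zero]
    · exact (hp x hx).le

end KahlerForm

end GenKahler

theorem mainTheorem4 (n : ℕ) (M : Type*) [TopologicalSpace M] [T2Space M] [CompactSpace M]
    [ChartedSpace (Eu n) M] [IsManifold (𝓡 (2 * n)) ∞ M]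
    (ψ : FormField n M) (hψ : IsSmoothForm ψ)
    (hpure : ∀ x, IsPure (ψ x)) (hnondeg : ∀ x, IsNondegenerate (ψ x)) :
    -- the model fibre is the homogeneous space `U(n,n) / (U(n) × U(n))`
    (∃ Θ : (Unn n ⧸ UnUn n) ≃ₜ modelFibre n, ∀ g : Unn n,
      (Θ (QuotientGroup.mk g) : ModelSpace n →L[ℝ] ModelSpace n) =
        matrixEnd ((g : GL (Fin n ⊕ Fin n) ℂ).val * modelBase n *
          ((g : GL (Fin n ⊕ Fin n) ℂ)⁻¹).val)) ∧
    -- local smooth frames, isometric and complex linear, trivialize the bundle of fibres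
    (∀ x₀ : M, ∃ U : Set M, IsOpen U ∧ x₀ ∈ U ∧
      ∃ L : ∀ x : M, ModelSpace n ≃L[ℝ] GenTangent (Tan n x),
        (∀ c : M, ContMDiffOn (𝓡 (2 * n)) 𝓘(ℝ, ModelSpace n →L[ℝ] GenTangent (Eu n)) ∞
          (fun x => (genCoord c x).comp (L x : ModelSpace n →L[ℝ] GenTangent (Tan n x)))
          (U ∩ (chartAt (Eu n) c).source)) ∧
        ∀ x ∈ U,
          (∀ v, L x (modelI n v) = spinorStructure ψ x (L x v)) ∧
          (∀ v w, genPairing (Tan n x) (L x v) (L x w) = modelForm n v w) ∧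
          ∀ J : GenTangent (Tan n x) →L[ℝ] GenTangent (Tan n x), J ∈ fibre ψ x ↔
            ((L x).symm : GenTangent (Tan n x) →L[ℝ] ModelSpace n).comp
              (J.comp (L x : ModelSpace n →L[ℝ] GenTangent (Tan n x))) ∈ modelFibre n) ∧
    -- the compatible structures are the smooth sections of this bundle
    (∀ J : EndField n M, J ∈ Compatible ψ ↔ IsSmoothField J ∧ ∀ x, J x ∈ fibre ψ x) ∧
    -- the tangent spaces consist of the velocities of smooth families
    (∀ (m : ℕ) (U : Set (EuclideanSpace ℝ (Fin m)))
      (A : EuclideanSpace ℝ (Fin m) → EndField n M), IsOpen U → (∀ t ∈ U, A t ∈ Compatible ψ) →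
      IsSmoothFamily U A → ∀ t ∈ U, ∀ v, velocity A t v ∈ tangentAt ψ (A t)) ∧
    (∀ J ∈ Compatible ψ, ∀ a ∈ tangentAt ψ J, ∃ (U : Set ℝ) (A : ℝ → EndField n M),
      IsOpen U ∧ 0 ∈ U ∧ (∀ t ∈ U, A t ∈ Compatible ψ) ∧ IsSmoothFamily U A ∧
      A 0 = J ∧ velocity A 0 1 = a) ∧
    -- the almost complex structure is integrable
    IsIntegrable ψ ∧
    -- the `L²` form is a (real) Kähler form, with the `L²` metric as Kähler metric
    ∃ Ω : EndField n M → EndField n M → EndField n M → ℝ,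
      (∀ J ∈ Compatible ψ, ∀ a ∈ tangentAt ψ J, ∀ b ∈ tangentAt ψ J,
        (Ω J a b : ℂ) = l2Form ψ J a b ∧ (Ω J (acs J a) b : ℂ) = l2Metric ψ J a b) ∧
      IsKahlerForm ψ Ω := by
  refine ⟨exists_modelHomeomorph n, fun x₀ => ?_, fun J => mem_compatible_iff hψ hpure hnondeg,
    fun m U A hU hc hA t ht v => velocity_mem_tangentAt hU hA hc ht v,
    fun J hJ a ha => exists_family_of_mem_tangentAt hJ ha, isIntegrable ψ, kahlerForm ψ,
    fun J hJ a _ b _ => ⟨ofReal_kahlerForm J a b, ofReal_kahlerForm_acs_left hJ a b⟩,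
    isKahlerForm_kahlerForm hψ hpure hnondeg⟩
  obtain ⟨U, hU, hx₀, L, hLs, hL⟩ := exists_localFrame hψ hpure hnondeg x₀
  exact ⟨U, hU, hx₀, L, hLs, fun x hx => ⟨(hL x hx).1, (hL x hx).2,
    isGenKahlerPair_conj_iff (L x) (hL x hx).2 (hL x hx).1⟩⟩
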